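/- **Setting.** Let $V=\mathbb R^n$ (or any $n$-dimensional real vector space) and let $Q\subset V$ be a quasilattice, i.e. the $\mathbb Z$-span of a finite set of vectors that spans $V$ over $\mathbb R$. Let $\Delta=\bigcap_{j=1}^d\{\mu\in V^*\mid\langle\mu,X_j\rangle\ge\lambda_j\}$ be an $n$-dimensional simple pointed polyhedron (it has a vertex, and each vertex lies on exactly $n$ facets) with exactly $d$ facets, whose normal vectors $X_1,\dots,X_d$ all lie in $Q$. *The toric quasifold of $(\Delta,\{X_j\},Q)$.* Let $\pi:\mathbb R^d\to V$, $\pi(e_j)=X_j$. Let $N=\{(e^{2\pi i a_j})_j\mid a\in\mathbb R^d,\ \pi(a)\in Q\}\subset T^d$ act on $\mathbb C^d$, let $J(z)=\sum_j(|z_j|^2+\lambda_j)e_j^*$, and let $\Psi(z)$ be the restriction of $J(z)$ to $\ker\pi$. Then $M=\Psi^{-1}(0)/N$ with the quotient topology. The quasitorus $D^n=V/Q\simeq T^d/N$ acts on $M$, with moment mapping $\Phi:M\to V^*$, $\Phi([z])=(\pi^*)^{-1}(J(z))$. For a vertex $\nu$ of $\Delta$, with facets through it indexed by $I$, $|I|=n$,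 write $X_j=\sum_{h\in I}a_{jh}X_h$. The corresponding chart of $M$ is $\tilde U_\nu/\Gamma_\nu\to M$, $[z]\mapsto[z:w]$, where $\tilde U_\nu\subset\mathbb C^n$ is the set of $z$ with $r_j(z)=\sum_{h\in I}a_{jh}(|z_h|^2+\lambda_h)-\lambda_j>0$ for $j\notin I$, $w_j=\sqrt{r_j(z)}$ for $j\notin I$, and $\Gamma_\nu=\{t\in N\mid t_j=1\text{ for }j\notin I\}$; its symplectic form is the pull-back by $z\mapsto(z,w)$ of $\frac1{2\pi i}\sum_j dz_j\wedge d\bar z_j$. These charts define the symplectic quasifold structure $\omega$ of $M$. *Quasifolds.* A symplectic quasifold of dimension $2m$ is a topological space covered by open sets with homeomorphisms $\tilde U/\Gamma\to U$, where $\tilde U$ is a connected, simply connected open subset of a $2m$-dimensional real vector space with a $\Gamma$-invariant symplectic form, and $\Gamma$ is a countable group acting on $\tilde U$ by diffeomorphisms with connected dense free locus. Whenever two charts meet, the preimages of the intersection in the chart domains, with the group actions, satisfy the same conditions (open, connected, connected dense free locus), and the changes of charts lift locally to symplectic diffeomorphisms. Smooth maps and symplectomorphisms of quasifolds are defined through local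 lifts to smooth maps and to symplectic diffeomorphisms in charts. **Theorem.** Let $\mathfrak k\subset V$ be a $k$-dimensional subspace, $j:\mathfrak k\to V$ the inclusion, $p:V\to V/\mathfrak k$ the projection, and $K=\mathfrak k/(\mathfrak k\cap Q)\subset D^n$, acting on $M$ with moment mapping $\Phi_{\mathfrak k}=j^*\circ\Phi$. Assume that $0$ is a value of $\Phi_{\mathfrak k}$ and that $K$ acts on $\Phi_{\mathfrak k}^{-1}(0)$ with $0$-dimensional (i.e. countable) isotropy groups. Let $\Delta_{\mathfrak k}=\{\nu\in(V/\mathfrak k)^*\mid p^*\nu\in\Delta\}$ and let, after renumbering, $$\Delta_{\mathfrak k}=\bigcap_{j=1}^{d_{\mathfrak k}}\{\nu\in(V/\mathfrak k)^*\mid\langle\nu,p(X_j)\rangle\ge\lambda_j\}$$ be a presentation by an irredundant choice of $d_{\mathfrak k}$ among the $d$ half-spaces $\{\langle\nu,p(X_j)\rangle\ge\lambda_j\}$. Then: 1. $\Delta_{\mathfrak k}$ is an $(n-k)$-dimensional simple pointed polyhedron with exactly $d_{\mathfrak k}$ facets and normal vectors $p(X_1),\dots,p(X_{d_{\mathfrak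 k}})$ in the quasilattice $p(Q)$, and its toric space $X_{\mathfrak k}$, constructed as above from $(\Delta_{\mathfrak k},\{p(X_1),\dots,p(X_{d_{\mathfrak k}})\},p(Q))$, is a $2(n-k)$-dimensional symplectic quasifold. 2. The reduced space $M_{\mathfrak k}=\Phi_{\mathfrak k}^{-1}(0)/K$, with the quotient topology, is a $2(n-k)$-dimensional symplectic quasifold with the reduced structure: if $\rho:\Phi_{\mathfrak k}^{-1}(0)\to M_{\mathfrak k}$ is the projection and $\iota:\Phi_{\mathfrak k}^{-1}(0)\to M$ the inclusion, then $\rho$ is a smooth submersion (it lifts locally to smooth maps and has smooth local sections through every point) and the symplectic form $\omega_{\mathfrak k}$ satisfies $\rho^*\omega_{\mathfrak k}=\iota^*\omega$. 3. The quasitorus $D^n/K\simeq(V/\mathfrak k)/p(Q)$ acts on $M_{\mathfrak k}$; this action, induced by that of $D^n$, is smooth and Hamiltonian, with moment mapping $M_{\mathfrak k}\to\ker j^*\simeq(V/\mathfrak k)^*$ induced by $\Phi$. 4. There is a homeomorphism $M_{\mathfrak k}\to X_{\mathfrak k}$ which is a symplectomorphism of quasifolds, is equivariant with respect to the identification $D^n/K\simeq(V/\mathfrak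 k)/p(Q)$, $[v]\mapsto[p(v)]$, and intertwines the moment mappings. -/

import Mathlib

open scoped ContDiff Topology

/-! ## Symplectic quasifolds -/

/-- The data of a symplectic quasifold chart on `M`, modelled on the real vector space `E`:
a domain `dom ⊆ E`, a group `Γ` acting on it, a map `proj : dom → M` which is to induce a
homeomorphism of `dom / Γ` onto an open subset of `M`, and a 2-form on `dom`.  (`act` and `form`
are only used at points of `dom`.)  The axioms are in `SymplecticChart.IsChart`. -/
structure SymplecticChart (E : Type*) [NormedAddCommGroup E] [NormedSpace ℝ E] (M : Type*) where
  dom : Set E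
  Γ : Type
  [group : Group Γ]
  act : Γ → E → E
  proj : dom → M
  form : E → E [⋀^Fin 2]→L[ℝ] ℝ

namespace SymplecticChart

variable {E : Type*} [NormedAddCommGroup E] [NormedSpace ℝ E]
  {F : Type*} [NormedAddCommGroup F] [NormedSpace ℝ F] {M N : Type*}

instance (c : SymplecticChart E M) : Group c.Γ := c.group

/-- The point `x` of the chart domain represents the point `m` of `M`. -/
def Rep (c : SymplecticChart E M) (x : E) (m : M) : Prop :=
  ∃ hx : x ∈ c.dom, c.proj ⟨x, hx⟩ = m

/-- The preimage, in the domain of `c`, of the intersection of the images of `c` and `c'`. -/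
def overlap (c c' : SymplecticChart E M) : Set E :=
  {x | ∃ m, c.Rep x m ∧ ∃ y, c'.Rep y m}

/-- The points of `W` at which the action of `Γ` is free. -/
def freeSet (c : SymplecticChart E M) (W : Set E) : Set E :=
  {x | x ∈ W ∧ ∀ γ : c.Γ, c.act γ x = x → γ = 1}

/-- `W / Γ` is a (sub)model: `W` is open and connected, the countable group `Γ` acts on `W` by
diffeomorphisms, and the set of points where the action is free is connected and dense in `W`. -/
structure IsModel (c : SymplecticChart E M) (W : Set E) : Prop where
  isOpen : IsOpen W
  isConnected : IsConnected W
  countable : Countable c.Γ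
  act_mem : ∀ γ, ∀ x ∈ W, c.act γ x ∈ W
  one_act : ∀ x ∈ W, c.act 1 x = x
  mul_act : ∀ γ γ', ∀ x ∈ W, c.act (γ * γ') x = c.act γ (c.act γ' x)
  smooth_act : ∀ γ, ContDiffOn ℝ ∞ (c.act γ) W
  free_connected : IsConnected (c.freeSet W)
  free_dense : W ⊆ closure (c.freeSet W)

/-- `c` is a symplectic quasifold chart: `dom / Γ` is a model with simply connected `dom`, `proj`
induces a homeomorphism of `dom / Γ` onto an open subset of `M`, and `form` is a `Γ`-invariant
symplectic form on `dom`. -/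
structure IsChart [TopologicalSpace M] (c : SymplecticChart E M) : Prop where
  isModel : c.IsModel c.dom
  simplyConnected : SimplyConnectedSpace c.dom
  continuous : Continuous c.proj
  isOpenMap : IsOpenMap c.proj
  fibre : ∀ x y : c.dom, c.proj x = c.proj y ↔ ∃ γ, c.act γ x = y
  form_smooth : ContDiffOn ℝ ∞ c.form c.dom
  form_closed : ∀ x ∈ c.dom, extDeriv c.form x = 0
  form_nondegenerate : ∀ x ∈ c.dom, ∀ u, (∀ v, c.form x ![u, v] = 0) → u = 0
  form_invariant : ∀ γ, ∀ x ∈ c.dom,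
    (c.form (c.act γ x)).compContinuousLinearMap (fderiv ℝ (c.act γ) x) = c.form x

/-- Near `x`, the map `f : M → N` lifts to a symplectic diffeomorphism (between open subsets of
the chart domains) that sends `x` to `y`. -/
def HasSymplecticLift (c : SymplecticChart E M) (c' : SymplecticChart F N) (f : M → N)
    (x : E) (y : F) : Prop :=
  ∃ h : OpenPartialHomeomorph E F,
    x ∈ h.source ∧ h x = y ∧ h.source ⊆ c.dom ∧
    ContDiffOn ℝ ∞ h h.source ∧ ContDiffOn ℝ ∞ h.symm h.target ∧
    (∀ x' ∈ h.source, ∀ m, c.Rep x' m → c'.Rep (h x') (f m)) ∧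
    (∀ x' ∈ h.source, (c'.form (h x')).compContinuousLinearMap (fderiv ℝ h x') = c.form x')

/-- Two charts are compatible: if their images meet, then the preimages of the intersection are
submodels, and the change of charts lifts to symplectic diffeomorphisms.  (The lifts are local, with
prescribed value at one point: a lift need not exist globally on the overlap, but only on its
universal covering.) -/
def Compatible (c c' : SymplecticChart E M) : Prop :=
  (c.overlap c').Nonempty →
    c.IsModel (c.overlap c') ∧ c'.IsModel (c'.overlap c) ∧
    ∀ x y m, c.Rep x m → c'.Rep y m → c.HasSymplecticLift c' id x y

end SymplecticChart

/-- A family of symplectic quasifold charts on `M`. -/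
structure SymplecticAtlas (E : Type*) [NormedAddCommGroup E] [NormedSpace ℝ E] (M : Type*) where
  Index : Type
  chart : Index → SymplecticChart E M

namespace SymplecticAtlas

variable {E : Type*} [NormedAddCommGroup E] [NormedSpace ℝ E]
  {F : Type*} [NormedAddCommGroup F] [NormedSpace ℝ F] {M N : Type*}

/-- The atlas makes `M` a symplectic quasifold of dimension `dim`. -/
structure IsSymplecticQuasifold [TopologicalSpace M] (A : SymplecticAtlas E M) (dim : ℕ) :
    Prop where
  finiteDimensional : FiniteDimensional ℝ E
  finrank_eq : Module.finrank ℝ E = dim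
  isChart : ∀ i, (A.chart i).IsChart
  cover : ∀ m : M, ∃ i x, (A.chart i).Rep x m
  compatible : ∀ i i', (A.chart i).Compatible (A.chart i')

/-- `f` has symplectic local lifts to diffeomorphisms in all charts: it is a local diffeomorphism
of quasifolds that pulls the symplectic form of `N` back to that of `M`. -/
def IsLocalSymplectomorphism (A : SymplecticAtlas E M) (B : SymplecticAtlas F N) (f : M → N) :
    Prop :=
  ∀ i i' x y m, (A.chart i).Rep x m → (B.chart i').Rep y (f m) →
    (A.chart i).HasSymplecticLift (B.chart i') f x y

/-- A symplectomorphism of symplectic quasifolds: a homeomorphism which, with its inverse, is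
smooth (that is, lifts to smooth maps in charts) and which preserves the symplectic forms. -/
def IsSymplectomorphism [TopologicalSpace M] [TopologicalSpace N] (A : SymplecticAtlas E M)
    (B : SymplecticAtlas F N) (f : M ≃ₜ N) : Prop :=
  A.IsLocalSymplectomorphism B f ∧ B.IsLocalSymplectomorphism A f.symm

/-- Let `ι : L → M` be the inclusion of a level set in the symplectic quasifold `(M, ω)` and
`ρ : L → N` a quotient map.  `B` is the reduced symplectic structure `ω_N` on `N`, that is,
`ρ` is a smooth submersion of `L` onto `N` with `ρ^* ω_N = ι^* ω`.  In charts: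
through every point of `L` passes a smooth local section of `ρ`, which pulls `ω` back to `ω_N`;
and `ρ` lifts to the restriction to (the preimage of) `L` of a smooth map, whose derivative
carries `ω` on vectors tangent to `L` to `ω_N`. -/
def IsReduction (A : SymplecticAtlas E M) (L : Set M) (ρ : L → N) (B : SymplecticAtlas F N) :
    Prop :=
  ∀ i i' x y, ∀ m : L, (A.chart i).Rep x m → (B.chart i').Rep y (ρ m) →
    (∃ (O : Set F) (s : F → E), IsOpen O ∧ y ∈ O ∧ O ⊆ (B.chart i').dom ∧ ContDiffOn ℝ ∞ s O ∧
      s y = x ∧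
      (∀ y' ∈ O, ∃ m' : L, (A.chart i).Rep (s y') m' ∧ (B.chart i').Rep y' (ρ m')) ∧
      ∀ y' ∈ O, ((A.chart i).form (s y')).compContinuousLinearMap (fderiv ℝ s y') =
        (B.chart i').form y') ∧
    (∃ (O : Set E) (r : E → F), IsOpen O ∧ x ∈ O ∧ O ⊆ (A.chart i).dom ∧ ContDiffOn ℝ ∞ r O ∧
      r x = y ∧
      (∀ x' ∈ O, ∀ m' : L, (A.chart i).Rep x' m' → (B.chart i').Rep (r x') (ρ m')) ∧
      ∀ x' ∈ O, ∀ m' : L, (A.chart i).Rep x' m' →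
        ∀ u ∈ tangentConeAt ℝ {z | ∃ m'' : L, (A.chart i).Rep z m''} x',
        ∀ v ∈ tangentConeAt ℝ {z | ∃ m'' : L, (A.chart i).Rep z m''} x',
          (B.chart i').form (r x') ![fderiv ℝ r x' u, fderiv ℝ r x' v] =
            (A.chart i).form x' ![u, v])

/-- `G` is a group with Lie algebra the real vector space `W` and exponential `exp : W → G` (a
quasitorus `W / Q`, with `exp` the projection), acting on `M`.  The action is smooth and
Hamiltonian with moment mapping `Φ : M → W^*`:
* `(w, m) ↦ exp w · m` lifts to smooth maps in charts (`W` being identified with a coordinate space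
  by an arbitrary linear isomorphism);
* every group element acts as a local symplectomorphism;
* `Φ` is invariant, and for `ξ ∈ W` the function `⟨Φ, ξ⟩` is in every chart a smooth function `H`
  with `dH = ω(Y, ·)`, where `Y` is the fundamental vector field of `ξ`, i.e. the vector field
  whose integral curves project to the orbits `t ↦ exp (t ξ) · m`. -/
structure IsHamiltonianAction {W G : Type*} [AddCommGroup W] [Module ℝ W] [AddCommGroup G]
    [AddAction G M] (A : SymplecticAtlas E M) (exp : W →+ G) (Φ : M → Module.Dual ℝ W) :
    Prop where
  exp_surjective : Function.Surjective exp
  smooth : ∀ (ℓ : (Fin (Module.finrank ℝ W) → ℝ) ≃ₗ[ℝ] W) (i i' : A.Index)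
    (v : Fin (Module.finrank ℝ W) → ℝ) (x y : E) (m : M),
    (A.chart i).Rep x m → (A.chart i').Rep y (exp (ℓ v) +ᵥ m) →
    ∃ (O : Set ((Fin (Module.finrank ℝ W) → ℝ) × E)) (f : (Fin (Module.finrank ℝ W) → ℝ) × E → E),
      IsOpen O ∧ (v, x) ∈ O ∧ ContDiffOn ℝ ∞ f O ∧ f (v, x) = y ∧
      ∀ v' x' m', (v', x') ∈ O → (A.chart i).Rep x' m' →
        (A.chart i').Rep (f (v', x')) (exp (ℓ v') +ᵥ m')
  symplectic : ∀ g : G, A.IsLocalSymplectomorphism A (fun m => g +ᵥ m)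
  invariant : ∀ (g : G) (m : M), Φ (g +ᵥ m) = Φ m
  moment : ∀ (i : A.Index) (ξ : W), ∃ (H : E → ℝ) (Y : E → E),
    ContDiffOn ℝ ∞ H (A.chart i).dom ∧ ContDiffOn ℝ ∞ Y (A.chart i).dom ∧
    ∀ x m, (A.chart i).Rep x m →
      H x = Φ m ξ ∧
      (∃ c : ℝ → E, c 0 = x ∧ ∀ᶠ t in 𝓝 (0 : ℝ),
        HasDerivAt c (Y (c t)) t ∧ (A.chart i).Rep (c t) (exp (t • ξ) +ᵥ m)) ∧
      ∀ u, (A.chart i).form x ![Y x, u] = fderiv ℝ H x u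

end SymplecticAtlas

/-! ## A residual action on an orbit space -/

section Residual

variable {G X : Type*} [AddCommGroup G] [AddAction G X] (H : AddSubgroup G)

/-- If the abelian group `G` acts on `X` and `H` is a subgroup, then `G ⧸ H` acts on `X / H`. -/
instance residualAction : AddAction (G ⧸ H) (AddAction.orbitRel.Quotient H X) where
  vadd := Quotient.map₂ (fun (g : G) (x : X) => g +ᵥ x) (by
    rintro g g' hg x x' ⟨h, rfl⟩
    have hg' : -g + g' ∈ H := QuotientAddGroup.leftRel_apply.mp hg
    refine ⟨h - ⟨-g + g', hg'⟩, ?_⟩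
    simp only [AddSubgroup.vadd_def, AddSubgroup.coe_sub, vadd_vadd]
    congr 1
    abel)
  zero_vadd := by
    rintro ⟨x⟩
    exact congrArg (Quotient.mk _) (zero_vadd G x)
  add_vadd := by
    rintro ⟨g⟩ ⟨g'⟩ ⟨x⟩
    exact congrArg (Quotient.mk _) (add_vadd g g' x)

end Residual

/-! ## The standard torus action on `ℂ^d` -/

/-- The exponential map `ℝ^d → T^d = (S^1)^d`, `a ↦ (exp (2 π i a_j))_j`. -/
noncomputable def torusExp {ι : Type} (a : ι → ℝ) : ι → Circle :=
  fun j => Circle.exp (2 * Real.pi * a j)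

/-- The standard symplectic form `(1 / 2πi) ∑ dz_j ∧ dz̄_j` on `ℂ^d`, normalized so that the
standard action of `T^d = ℝ^d / ℤ^d` has moment mapping `∑ |z_j|^2 e_j^*`. -/
noncomputable def stdSymplecticForm (ι : Type) [Fintype ι] : (ι → ℂ) [⋀^Fin 2]→L[ℝ] ℝ where
  toFun v := -(1 / Real.pi) * ∑ j, ((v 0 j).re * (v 1 j).im - (v 0 j).im * (v 1 j).re)
  map_update_add' v i x y := by
    fin_cases i <;>
    · simp only [Fin.zero_eta, Fin.mk_one, Function.update_self, Pi.add_apply, Complex.add_re,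
        Complex.add_im, ne_eq, one_ne_zero, zero_ne_one, not_false_eq_true, Function.update_of_ne]
      rw [← mul_add, ← Finset.sum_add_distrib]
      congr 1
      exact Finset.sum_congr rfl fun j _ => by ring
  map_update_smul' v i c x := by
    fin_cases i <;>
    · simp only [Fin.zero_eta, Fin.mk_one, Function.update_self, Pi.smul_apply, Complex.smul_re,
        Complex.smul_im, ne_eq, one_ne_zero, zero_ne_one, not_false_eq_true, Function.update_of_ne,
        smul_eq_mul]
      rw [mul_left_comm, Finset.mul_sum Finset.univ _ c]
      congr 1
      exact Finset.sum_congr rfl fun j _ => by ring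
  cont := by fun_prop
  map_eq_zero_of_eq' v i j hij hne := by
    have h01 : v 0 = v 1 := by
      fin_cases i <;> fin_cases j <;> simp_all
    simp [h01, mul_comm]

/-! ## The generalized Delzant construction -/

/-- The polyhedron `{μ ∈ V^* | ⟨μ, X_j⟩ ≥ λ_j for all j ∈ J}`. -/
def halfSpaceInter {V : Type*} [AddCommGroup V] [Module ℝ V] {ι : Type} (X : ι → V) (lam : ι → ℝ)
    (J : Set ι) : Set (Module.Dual ℝ V) :=
  {μ | ∀ j ∈ J, lam j ≤ μ (X j)}

/-- A triple `(Δ, {X_1, …, X_d}, Q)`: a quasilattice `Q` in the vector space `V`, of dimension `n`,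
and an `n`-dimensional simple pointed polyhedron
`Δ = {μ ∈ V^* | ⟨μ, X_j⟩ ≥ λ_j for j = 1, …, d}` with exactly `d` facets and with normal vectors
`X_1, …, X_d` in `Q`. -/
structure ToricTriple (V : Type*) [AddCommGroup V] [Module ℝ V] (ι : Type) where
  normal : ι → V
  lam : ι → ℝ
  Q : AddSubgroup V
  /-- `Q` is the `ℤ`-span of a finite set of vectors that span `V` -/
  quasilattice : ∃ S : Finset V, Submodule.span ℝ (S : Set V) = ⊤ ∧
    AddSubgroup.closure (S : Set V) = Q
  normal_mem : ∀ j, normal j ∈ Q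
  /-- `Δ` has dimension `n` -/
  full_dim : Module.finrank ℝ (vectorSpan ℝ (halfSpaceInter normal lam Set.univ)) =
    Module.finrank ℝ V
  /-- each `{μ ∈ Δ | ⟨μ, X_j⟩ = λ_j}` is a facet, i.e. has dimension `n - 1` -/
  facet_nonempty : ∀ j, {μ ∈ halfSpaceInter normal lam Set.univ | μ (normal j) = lam j}.Nonempty
  facet_dim : ∀ j, Module.finrank ℝ
    (vectorSpan ℝ {μ ∈ halfSpaceInter normal lam Set.univ | μ (normal j) = lam j}) + 1 =
    Module.finrank ℝ V
  /-- the `d` facets are distinct -/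
  facet_injective : Function.Injective
    fun j => {μ ∈ halfSpaceInter normal lam Set.univ | μ (normal j) = lam j}
  /-- `Δ` has a vertex -/
  pointed : ((halfSpaceInter normal lam Set.univ).extremePoints ℝ).Nonempty
  /-- every vertex lies on exactly `n` facets -/
  simple : ∀ ν ∈ (halfSpaceInter normal lam Set.univ).extremePoints ℝ,
    {j | ν (normal j) = lam j}.ncard = Module.finrank ℝ V

namespace ToricTriple

variable {V : Type*} [AddCommGroup V] [Module ℝ V] {ι : Type}

/-- The polyhedron `Δ ⊆ V^*`. -/
def polyhedron (T : ToricTriple V ι) : Set (Module.Dual ℝ V) :=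
  halfSpaceInter T.normal T.lam Set.univ

variable [Fintype ι]

/-- At a vertex the normals of the facets through it span `V`. -/
theorem span_active (T : ToricTriple V ι) {ν : Module.Dual ℝ V}
    (hν : ν ∈ T.polyhedron.extremePoints ℝ) :
    Submodule.span ℝ (T.normal '' {j | ν (T.normal j) = T.lam j}) = ⊤ := by
  by_contra hne
  obtain ⟨μ, hμ0, hμ⟩ := Submodule.exists_le_ker_of_lt_top _ (lt_top_iff_ne_top.mpr hne)
  have hact : ∀ j, ν (T.normal j) = T.lam j → μ (T.normal j) = 0 := fun j hj =>
    hμ (Submodule.subset_span ⟨j, hj, rfl⟩)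
  have hev : ∀ᶠ ε in 𝓝 (0 : ℝ), ∀ j,
      T.lam j ≤ ν (T.normal j) + ε * μ (T.normal j) := by
    rw [Filter.eventually_all]
    intro j
    rcases (hν.1 j (Set.mem_univ j)).eq_or_lt with h | h
    · refine Filter.Eventually.of_forall fun ε => ?_
      rw [hact j h.symm, mul_zero, add_zero]
      exact h.le
    · have hc : Continuous fun ε : ℝ => ν (T.normal j) + ε * μ (T.normal j) := by fun_prop
      have := (hc.tendsto 0).eventually_const_lt (u := T.lam j) (by simpa using h)
      exact this.mono fun ε h => h.le
  obtain ⟨ε, hε, hball⟩ := Metric.eventually_nhds_iff.mp hev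
  have hmem : ∀ s : ℝ, |s| < ε → ν + s • μ ∈ T.polyhedron := by
    intro s hs j _
    simpa using hball (by simpa using hs) j
  have h2 : |ε / 2| < ε := by rw [abs_of_pos (by linarith)]; linarith
  have := hν.2 (hmem (ε / 2) h2) (hmem (-(ε / 2)) (by rwa [abs_neg]))
    ⟨1 / 2, 1 / 2, by norm_num, by norm_num, by norm_num, by module⟩
  have hz : (ε / 2) • μ = 0 := by simpa using this
  rcases smul_eq_zero.mp hz with h | h
  · linarith
  · exact hμ0 h

/-- The linear map `π : ℝ^d → V`, `e_j ↦ X_j`. -/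
noncomputable def piMap (T : ToricTriple V ι) : (ι → ℝ) →ₗ[ℝ] V :=
  Fintype.linearCombination ℝ T.normal

theorem piMap_surjective (T : ToricTriple V ι) : Function.Surjective T.piMap := by
  rw [← LinearMap.range_eq_top, piMap, Fintype.range_linearCombination]
  obtain ⟨ν, hν⟩ := T.pointed
  exact top_le_iff.mp ((T.span_active hν).symm.le.trans
    (Submodule.span_mono (Set.image_subset_range _ _)))

/-- The group `N`, the kernel of `Π : T^d → D = V / Q`: the elements `exp a` with
`π a ∈ Q`. -/
noncomputable def N (T : ToricTriple V ι) : Subgroup (ι → Circle) where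
  carrier := {t | ∃ a : ι → ℝ, T.piMap a ∈ T.Q ∧ torusExp a = t}
  one_mem' := ⟨0, by simp, by ext; simp [torusExp]⟩
  mul_mem' := by
    rintro _ _ ⟨a, ha, rfl⟩ ⟨b, hb, rfl⟩
    exact ⟨a + b, by simpa using add_mem ha hb, by
      ext; simp [torusExp, mul_add, Circle.exp_add]⟩
  inv_mem' := by
    rintro _ ⟨a, ha, rfl⟩
    exact ⟨-a, by simpa using ha, by ext; simp [torusExp, Circle.exp_neg]⟩

/-- The moment mapping `J(z) = ∑ (|z_j|^2 + λ_j) e_j^*` of the action of `T^d` on `ℂ^d`. -/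
noncomputable def J (T : ToricTriple V ι) (z : ι → ℂ) : Module.Dual ℝ (ι → ℝ) :=
  ∑ j, (‖z j‖ ^ 2 + T.lam j) • LinearMap.proj j

/-- The level set `Ψ⁻¹(0)` of `Ψ = i^* ∘ J`, with `i : ker π → ℝ^d` the inclusion, with its action
of `T^d`. -/
noncomputable def levelSet (T : ToricTriple V ι) : SubMulAction (ι → Circle) (ι → ℂ) where
  carrier := {z | T.J z ∘ₗ (LinearMap.ker T.piMap).subtype = 0}
  smul_mem' := by
    intro t z hz
    have : T.J (t • z) = T.J z := by simp [J, Circle.smul_def, Circle.norm_coe]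
    simpa [this] using hz

/-- The toric quasifold `M = Ψ⁻¹(0) / N`, as a topological space. -/
noncomputable abbrev Space (T : ToricTriple V ι) : Type := MulAction.orbitRel.Quotient T.N T.levelSet

/-- The class `[z]` in `M` of a point `z` of `Ψ⁻¹(0)`. -/
noncomputable def cls (T : ToricTriple V ι) (z : T.levelSet) : T.Space := Quotient.mk _ z

theorem cls_eq (T : ToricTriple V ι) {a b : ι → ℝ} (h : T.piMap a - T.piMap b ∈ T.Q)
    (z : T.levelSet) : T.cls (torusExp a • z) = T.cls (torusExp b • z) := by
  refine Quotient.sound ⟨⟨torusExp (a - b), a - b, by simpa using h, rfl⟩, ?_⟩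
  change torusExp (a - b) • torusExp b • z = _
  rw [smul_smul]
  congr 1
  ext j
  simp [torusExp, ← Circle.exp_add, ← mul_add]

theorem cls_smul_congr (T : ToricTriple V ι) (t : ι → Circle) {z z' : T.levelSet}
    (h : T.cls z = T.cls z') : T.cls (t • z) = T.cls (t • z') := by
  obtain ⟨s, hs⟩ := Quotient.exact h
  refine Quotient.sound ⟨s, ?_⟩
  change (s : ι → Circle) • z' = z at hs
  change (s : ι → Circle) • t • z' = t • z
  rw [smul_comm, hs]

theorem exists_lift (T : ToricTriple V ι) (δ : V ⧸ T.Q) :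
    ∃ a : ι → ℝ, (QuotientAddGroup.mk (T.piMap a) : V ⧸ T.Q) = δ := by
  obtain ⟨v, rfl⟩ := QuotientAddGroup.mk_surjective δ
  obtain ⟨a, rfl⟩ := T.piMap_surjective v
  exact ⟨a, rfl⟩

/-- The action of the quasitorus `D = V / Q ≃ T^d / N` on `M`: the class of `π a` acts as
`exp a` (see `vadd_cls`). -/
noncomputable instance (T : ToricTriple V ι) : VAdd (V ⧸ T.Q) T.Space where
  vadd δ := Quotient.lift (fun z => T.cls (torusExp (T.exists_lift δ).choose • z))
    fun _ _ h => T.cls_smul_congr _ (Quotient.sound h)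

theorem vadd_cls (T : ToricTriple V ι) (a : ι → ℝ) (z : T.levelSet) :
    (QuotientAddGroup.mk (T.piMap a) : V ⧸ T.Q) +ᵥ T.cls z = T.cls (torusExp a • z) := by
  refine T.cls_eq ?_ z
  have := (T.exists_lift (QuotientAddGroup.mk (T.piMap a) : V ⧸ T.Q)).choose_spec
  rw [← QuotientAddGroup.eq_zero_iff, QuotientAddGroup.mk_sub, this, sub_self]

noncomputable instance (T : ToricTriple V ι) : AddAction (V ⧸ T.Q) T.Space where
  zero_vadd := by
    rintro ⟨z⟩
    have h := T.vadd_cls 0 z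
    rw [map_zero] at h
    refine h.trans (congrArg T.cls ?_)
    convert one_smul (ι → Circle) z using 2
    ext; simp [torusExp]
  add_vadd := by
    rintro δ δ' ⟨z⟩
    obtain ⟨a, rfl⟩ := T.exists_lift δ
    obtain ⟨b, rfl⟩ := T.exists_lift δ'
    change _ +ᵥ T.cls z = _ +ᵥ (_ +ᵥ T.cls z)
    rw [vadd_cls, vadd_cls, ← QuotientAddGroup.mk_add, ← map_add, vadd_cls, smul_smul]
    congr 2
    ext j
    simp [torusExp, Circle.exp_add, mul_add]

theorem exists_moment (T : ToricTriple V ι) (z : T.levelSet) :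
    ∃ μ : Module.Dual ℝ V, T.piMap.dualMap μ = T.J z := by
  have h : T.J z ∈ LinearMap.range T.piMap.dualMap := by
    rw [LinearMap.range_dualMap_eq_dualAnnihilator_ker, Submodule.mem_dualAnnihilator]
    intro c hc
    exact LinearMap.congr_fun (z.2 : T.J z ∘ₗ (LinearMap.ker T.piMap).subtype = 0) ⟨c, hc⟩
  exact h

/-- The moment mapping `Φ : M → V^*` of the `D`-action, `Φ([z]) = (π^*)⁻¹ (J z)`. -/
noncomputable def Φ (T : ToricTriple V ι) : T.Space → Module.Dual ℝ V :=
  Quotient.lift (fun z => (T.exists_moment z).choose) (by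
    rintro z z' ⟨t, ht⟩
    refine LinearMap.dualMap_injective_of_surjective T.piMap_surjective ?_
    rw [(T.exists_moment z).choose_spec, (T.exists_moment z').choose_spec]
    change (t : ι → Circle) • z' = z at ht
    rw [← ht]
    simp [J, Circle.smul_def, Circle.norm_coe])

theorem Φ_cls (T : ToricTriple V ι) (z : T.levelSet) : T.piMap.dualMap (T.Φ (T.cls z)) = T.J z :=
  (T.exists_moment z).choose_spec

theorem Φ_vadd (T : ToricTriple V ι) (δ : V ⧸ T.Q) (m : T.Space) : T.Φ (δ +ᵥ m) = T.Φ m := by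
  obtain ⟨z, rfl⟩ : ∃ z, T.cls z = m := Quotient.exists_rep m
  obtain ⟨a, rfl⟩ := T.exists_lift δ
  refine LinearMap.dualMap_injective_of_surjective T.piMap_surjective ?_
  rw [vadd_cls, Φ_cls, Φ_cls]
  simp [J, Circle.smul_def, Circle.norm_coe]

/-! ### The atlas of `M`, indexed by the vertices of `Δ` -/

/-- A vertex of `Δ` with an enumeration `h ↦ X_{e h}` of the normals of the `n` facets through
it. -/
def VertexIndex (T : ToricTriple V ι) : Type :=
  {e : Fin (Module.finrank ℝ V) ↪ ι //
    ∃ ν ∈ T.polyhedron.extremePoints ℝ, Set.range e = {j | ν (T.normal j) = T.lam j}}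

/-- The `n` normals at a vertex form a basis of `V`. -/
noncomputable def vertexBasis (T : ToricTriple V ι) (e : T.VertexIndex) :
    Module.Basis (Fin (Module.finrank ℝ V)) ℝ V :=
  basisOfTopLeSpanOfCardEqFinrank (fun h => T.normal (e.1 h)) (by
    obtain ⟨ν, hν, he⟩ := e.2
    rw [show (fun h => T.normal (e.1 h)) = T.normal ∘ e.1 from rfl, Set.range_comp, he,
      T.span_active hν]) (by simp)

/-- The number `∑_h a_{jh} (|z_h|^2 + λ_h) - λ_j`, where `X_j = ∑_h a_{jh} X_h` in the basis of
the normals at the vertex. -/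
noncomputable def radicand (T : ToricTriple V ι) (e : T.VertexIndex)
    (z : Fin (Module.finrank ℝ V) → ℂ) (j : ι) : ℝ :=
  ∑ h, (T.vertexBasis e).repr (T.normal j) h * (‖z h‖ ^ 2 + T.lam (e.1 h)) - T.lam j

/-- The chart domain `Ũ_ν ⊆ ℂ^n`. -/
def vertexDom (T : ToricTriple V ι) (e : T.VertexIndex) : Set (Fin (Module.finrank ℝ V) → ℂ) :=
  {z | ∀ j ∉ Set.range e.1, 0 < T.radicand e z j}

open Classical in
/-- The map `(z_1, …, z_n) ↦ (z_1, …, z_n, w_{n+1}, …, w_d)` with `w_j` the square root of the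
radicand. -/
noncomputable def vertexLift (T : ToricTriple V ι) (e : T.VertexIndex)
    (z : Fin (Module.finrank ℝ V) → ℂ) (j : ι) : ℂ :=
  if h : ∃ h, e.1 h = j then z h.choose else (Real.sqrt (T.radicand e z j) : ℂ)

theorem vertexLift_apply (T : ToricTriple V ι) (e : T.VertexIndex)
    (z : Fin (Module.finrank ℝ V) → ℂ) (h : Fin (Module.finrank ℝ V)) :
    T.vertexLift e z (e.1 h) = z h := by
  have hex : ∃ h', e.1 h' = e.1 h := ⟨h, rfl⟩
  rw [vertexLift, dif_pos hex, e.1.injective hex.choose_spec]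

theorem vertexLift_mem (T : ToricTriple V ι) (e : T.VertexIndex)
    {z : Fin (Module.finrank ℝ V) → ℂ} (hz : z ∈ T.vertexDom e) :
    T.vertexLift e z ∈ T.levelSet := by
  let b := T.vertexBasis e
  let μ : Module.Dual ℝ V := b.constr ℝ fun h => ‖z h‖ ^ 2 + T.lam (e.1 h)
  have hμ : ∀ j, μ (T.normal j) = T.radicand e z j + T.lam j := fun j => by
    simp [μ, radicand, b, Module.Basis.constr_apply_fintype, Module.Basis.equivFun_apply]
  have hw : ∀ j, ‖T.vertexLift e z j‖ ^ 2 + T.lam j = μ (T.normal j) := by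
    intro j
    by_cases hj : ∃ h, e.1 h = j
    · obtain ⟨h, rfl⟩ := hj
      have hb : b h = T.normal (e.1 h) := by simp [b, vertexBasis]
      rw [vertexLift_apply, ← hb]
      simp [μ]
    · rw [hμ, vertexLift, dif_neg hj, Complex.norm_real, Real.norm_eq_abs, sq_abs,
        Real.sq_sqrt (hz j hj).le]
  change T.J _ ∘ₗ _ = 0
  ext ⟨c, hc⟩
  have : T.J (T.vertexLift e z) c = μ (T.piMap c) := by
    simp [J, hw, piMap, Fintype.linearCombination_apply, mul_comm]
  simpa [LinearMap.mem_ker.mp hc] using this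

/-- The group `Γ_ν = N ∩ ((S^1)^n × 1^{d-n})`. -/
noncomputable def vertexGroup (T : ToricTriple V ι) (e : T.VertexIndex) : Subgroup (ι → Circle) where
  carrier := {t | t ∈ T.N ∧ ∀ j ∉ Set.range e.1, t j = 1}
  one_mem' := ⟨one_mem _, fun _ _ => rfl⟩
  mul_mem' := fun ha hb => ⟨mul_mem ha.1 hb.1, fun j hj => by simp [ha.2 j hj, hb.2 j hj]⟩
  inv_mem' := fun ha => ⟨inv_mem ha.1, fun j hj => by simp [ha.2 j hj]⟩

/-- The symplectic quasifold chart `Ũ_ν / Γ_ν → M`, `[z] ↦ [z : w]`; the symplectic form on `Ũ_ν`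
is the pull-back, by `z ↦ (z, w) ∈ Ψ⁻¹(0)`, of the standard form of `ℂ^d`. -/
noncomputable def vertexChart (T : ToricTriple V ι) (e : T.VertexIndex) :
    SymplecticChart (Fin (Module.finrank ℝ V) → ℂ) T.Space where
  dom := T.vertexDom e
  Γ := T.vertexGroup e
  act t z h := (t : ι → Circle) (e.1 h) • z h
  proj z := T.cls ⟨T.vertexLift e z, T.vertexLift_mem e z.2⟩
  form z := (stdSymplecticForm ι).compContinuousLinearMap (fderiv ℝ (T.vertexLift e) z)

/-- The symplectic atlas of the toric quasifold `M`. -/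
noncomputable def atlas (T : ToricTriple V ι) :
    SymplecticAtlas (Fin (Module.finrank ℝ V) → ℂ) T.Space where
  Index := T.VertexIndex
  chart := T.vertexChart

/-! ### The reduced space -/

/-- The subgroup `K = 𝔨 / (𝔨 ∩ Q)` of `D = V / Q`: the image of `𝔨`. -/
def K (T : ToricTriple V ι) (𝔨 : Submodule ℝ V) : AddSubgroup (V ⧸ T.Q) :=
  𝔨.toAddSubgroup.map (QuotientAddGroup.mk' T.Q)

/-- The moment mapping `Φ_𝔨 = j^* ∘ Φ` of the `K`-action, with `j : 𝔨 → V` the inclusion. -/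
noncomputable def Φk (T : ToricTriple V ι) (𝔨 : Submodule ℝ V) (m : T.Space) : Module.Dual ℝ 𝔨 :=
  𝔨.subtype.dualMap (T.Φ m)

/-- The level set `Φ_𝔨⁻¹(0) ⊆ M`, with its action of `D`. -/
noncomputable def zeroLevel (T : ToricTriple V ι) (𝔨 : Submodule ℝ V) : SubAddAction (V ⧸ T.Q) T.Space where
  carrier := {m | T.Φk 𝔨 m = 0}
  vadd_mem' := by
    intro δ m hm
    simpa [Φk, Φ_vadd] using hm

/-- The reduced space `M_𝔨 = Φ_𝔨⁻¹(0) / K`, as a topological space; `D / K` acts on it by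
`residualAction`. -/
noncomputable abbrev ReducedSpace (T : ToricTriple V ι) (𝔨 : Submodule ℝ V) : Type _ :=
  AddAction.orbitRel.Quotient (T.K 𝔨) (T.zeroLevel 𝔨)

/-- The quotient map `ρ : Φ_𝔨⁻¹(0) → M_𝔨`. -/
noncomputable def reducedMk (T : ToricTriple V ι) (𝔨 : Submodule ℝ V) (m : T.zeroLevel 𝔨) : T.ReducedSpace 𝔨 :=
  Quotient.mk _ m

/-- The mapping `M_𝔨 → (V / 𝔨)^*` induced by `Φ`, which has values in `ker j^* = (V / 𝔨)^*` on
`Φ_𝔨⁻¹(0)`. -/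
noncomputable def reducedMoment (T : ToricTriple V ι) (𝔨 : Submodule ℝ V) :
    T.ReducedSpace 𝔨 → Module.Dual ℝ (V ⧸ 𝔨) :=
  Quotient.lift
    (fun m => 𝔨.liftQ (T.Φ m) fun v hv =>
      LinearMap.congr_fun (m.2 : T.Φk 𝔨 m = 0) ⟨v, hv⟩) (by
    rintro m m' ⟨κ, hκ⟩
    have : T.Φ (m : T.Space) = T.Φ m' := by
      rw [← hκ]
      exact T.Φ_vadd κ.1 m'
    ext v
    exact LinearMap.congr_fun this v)

/-- The exponential `V / 𝔨 → D / K`, sending the class of `v` to the class of `v`; its kernel is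
`p(Q)`, with `p : V → V / 𝔨` the projection. -/
def residualExp (T : ToricTriple V ι) (𝔨 : Submodule ℝ V) : (V ⧸ 𝔨) →+ (V ⧸ T.Q) ⧸ T.K 𝔨 :=
  QuotientAddGroup.lift 𝔨.toAddSubgroup
    ((QuotientAddGroup.mk' (T.K 𝔨)).comp (QuotientAddGroup.mk' T.Q))
    fun v hv => (QuotientAddGroup.eq_zero_iff _).mpr ⟨v, hv, rfl⟩

end ToricTriple

/-!
The spaces `M`, `M_𝔨` and `X_𝔨` are quotients of level sets in `ℂ^d` (or `ℂ^J`) by groups of the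
form `exp (P⁻¹ L)`, where `P` is a linear map from `ℝ^d` (or `ℝ^J`) onto a vector space and `L` is
a countable group, so that everything can be compared upstairs. The proof has three parts.

*Convex geometry.* A point of `Φ_𝔨⁻¹(0)` over `p^* ν` has a stabilizer in `K` that contains the
classes of the vectors of `𝔨` in the span of the normals `X_j` active at `p^* ν`. If it is
countable, this intersection is zero (`ToricTriple.eq_zero_of_mkQ_piMap_eq_zero`: a line is
uncountable, and `Q` is countable). As `Δ` is simple, the active `X_j` are linearly independent,
hence so are the active `p(X_j)`. Therefore `Δ_𝔨` is simple, it has a vertex because the `p(X_j)`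
span, and the half-spaces of an irredundant presentation are those whose boundaries meet `Δ_𝔨`,
each in a facet (`ToricTriple.exists_isCut`). So over `Δ_𝔨` the coordinates `z_j` with `j ∉ J` do
not vanish.

*The quasifold structures.* For a set `S` of coordinates such that `P` has a linear section with
values in `ℝ^S`, the elements of `exp (ker P)` can be used to turn the coordinates outside of `S`
to non-negative real numbers, by a formula that is smooth as long as these coordinates avoid the
negative real axis (`Slice.normalize`). With `S` the facets through a vertex this gives the inverses
of the vertex charts, and with it the changes of charts and the lifts of all the torus actions. The
standard form of `ℂ^d` is preserved by such a rotation with variable angles, in the directions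
tangent to the level set: the new terms are differentials of functions `∑ a_j (|z_j|² + λ_j)` with
`a ∈ ker P`, which vanish on it (`Slice.stdSymplecticForm_normalize`). Hence all these lifts are
symplectic, which yields `ToricTriple.isSymplecticQuasifold_atlas` and
`ToricTriple.isHamiltonianAction_atlas`.

*The reduced space.* `M_𝔨` is the quotient of the preimage of `Φ_𝔨⁻¹(0)` in `ℂ^d` by the group
`{exp a | p (π a) ∈ p(Q)}` (`ToricTriple.redCls_eq_iff`). The points of that preimage with positive
coordinates outside of `J` form a slice, and it is the level set of `X_𝔨`, as the positive
coordinates are determined by the others. This gives the homeomorphism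
`ToricTriple.IsCut.homeomorph` between `M_𝔨` and `X_𝔨`. The structure of `M_𝔨` is that of `X_𝔨`,
transported; that it is the reduced structure (`ToricTriple.IsCut.isReduction`) holds because a
chart of `M` and a chart of `M_𝔨` both embed into `ℂ^d`, with the pull-backs of its standard form
as symplectic forms, and differ there by rotations as above.
-/

/-! ### Polyhedra and their active constraints -/

section Polyhedra

variable {W : Type*} [AddCommGroup W] [Module ℝ W] {ι : Type}

/-- The set of constraints `⟨ν, Y_j⟩ ≥ λ_j` that hold with equality at `ν`. -/
def activeSet (Y : ι → W) (lam : ι → ℝ) (ν : Module.Dual ℝ W) : Set ι := {j | ν (Y j) = lam j}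

theorem exists_pos_inactive_lt [Finite ι] (Y : ι → W) (lam : ι → ℝ) (ν δ : Module.Dual ℝ W) :
    ∃ ε > (0 : ℝ), ∀ s : ℝ, |s| < ε → ∀ j, lam j < ν (Y j) → lam j < (ν + s • δ) (Y j) := by
  have hev : ∀ᶠ s in 𝓝 (0 : ℝ), ∀ j, lam j < ν (Y j) → lam j < (ν + s • δ) (Y j) := by
    rw [Filter.eventually_all]
    intro j
    by_cases h : lam j < ν (Y j)
    · have hc : Continuous fun s : ℝ => (ν + s • δ) (Y j) := by
        simp only [LinearMap.add_apply, LinearMap.smul_apply, smul_eq_mul]; fun_prop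
      have := (hc.tendsto 0).eventually_const_lt (u := lam j) (by simpa using h)
      exact this.mono fun ε h _ => h
    · exact Filter.Eventually.of_forall fun s hs => absurd hs h
  obtain ⟨ε, hε, hball⟩ := Metric.eventually_nhds_iff.mp hev
  exact ⟨ε, hε, fun s hs => hball (by simpa using hs)⟩

/-- A point can be moved slightly in any direction that does not decrease the active
constraints. -/
theorem exists_pos_add_smul_mem [Finite ι] {Y : ι → W} {lam : ι → ℝ} {ν : Module.Dual ℝ W}
    (hν : ν ∈ halfSpaceInter Y lam Set.univ) (δ : Module.Dual ℝ W)
    (hδ : ∀ j ∈ activeSet Y lam ν, 0 ≤ δ (Y j)) :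
    ∃ ε > (0 : ℝ), ν + ε • δ ∈ halfSpaceInter Y lam Set.univ ∧
      activeSet Y lam (ν + ε • δ) = {j ∈ activeSet Y lam ν | δ (Y j) = 0} := by
  obtain ⟨ε, hε, h⟩ := exists_pos_inactive_lt Y lam ν δ
  have h2 := h (ε / 2) (by rw [abs_of_pos (by linarith)]; linarith)
  have hpos : 0 < ε / 2 := by linarith
  refine ⟨ε / 2, hpos, fun j _ => ?_, ?_⟩
  · rcases (hν j (Set.mem_univ j)).eq_or_lt with hj | hj
    · have := mul_nonneg hpos.le (hδ j hj.symm)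
      simp only [LinearMap.add_apply, LinearMap.smul_apply, smul_eq_mul]
      linarith
    · exact (h2 j hj).le
  · ext j
    rcases (hν j (Set.mem_univ j)).eq_or_lt with hj | hj
    · simp [activeSet, hj.symm, hpos.ne']
    · have := h2 j hj
      constructor
      · intro hx; exact absurd hx this.ne'
      · intro hx; exact absurd hx.1 hj.ne'

/-- A point at which the active normals span is a vertex. -/
theorem mem_extremePoints_of_span_eq_top {Y : ι → W} {lam : ι → ℝ} {ν : Module.Dual ℝ W}
    (hν : ν ∈ halfSpaceInter Y lam Set.univ)
    (hs : Submodule.span ℝ (Y '' activeSet Y lam ν) = ⊤) :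
    ν ∈ (halfSpaceInter Y lam Set.univ).extremePoints ℝ := by
  refine ⟨hν, fun x1 h1 x2 h2 hseg => ?_⟩
  obtain ⟨a, b, ha, hb, hab, rfl⟩ := hseg
  refine LinearMap.ext_on hs ?_
  rintro _ ⟨j, hj, rfl⟩
  have e1 := h1 j (Set.mem_univ j)
  have e2 := h2 j (Set.mem_univ j)
  have hj' : a * x1 (Y j) + b * x2 (Y j) = lam j := by simpa [activeSet] using hj
  have : x1 (Y j) = lam j := by
    obtain rfl : b = 1 - a := by linarith
    nlinarith
  rw [this]
  exact hj.symm

/-- At a vertex the active normals span. -/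
theorem span_eq_top_of_mem_extremePoints [Finite ι] {Y : ι → W} {lam : ι → ℝ}
    {ν : Module.Dual ℝ W} (hν : ν ∈ (halfSpaceInter Y lam Set.univ).extremePoints ℝ) :
    Submodule.span ℝ (Y '' activeSet Y lam ν) = ⊤ := by
  by_contra hne
  obtain ⟨μ, hμ0, hμ⟩ := Submodule.exists_le_ker_of_lt_top _ (lt_top_iff_ne_top.mpr hne)
  have hact : ∀ j ∈ activeSet Y lam ν, μ (Y j) = 0 := fun j hj =>
    hμ (Submodule.subset_span ⟨j, hj, rfl⟩)
  obtain ⟨ε, hε, h1, -⟩ := exists_pos_add_smul_mem hν.1 μ fun j hj => (hact j hj).ge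
  obtain ⟨ε', hε', h2, -⟩ := exists_pos_add_smul_mem hν.1 (-μ) fun j hj => by simp [hact j hj]
  have h := hν.2 h1 h2 ⟨ε' / (ε + ε'), ε / (ε + ε'), by positivity, by positivity, by
    field_simp; ring, by
      have : ε + ε' ≠ 0 := by positivity
      ext w
      simp only [LinearMap.add_apply, LinearMap.smul_apply, smul_eq_mul, LinearMap.neg_apply]
      field_simp
      ring⟩
  have hz : ε • μ = 0 := by simpa using h
  rcases smul_eq_zero.mp hz with h | h
  · exact hε.ne' h
  · exact hμ0 h

/-- Every point of a polyhedron whose normals span lies on a face through a vertex: moving inside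
the face of the point until further constraints become active ends at a vertex. -/
theorem exists_extremePoint_activeSet_subset [Finite ι] {Y : ι → W} {lam : ι → ℝ}
    (hY : Submodule.span ℝ (Set.range Y) = ⊤) {ν : Module.Dual ℝ W}
    (hν : ν ∈ halfSpaceInter Y lam Set.univ) :
    ∃ ν' ∈ (halfSpaceInter Y lam Set.univ).extremePoints ℝ,
      activeSet Y lam ν ⊆ activeSet Y lam ν' := by
  obtain ⟨_, hle, hmax⟩ := (Set.toFinite
    (activeSet Y lam '' halfSpaceInter Y lam Set.univ)).exists_le_maximal
    (Set.mem_image_of_mem _ hν)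
  obtain ⟨⟨ν', hν', rfl⟩, hmax⟩ := hmax
  refine ⟨ν', mem_extremePoints_of_span_eq_top hν' ?_, hle⟩
  by_contra hne
  obtain ⟨μ, hμ0, hμ⟩ := Submodule.exists_le_ker_of_lt_top _ (lt_top_iff_ne_top.mpr hne)
  have hact : ∀ j ∈ activeSet Y lam ν', μ (Y j) = 0 := fun j hj =>
    hμ (Submodule.subset_span ⟨j, hj, rfl⟩)
  clear hμ
  -- one of `μ`, `-μ` decreases some constraint
  obtain ⟨δ, hδ, j₁, hj₁⟩ : ∃ δ : Module.Dual ℝ W, (∀ j ∈ activeSet Y lam ν', δ (Y j) = 0) ∧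
      ∃ j, δ (Y j) < 0 := by
    by_contra! hcon
    refine hμ0 (LinearMap.ext_on hY ?_)
    rintro _ ⟨j, rfl⟩
    have h1 := hcon μ hact j
    have h2 := hcon (-μ) (fun j hj => by simp [hact j hj]) j
    simp only [LinearMap.neg_apply] at h2
    simp only [LinearMap.zero_apply]
    linarith
  obtain ⟨j₀, hj₀, hmin⟩ := Set.exists_min_image {j | δ (Y j) < 0}
    (fun j => (ν' (Y j) - lam j) / (-δ (Y j))) (Set.toFinite _) ⟨j₁, hj₁⟩
  set r := (ν' (Y j₀) - lam j₀) / (-δ (Y j₀)) with hr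
  have hj₀' : 0 < -δ (Y j₀) := by simpa using hj₀
  have hr0 : 0 ≤ r := div_nonneg (by linarith [hν' j₀ (Set.mem_univ _)]) hj₀'.le
  have hmem : ν' + r • δ ∈ halfSpaceInter Y lam Set.univ := by
    intro j _
    have hj := hν' j (Set.mem_univ _)
    simp only [LinearMap.add_apply, LinearMap.smul_apply, smul_eq_mul]
    rcases le_or_gt 0 (δ (Y j)) with h | h
    · nlinarith
    · have := hmin j h
      rw [le_div_iff₀ (by linarith)] at this
      linarith
  have hact0 : j₀ ∈ activeSet Y lam (ν' + r • δ) := by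
    change (ν' + r • δ) (Y j₀) = lam j₀
    have : r * (-δ (Y j₀)) = ν' (Y j₀) - lam j₀ := by
      rw [hr, div_mul_cancel₀ _ hj₀'.ne']
    simp only [LinearMap.add_apply, LinearMap.smul_apply, smul_eq_mul]
    linarith
  have hsub : activeSet Y lam ν' ⊆ activeSet Y lam (ν' + r • δ) := fun j hj => by
    change (ν' + r • δ) (Y j) = lam j
    rw [LinearMap.add_apply, LinearMap.smul_apply, hδ j hj, smul_zero, add_zero]
    exact hj
  have := hmax ⟨_, hmem, rfl⟩ hsub hact0
  have h0 := hδ j₀ this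
  exact hj₀'.ne' (by rw [h0, neg_zero])

/-- If the active normals at `ν` are linearly independent then any subset of them is the set of
active constraints at some point. -/
theorem exists_activeSet_eq [Finite ι] {Y : ι → W} {lam : ι → ℝ} {ν : Module.Dual ℝ W}
    (hν : ν ∈ halfSpaceInter Y lam Set.univ)
    (hli : LinearIndependent ℝ fun j : activeSet Y lam ν => Y j) (A : Set ι)
    (hA : A ⊆ activeSet Y lam ν) :
    ∃ ν' ∈ halfSpaceInter Y lam Set.univ, activeSet Y lam ν' = A := by
  classical
  obtain ⟨δ, hδ⟩ : ∃ δ : Module.Dual ℝ W, ∀ j : activeSet Y lam ν,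
      δ (Y j) = if (j : ι) ∈ A then 0 else 1 := by
    let b := Module.Basis.extend hli.linearIndepOn_id
    let f : W → ℝ := fun w => if ∃ j ∈ A, Y j = w then 0 else 1
    refine ⟨b.constr ℝ fun i => f i, fun j => ?_⟩
    have hj : Y j ∈ hli.linearIndepOn_id.extend (Set.subset_univ _) :=
      hli.linearIndepOn_id.subset_extend _ ⟨j, rfl⟩
    have hb : b ⟨Y j, hj⟩ = Y j := by simp [b]
    rw [← hb, Module.Basis.constr_basis]
    have : (∃ i ∈ A, Y i = Y j) ↔ (j : ι) ∈ A := by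
      constructor
      · rintro ⟨i, hi, hij⟩
        have : (⟨i, hA hi⟩ : activeSet Y lam ν) = j := hli.injective hij
        rw [← this]; exact hi
      · exact fun h => ⟨j, h, rfl⟩
    simp only [f, this]
  obtain ⟨ε, -, hmem, hact⟩ := exists_pos_add_smul_mem hν δ fun j hj => by
    rw [hδ ⟨j, hj⟩]; positivity
  refine ⟨_, hmem, hact.trans ?_⟩
  ext j
  constructor
  · rintro ⟨hj, h⟩
    rw [hδ ⟨j, hj⟩] at h
    by_contra hjA
    simp [hjA] at h
  · intro hj
    exact ⟨hA hj, by rw [hδ ⟨j, hA hj⟩]; simp [hj]⟩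

/-- The affine span of the face of a point is parallel to the annihilator of the active normals. -/
theorem vectorSpan_face [Finite ι] {Y : ι → W} {lam : ι → ℝ} {ν : Module.Dual ℝ W}
    (hν : ν ∈ halfSpaceInter Y lam Set.univ) :
    vectorSpan ℝ {μ ∈ halfSpaceInter Y lam Set.univ | ∀ j ∈ activeSet Y lam ν, μ (Y j) = lam j} =
      (Submodule.span ℝ (Y '' activeSet Y lam ν)).dualAnnihilator := by
  apply le_antisymm
  · rw [vectorSpan, Submodule.span_le]
    rintro _ ⟨μ, ⟨-, hμ⟩, μ', ⟨-, hμ'⟩, rfl⟩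
    rw [SetLike.mem_coe, Submodule.mem_dualAnnihilator]
    intro w hw
    induction hw using Submodule.span_induction with
    | mem w hw =>
      obtain ⟨j, hj, rfl⟩ := hw
      simp [hμ j hj, hμ' j hj]
    | zero => simp
    | add x y _ _ hx hy => rw [map_add, hx, hy, add_zero]
    | smul a x _ hx => rw [map_smul, hx, smul_zero]
  · intro δ hδ
    rw [Submodule.mem_dualAnnihilator] at hδ
    have hδ0 : ∀ j ∈ activeSet Y lam ν, δ (Y j) = 0 := fun j hj =>
      hδ _ (Submodule.subset_span ⟨j, hj, rfl⟩)
    obtain ⟨ε, hε, hmem, hact⟩ := exists_pos_add_smul_mem hν δ fun j hj => (hδ0 j hj).ge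
    have h1 : ν + ε • δ - ν ∈ vectorSpan ℝ {μ ∈ halfSpaceInter Y lam Set.univ |
        ∀ j ∈ activeSet Y lam ν, μ (Y j) = lam j} := by
      refine vsub_mem_vectorSpan ℝ ⟨hmem, fun j hj => ?_⟩ ⟨hν, fun j hj => hj⟩
      have : j ∈ activeSet Y lam (ν + ε • δ) := by rw [hact]; exact ⟨hj, hδ0 j hj⟩
      exact this
    rw [add_sub_cancel_left] at h1
    have := Submodule.smul_mem _ ε⁻¹ h1
    rwa [smul_smul, inv_mul_cancel₀ hε.ne', one_smul] at this

end Polyhedra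

/-- A finitely generated abelian group, here a quasilattice, is countable. -/
theorem ToricTriple.countable_Q {V : Type*} [AddCommGroup V] [Module ℝ V] {ι : Type}
    (T : ToricTriple V ι) : Countable T.Q := by
  obtain ⟨S, -, hS⟩ := T.quasilattice
  rw [← hS, ← Submodule.span_int_eq_addSubgroupClosure]
  have : (Submodule.span ℤ (S : Set V) : Set V) ⊆
      Set.range (Fintype.linearCombination ℤ (Subtype.val : S → V)) := by
    rw [← LinearMap.coe_range, Fintype.range_linearCombination]
    simp
  exact ((Set.countable_range _).mono this).to_subtype

namespace ToricTriple

variable {V : Type*} [AddCommGroup V] [Module ℝ V] {ι : Type} [Fintype ι]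

/-! ### The level set and its moment mapping -/

theorem piMap_apply (T : ToricTriple V ι) (a : ι → ℝ) : T.piMap a = ∑ j, a j • T.normal j := by
  simp [piMap, Fintype.linearCombination_apply]

theorem J_apply (T : ToricTriple V ι) (z : ι → ℂ) (a : ι → ℝ) :
    T.J z a = ∑ j, (‖z j‖ ^ 2 + T.lam j) * a j := by
  simp [J]

theorem span_range_normal (T : ToricTriple V ι) : Submodule.span ℝ (Set.range T.normal) = ⊤ := by
  rw [← Fintype.range_linearCombination]
  exact LinearMap.range_eq_top.mpr T.piMap_surjective

theorem J_eq_iff (T : ToricTriple V ι) (z : ι → ℂ) (μ : Module.Dual ℝ V) :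
    T.piMap.dualMap μ = T.J z ↔ ∀ j, ‖z j‖ ^ 2 + T.lam j = μ (T.normal j) := by
  classical
  constructor
  · intro h j
    have := LinearMap.congr_fun h (Pi.single j 1)
    simpa [J_apply, piMap_apply, Pi.single_apply] using this.symm
  · intro h
    refine LinearMap.ext fun a => ?_
    simp [J_apply, piMap_apply, h, mul_comm]

/-- `z` lies in `Ψ⁻¹(0)` if and only if the numbers `|z_j|² + λ_j` are the values of a linear form
at the normals. -/
theorem mem_levelSet_iff (T : ToricTriple V ι) (z : ι → ℂ) :
    z ∈ T.levelSet ↔ ∃ μ : Module.Dual ℝ V, ∀ j, ‖z j‖ ^ 2 + T.lam j = μ (T.normal j) := by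
  constructor
  · intro hz
    obtain ⟨μ, hμ⟩ := T.exists_moment ⟨z, hz⟩
    exact ⟨μ, (T.J_eq_iff z μ).mp hμ⟩
  · rintro ⟨μ, hμ⟩
    change T.J z ∘ₗ (LinearMap.ker T.piMap).subtype = 0
    rw [← (T.J_eq_iff z μ).mpr hμ]
    ext ⟨c, hc⟩
    simp [LinearMap.mem_ker.mp hc]

theorem Φ_cls_normal (T : ToricTriple V ι) (z : T.levelSet) (j : ι) :
    T.Φ (T.cls z) (T.normal j) = ‖(z : ι → ℂ) j‖ ^ 2 + T.lam j :=
  ((T.J_eq_iff _ _).mp (T.Φ_cls z) j).symm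

theorem Φ_cls_eq (T : ToricTriple V ι) (z : T.levelSet) {μ : Module.Dual ℝ V}
    (hμ : ∀ j, ‖(z : ι → ℂ) j‖ ^ 2 + T.lam j = μ (T.normal j)) : T.Φ (T.cls z) = μ :=
  LinearMap.dualMap_injective_of_surjective T.piMap_surjective
    ((T.Φ_cls z).trans ((T.J_eq_iff _ _).mpr hμ).symm)

theorem Φ_mem_polyhedron (T : ToricTriple V ι) (m : T.Space) : T.Φ m ∈ T.polyhedron := by
  obtain ⟨z, rfl⟩ : ∃ z, T.cls z = m := Quotient.exists_rep m
  intro j _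
  rw [Φ_cls_normal]
  linarith [sq_nonneg ‖(z : ι → ℂ) j‖]

theorem cls_eq_iff (T : ToricTriple V ι) (z z' : T.levelSet) :
    T.cls z = T.cls z' ↔
      ∃ a : ι → ℝ, T.piMap a ∈ T.Q ∧ torusExp a • (z' : ι → ℂ) = z := by
  constructor
  · intro h
    obtain ⟨⟨_, a, ha, rfl⟩, ht⟩ := Quotient.exact h
    exact ⟨a, ha, congrArg Subtype.val ht⟩
  · rintro ⟨a, ha, h⟩
    exact Quotient.sound ⟨⟨_, a, ha, rfl⟩, Subtype.ext h⟩

/-- The point of `Ψ⁻¹(0)` over `μ ∈ Δ` with non-negative real coordinates. -/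
theorem exists_cls_of_mem_polyhedron (T : ToricTriple V ι) {μ : Module.Dual ℝ V}
    (hμ : μ ∈ T.polyhedron) :
    ∃ z : T.levelSet, T.Φ (T.cls z) = μ := by
  have h : ∀ j, ‖((Real.sqrt (μ (T.normal j) - T.lam j) : ℝ) : ℂ)‖ ^ 2 + T.lam j =
      μ (T.normal j) := fun j => by
    rw [Complex.norm_real, Real.norm_eq_abs, sq_abs, Real.sq_sqrt, sub_add_cancel]
    exact sub_nonneg.mpr (hμ j (Set.mem_univ j))
  let z : T.levelSet := ⟨fun j => (Real.sqrt (μ (T.normal j) - T.lam j) : ℂ),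
    (T.mem_levelSet_iff _).mpr ⟨μ, h⟩⟩
  exact ⟨z, T.Φ_cls_eq z h⟩

/-! ### Simplicity -/

theorem vertexBasis_apply (T : ToricTriple V ι) (e : T.VertexIndex)
    (h : Fin (Module.finrank ℝ V)) : T.vertexBasis e h = T.normal (e.1 h) := by
  simp [vertexBasis]

theorem exists_vertexIndex (T : ToricTriple V ι) {μ : Module.Dual ℝ V} (hμ : μ ∈ T.polyhedron) :
    ∃ e : T.VertexIndex, activeSet T.normal T.lam μ ⊆ Set.range e.1 := by
  obtain ⟨ν, hν, hsub⟩ := exists_extremePoint_activeSet_subset T.span_range_normal hμ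
  have hcard := T.simple ν hν
  have f := (Finite.equivFinOfCardEq (α := {j | ν (T.normal j) = T.lam j}) hcard).symm
  let e : Fin (Module.finrank ℝ V) ↪ ι := f.toEmbedding.trans (Function.Embedding.subtype _)
  have he : Set.range e = {j | ν (T.normal j) = T.lam j} := by
    ext j
    constructor
    · rintro ⟨h, rfl⟩; exact (f h).2
    · intro hj; exact ⟨f.symm ⟨j, hj⟩, by simp [e]⟩
  exact ⟨⟨e, ν, hν, he⟩, by rw [he]; exact hsub⟩

/-- The normals of the facets through any point of a simple polyhedron are linearly independent. -/
theorem linearIndependent_active (T : ToricTriple V ι) {μ : Module.Dual ℝ V}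
    (hμ : μ ∈ T.polyhedron) :
    LinearIndependent ℝ fun j : activeSet T.normal T.lam μ => T.normal j := by
  obtain ⟨e, he⟩ := T.exists_vertexIndex hμ
  choose f hf using fun j : activeSet T.normal T.lam μ => he j.2
  have hinj : Function.Injective f := fun i j hij => Subtype.ext (by rw [← hf i, ← hf j, hij])
  have := (T.vertexBasis e).linearIndependent.comp f hinj
  convert this using 1
  ext j
  simp [vertexBasis_apply, hf]

/-! ### Isotropy -/

theorem _root_.torusExp_smul_eq_self {ι : Type} {c : ι → ℝ} {z : ι → ℂ}
    (h : ∀ j, c j ≠ 0 → z j = 0) :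
    torusExp c • z = z := by
  ext j
  by_cases hc : c j = 0
  · simp [torusExp, hc]
  · simp [h j hc]

/-- If `K` acts with countable isotropy on `Φ_𝔨⁻¹(0)`, then `𝔨` meets the span of the normals of
the facets through a point of `Δ ∩ 𝔨^⊥` only in zero: otherwise a line in the intersection, modulo
the countable group `Q`, would be contained in the isotropy group of a point. -/
theorem eq_zero_of_mkQ_piMap_eq_zero (T : ToricTriple V ι) (𝔨 : Submodule ℝ V)
    (hiso : ∀ m : T.zeroLevel 𝔨, Countable (AddAction.stabilizer (T.K 𝔨) m))
    {ν : Module.Dual ℝ (V ⧸ 𝔨)} (hν : 𝔨.mkQ.dualMap ν ∈ T.polyhedron) {c : ι → ℝ}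
    (hc : ∀ j, c j ≠ 0 → ν (𝔨.mkQ (T.normal j)) = T.lam j) (h0 : 𝔨.mkQ (T.piMap c) = 0) :
    c = 0 := by
  classical
  -- `π c = 0` suffices, by the linear independence of the active normals
  suffices hπ : T.piMap c = 0 by
    have hli := Fintype.linearIndependent_iff.mp (T.linearIndependent_active hν)
      (fun j => c j) (by
        rw [← hπ, piMap_apply]
        refine Fintype.sum_of_injective _ Subtype.val_injective _ _ (fun j hj => ?_) fun _ => rfl
        have : c j = 0 := by_contra fun h => hj ⟨⟨j, hc j h⟩, rfl⟩
        rw [this, zero_smul])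
    ext j
    by_contra hj
    exact hj (hli ⟨j, hc j hj⟩)
  by_contra hπ
  obtain ⟨z, hz⟩ := T.exists_cls_of_mem_polyhedron hν
  have hm : T.cls z ∈ T.zeroLevel 𝔨 := by
    change T.Φk 𝔨 (T.cls z) = 0
    refine LinearMap.ext fun v => ?_
    simp [Φk, hz, (Submodule.Quotient.mk_eq_zero 𝔨).mpr v.2]
  have hzc : ∀ j, c j ≠ 0 → (z : ι → ℂ) j = 0 := fun j hj => by
    have h1 := T.Φ_cls_normal z j
    rw [hz] at h1
    have h2 : ν (𝔨.mkQ (T.normal j)) = ‖(z : ι → ℂ) j‖ ^ 2 + T.lam j := h1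
    rw [hc j hj] at h2
    simpa using h2
  have hmem : ∀ s : ℝ, s • T.piMap c ∈ 𝔨 := fun s =>
    𝔨.smul_mem s ((Submodule.Quotient.mk_eq_zero 𝔨).mp h0)
  let κ : ℝ → T.K 𝔨 := fun s => ⟨QuotientAddGroup.mk (s • T.piMap c), s • T.piMap c, hmem s, rfl⟩
  have hstab : ∀ s, κ s ∈ AddAction.stabilizer (T.K 𝔨) (⟨T.cls z, hm⟩ : T.zeroLevel 𝔨) := by
    intro s
    rw [AddAction.mem_stabilizer_iff]
    refine Subtype.ext ?_
    change (QuotientAddGroup.mk (s • T.piMap c) : V ⧸ T.Q) +ᵥ T.cls z = T.cls z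
    rw [← map_smul, vadd_cls]
    congr 1
    refine Subtype.ext (torusExp_smul_eq_self fun j hj => hzc j ?_)
    rintro h
    exact hj (by simp [h])
  have := hiso ⟨T.cls z, hm⟩
  have := T.countable_Q
  let f : ℝ → AddAction.stabilizer (T.K 𝔨) (⟨T.cls z, hm⟩ : T.zeroLevel 𝔨) :=
    fun s => ⟨κ s, hstab s⟩
  have hinj : Function.Injective fun s : ℝ => s • T.piMap c := smul_left_injective ℝ hπ
  have hfib : ∀ s, (f ⁻¹' {s}).Countable := by
    intro s
    rcases (f ⁻¹' {s}).eq_empty_or_nonempty with h | ⟨r, hr⟩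
    · rw [h]; exact Set.countable_empty
    refine ((T.Q : Set V).to_countable.preimage (f := fun s : ℝ => s • T.piMap c - r • T.piMap c)
      fun a b hab => hinj (sub_left_injective hab)).mono fun a ha => ?_
    have hfar : f a = f r := Eq.trans ha (Eq.symm hr)
    have : (QuotientAddGroup.mk (a • T.piMap c) : V ⧸ T.Q) = QuotientAddGroup.mk (r • T.piMap c) :=
      congrArg (fun x => ((x.1 : T.K 𝔨) : V ⧸ T.Q)) hfar
    rw [Set.mem_preimage, SetLike.mem_coe, ← QuotientAddGroup.eq_zero_iff, QuotientAddGroup.mk_sub,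
      this, sub_self]
  have huniv : (Set.univ : Set ℝ).Countable := by
    rw [← Set.preimage_univ (f := f), ← Set.iUnion_of_singleton, Set.preimage_iUnion]
    exact Set.countable_iUnion hfib
  exact Cardinal.not_countable_real huniv

end ToricTriple

/-! ### The polyhedron of the reduced space -/

section Faces

variable {W : Type*} [AddCommGroup W] [Module ℝ W] {ι : Type}

theorem vectorSpan_halfSpaceInter_eq_top [Finite ι] {Y : ι → W} {lam : ι → ℝ}
    {ν : Module.Dual ℝ W} (hν : ν ∈ halfSpaceInter Y lam Set.univ)
    (hact : activeSet Y lam ν = ∅) :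
    vectorSpan ℝ (halfSpaceInter Y lam Set.univ) = ⊤ := by
  have h := vectorSpan_face hν
  simpa [hact] using h

theorem finrank_vectorSpan_facet [Finite ι] [FiniteDimensional ℝ W] {Y : ι → W} {lam : ι → ℝ}
    {ν : Module.Dual ℝ W} (hν : ν ∈ halfSpaceInter Y lam Set.univ) {j : ι}
    (hact : activeSet Y lam ν = {j}) (hj : Y j ≠ 0) :
    Module.finrank ℝ (vectorSpan ℝ {μ ∈ halfSpaceInter Y lam Set.univ | μ (Y j) = lam j}) + 1 =
      Module.finrank ℝ W := by
  have h := vectorSpan_face hν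
  simp only [hact, Set.mem_singleton_iff, forall_eq, Set.image_singleton] at h
  rw [h, ← Subspace.finrank_add_finrank_dualAnnihilator_eq (Submodule.span ℝ {Y j}),
    finrank_span_singleton hj, add_comm]

/-- If the active normals are everywhere linearly independent, then a half-space whose boundary
meets the polyhedron cannot be omitted. -/
theorem activeSet_subset_of_eq [Finite ι] {Y : ι → W} {lam : ι → ℝ}
    (hli : ∀ ν ∈ halfSpaceInter Y lam Set.univ,
      LinearIndependent ℝ fun j : activeSet Y lam ν => Y j) {J : Finset ι}
    (hJ : halfSpaceInter Y lam (J : Set ι) = halfSpaceInter Y lam Set.univ)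
    {ν : Module.Dual ℝ W} (hν : ν ∈ halfSpaceInter Y lam Set.univ) : activeSet Y lam ν ⊆ J := by
  intro j hj
  by_contra hjJ
  obtain ⟨ν₁, hν₁, hact⟩ := exists_activeSet_eq hν (hli ν hν) {j} (by simpa using hj)
  have hjν : ν₁ (Y j) = lam j := by
    have : j ∈ activeSet Y lam ν₁ := by rw [hact]; rfl
    exact this
  have hYj : Y j ≠ 0 := (hli ν hν).ne_zero ⟨j, hj⟩
  obtain ⟨φ, hφ⟩ : ∃ φ : Module.Dual ℝ W, φ (Y j) ≠ 0 := by
    by_contra! h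
    exact hYj ((Module.forall_dual_apply_eq_zero_iff ℝ _).mp h)
  -- moving against `Y j` violates the `j`-th constraint only
  obtain ⟨ε, hε, h⟩ := exists_pos_inactive_lt Y lam ν₁ (-(φ (Y j)) • φ)
  have hmem : ν₁ + (ε / 2) • (-(φ (Y j)) • φ) ∈ halfSpaceInter Y lam (J : Set ι) := by
    intro i hi
    refine (h (ε / 2) (by rw [abs_of_pos (by linarith)]; linarith) i
      (lt_of_le_of_ne (hν₁ i (Set.mem_univ i)) fun hne => ?_)).le
    have : i ∈ activeSet Y lam ν₁ := hne.symm
    rw [hact] at this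
    exact hjJ (this ▸ hi)
  rw [hJ] at hmem
  have h1 := hmem j (Set.mem_univ j)
  simp only [LinearMap.add_apply, LinearMap.smul_apply, smul_eq_mul, hjν] at h1
  have h2 : 0 < φ (Y j) * φ (Y j) := mul_self_pos.mpr hφ
  nlinarith

/-- A half-space of an irredundant presentation has a boundary that meets the polyhedron. -/
theorem exists_mem_of_minimal {Y : ι → W} {lam : ι → ℝ} {ν₀ : Module.Dual ℝ W}
    (hν₀ : ν₀ ∈ halfSpaceInter Y lam Set.univ) {J : Finset ι}
    (hJ : Minimal (fun J' : Finset ι =>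
      halfSpaceInter Y lam (J' : Set ι) = halfSpaceInter Y lam Set.univ) J) {j : ι} (hj : j ∈ J) :
    ∃ ν ∈ halfSpaceInter Y lam Set.univ, ν (Y j) = lam j := by
  classical
  by_contra! hcon
  have hprop : halfSpaceInter Y lam (J.erase j : Set ι) =
      halfSpaceInter Y lam Set.univ := by
    rw [← hJ.prop]
    refine Set.Subset.antisymm (fun ν hν => ?_) fun ν hν i hi => hν i (Finset.mem_of_mem_erase hi)
    by_contra hnot
    have hlt : ν (Y j) < lam j := by
      by_contra! h
      refine hnot fun i hi => ?_
      by_cases hij : i = j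
      · rw [hij]; exact h
      · exact hν i (Finset.mem_erase.mpr ⟨hij, hi⟩)
    have hlt₀ : lam j < ν₀ (Y j) :=
      lt_of_le_of_ne (hν₀ j (Set.mem_univ j)) (hcon ν₀ hν₀).symm
    -- the point of the segment from `ν₀` to `ν` on the hyperplane
    set s := (ν₀ (Y j) - lam j) / (ν₀ (Y j) - ν (Y j)) with hs
    have hd : 0 < ν₀ (Y j) - ν (Y j) := by linarith
    have hs0 : 0 ≤ s := div_nonneg (by linarith) hd.le
    have hs1 : s ≤ 1 := (div_le_one hd).mpr (by linarith)
    have hsj : s * (ν₀ (Y j) - ν (Y j)) = ν₀ (Y j) - lam j := div_mul_cancel₀ _ hd.ne'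
    have hj' : ((1 - s) • ν₀ + s • ν) (Y j) = lam j := by
      simp only [LinearMap.add_apply, LinearMap.smul_apply, smul_eq_mul]
      linarith
    refine hcon ((1 - s) • ν₀ + s • ν) ?_ hj'
    rw [← hJ.prop]
    intro i hi
    by_cases hij : i = j
    · rw [hij]; exact hj'.ge
    · have h1 := hν i (Finset.mem_erase.mpr ⟨hij, hi⟩)
      have h2 := hν₀ i (Set.mem_univ i)
      simp only [LinearMap.add_apply, LinearMap.smul_apply, smul_eq_mul]
      nlinarith
  have := hJ.le_of_le hprop (Finset.erase_subset j J) hj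
  simp at this
theorem halfSpaceInter_restrict (Y : ι → W) (lam : ι → ℝ) (J : Set ι) :
    halfSpaceInter (fun j : J => Y j) (fun j => lam j) Set.univ = halfSpaceInter Y lam J := by
  ext ν
  exact ⟨fun h j hj => h ⟨j, hj⟩ (Set.mem_univ _), fun h j _ => h j j.2⟩

theorem linearIndependent_active_restrict {Y : ι → W} {lam : ι → ℝ} (J : Set ι)
    {ν : Module.Dual ℝ W} (hli : LinearIndependent ℝ fun j : activeSet Y lam ν => Y j) :
    LinearIndependent ℝ
      fun j : activeSet (fun j : J => Y j) (fun j => lam j) ν => Y j.1.1 := by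
  let f : activeSet (fun j : J => Y j) (fun j : J => lam j) ν → activeSet Y lam ν :=
    fun j => ⟨j.1.1, j.2⟩
  have hf : Function.Injective f := fun i j hij =>
    Subtype.ext (Subtype.ext (show (f i).1 = (f j).1 by rw [hij]))
  exact hli.comp f hf

/-- A polyhedron with a vertex, whose active normals are everywhere linearly independent and all of
whose constraints are somewhere active, is simple, of full dimension, and has exactly the given
facets. -/
def ToricTriple.ofLinearIndependent [Finite ι] [FiniteDimensional ℝ W] (Y : ι → W) (lam : ι → ℝ)
    (Q : AddSubgroup W)
    (hQ : ∃ S : Finset W, Submodule.span ℝ (S : Set W) = ⊤ ∧ AddSubgroup.closure (S : Set W) = Q)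
    (hYQ : ∀ j, Y j ∈ Q)
    (hv : ((halfSpaceInter Y lam Set.univ).extremePoints ℝ).Nonempty)
    (hli : ∀ ν ∈ halfSpaceInter Y lam Set.univ,
      LinearIndependent ℝ fun j : activeSet Y lam ν => Y j)
    (hact : ∀ j, ∃ ν ∈ halfSpaceInter Y lam Set.univ, ν (Y j) = lam j) : ToricTriple W ι :=
  have hface : ∀ j, ∃ ν ∈ halfSpaceInter Y lam Set.univ, activeSet Y lam ν = {j} := by
    intro j
    obtain ⟨ν, hν, hj⟩ := hact j
    exact exists_activeSet_eq hν (hli ν hν) {j} (by simpa [activeSet] using hj)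
  have hmem_face : ∀ j, ∀ ν, activeSet Y lam ν = {j} → ∀ i, ν (Y i) = lam i ↔ i = j :=
    fun j ν h i => by
      rw [← Set.mem_singleton_iff (a := i), ← h]
      rfl
  { normal := Y
    lam := lam
    Q := Q
    quasilattice := hQ
    normal_mem := hYQ
    full_dim := by
      obtain ⟨ν₀, hν₀⟩ := hv
      obtain ⟨ν, hν, h⟩ := exists_activeSet_eq hν₀.1 (hli ν₀ hν₀.1) ∅ (Set.empty_subset _)
      rw [vectorSpan_halfSpaceInter_eq_top hν h, finrank_top, Subspace.dual_finrank_eq]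
    facet_nonempty := fun j => hact j
    facet_dim := fun j => by
      obtain ⟨ν, hν, h⟩ := hface j
      exact finrank_vectorSpan_facet hν h ((hli ν hν).ne_zero ⟨j, by rw [h]; rfl⟩)
    facet_injective := fun i j hij => by
      obtain ⟨ν, hν, h⟩ := hface i
      have : ν ∈ {μ ∈ halfSpaceInter Y lam Set.univ | μ (Y j) = lam j} := by
        refine (Set.ext_iff.mp hij ν).mp ?_
        exact ⟨hν, (hmem_face i ν h i).mpr rfl⟩
      exact ((hmem_face i ν h j).mp this.2).symm
    pointed := hv
    simple := fun ν hν => by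
      have := Fintype.ofFinite (activeSet Y lam ν)
      have hcard := finrank_span_eq_card (hli ν hν.1)
      rw [← Set.image_eq_range, span_eq_top_of_mem_extremePoints hν, finrank_top] at hcard
      rw [hcard, ← Nat.card_eq_fintype_card]
      rfl }

end Faces

namespace ToricTriple

variable {V : Type*} [AddCommGroup V] [Module ℝ V] {ι : Type} [Fintype ι]

/-- `T'` is the triple `(Δ_𝔨, {p(X_j)}_{j ∈ J}, p(Q))` cut out of `T` by the subspace `𝔨`: the
half-spaces indexed by `J` define `Δ_𝔨`, and the boundaries of the others do not meet `Δ_𝔨`. -/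
structure IsCut (T : ToricTriple V ι) (𝔨 : Submodule ℝ V) (J : Finset ι)
    (T' : ToricTriple (V ⧸ 𝔨) J) : Prop where
  polyhedron_eq : T'.polyhedron = {ν | 𝔨.mkQ.dualMap ν ∈ T.polyhedron}
  normal_eq : ∀ j : J, T'.normal j = 𝔨.mkQ (T.normal j)
  lam_eq : ∀ j : J, T'.lam j = T.lam j
  Q_eq : T'.Q = T.Q.map (𝔨.mkQ : V →+ V ⧸ 𝔨)
  lam_lt : ∀ ν ∈ T'.polyhedron, ∀ j ∉ J, T.lam j < ν (𝔨.mkQ (T.normal j))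

/-- The polyhedron `Δ_𝔨` is simple, with facets indexed by any irredundant choice of half-spaces.
Indeed the projections of the normals active at a point of `Δ_𝔨` are linearly independent, by the
hypothesis on the isotropy groups. -/
theorem exists_isCut [FiniteDimensional ℝ V] (T : ToricTriple V ι) (𝔨 : Submodule ℝ V)
    (h0 : ∃ m, T.Φk 𝔨 m = 0)
    (hiso : ∀ m : T.zeroLevel 𝔨, Countable (AddAction.stabilizer (T.K 𝔨) m)) (J : Finset ι)
    (hJ : Minimal (fun J' : Finset ι =>
      halfSpaceInter (fun j => 𝔨.mkQ (T.normal j)) T.lam (J' : Set ι) =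
        {ν | 𝔨.mkQ.dualMap ν ∈ T.polyhedron}) J) :
    ∃ T' : ToricTriple (V ⧸ 𝔨) J, T.IsCut 𝔨 J T' := by
  classical
  set Y : ι → V ⧸ 𝔨 := fun j => 𝔨.mkQ (T.normal j) with hY
  have hP : {ν | 𝔨.mkQ.dualMap ν ∈ T.polyhedron} = halfSpaceInter Y T.lam Set.univ := rfl
  have hYspan : Submodule.span ℝ (Set.range Y) = ⊤ := by
    have : Set.range Y = 𝔨.mkQ '' Set.range T.normal := by rw [← Set.range_comp]; rfl
    rw [this, ← Submodule.map_span, T.span_range_normal, Submodule.map_top, Submodule.range_mkQ]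
  obtain ⟨ν₀, hν₀⟩ : (halfSpaceInter Y T.lam Set.univ).Nonempty := by
    obtain ⟨m, hm⟩ := h0
    refine ⟨𝔨.liftQ (T.Φ m) fun v hv => LinearMap.congr_fun hm ⟨v, hv⟩, fun j _ => ?_⟩
    exact T.Φ_mem_polyhedron m j (Set.mem_univ j)
  have hli : ∀ ν ∈ halfSpaceInter Y T.lam Set.univ,
      LinearIndependent ℝ fun j : activeSet Y T.lam ν => Y j := by
    intro ν hν
    rw [Fintype.linearIndependent_iff]
    intro g hg j
    let c : ι → ℝ := fun i => if h : i ∈ activeSet Y T.lam ν then g ⟨i, h⟩ else 0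
    have hc : c = 0 := by
      refine T.eq_zero_of_mkQ_piMap_eq_zero 𝔨 hiso hν (fun i hi => ?_) ?_
      · by_contra h
        exact hi (dif_neg h)
      · rw [← hg, piMap_apply, map_sum]
        refine (Fintype.sum_of_injective _ Subtype.val_injective _ _ (fun i hi => ?_)
          fun i => ?_).symm
        · have : c i = 0 := dif_neg fun h => hi ⟨⟨i, h⟩, rfl⟩
          rw [this, zero_smul, map_zero]
        · have : c i = g i := dif_pos i.2
          rw [this, map_smul]
    have := congrFun hc j
    simpa [c] using this
  have hJ' : Minimal (fun J' : Finset ι =>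
      halfSpaceInter Y T.lam (J' : Set ι) = halfSpaceInter Y T.lam Set.univ) J := hJ
  have hPJ : halfSpaceInter (fun j : J => Y j) (fun j : J => T.lam j) Set.univ =
      halfSpaceInter Y T.lam Set.univ :=
    (halfSpaceInter_restrict Y T.lam (J : Set ι)).trans hJ'.prop
  refine ⟨ofLinearIndependent (fun j : J => Y j) (fun j : J => T.lam j)
    (T.Q.map (𝔨.mkQ : V →+ V ⧸ 𝔨)) ?_ ?_ ?_ ?_ ?_, hPJ, fun _ => rfl, fun _ => rfl, rfl, ?_⟩
  · obtain ⟨S, hS, hSQ⟩ := T.quasilattice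
    refine ⟨S.image 𝔨.mkQ, ?_, ?_⟩
    · rw [Finset.coe_image, ← Submodule.map_span, hS, Submodule.map_top, Submodule.range_mkQ]
    · rw [← hSQ, AddMonoidHom.map_closure]
      simp
  · exact fun j => ⟨_, T.normal_mem j, rfl⟩
  · rw [hPJ]
    obtain ⟨ν, hν, -⟩ := exists_extremePoint_activeSet_subset hYspan hν₀
    exact ⟨ν, hν⟩
  · intro ν hν
    exact linearIndependent_active_restrict (J : Set ι) (hli ν (hPJ ▸ hν))
  · intro j
    obtain ⟨ν, hν, hj⟩ := exists_mem_of_minimal hν₀ hJ' j.2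
    exact ⟨ν, hPJ.symm ▸ hν, hj⟩
  · intro ν hν j hj
    have hν' : ν ∈ halfSpaceInter Y T.lam Set.univ := hPJ ▸ hν
    exact lt_of_le_of_ne (hν' j (Set.mem_univ j)) fun h =>
      hj (activeSet_subset_of_eq hli hJ'.prop hν' h.symm)

end ToricTriple

/-! ### Slices for torus actions -/

section Torus

variable {ι : Type}

theorem torusExp_zero : torusExp (0 : ι → ℝ) = 1 := by
  ext j; simp [torusExp]

theorem torusExp_add (a b : ι → ℝ) : torusExp (a + b) = torusExp a * torusExp b := by
  ext j; simp [torusExp, mul_add, Circle.exp_add]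

theorem torusExp_neg (a : ι → ℝ) : torusExp (-a) = (torusExp a)⁻¹ := by
  ext j; simp [torusExp, Circle.exp_neg]

theorem torus_smul_apply (t : ι → Circle) (w : ι → ℂ) (j : ι) : (t • w) j = (t j : ℂ) * w j := by
  simp [Circle.smul_def]

theorem coe_torusExp (a : ι → ℝ) (j : ι) :
    (torusExp a j : ℂ) = Complex.exp (2 * Real.pi * a j * Complex.I) := by
  simp [torusExp, Circle.coe_exp]

theorem norm_torus_smul (t : ι → Circle) (w : ι → ℂ) (j : ι) : ‖(t • w) j‖ = ‖w j‖ := by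
  simp

theorem torusExp_apply_eq_one_iff (a : ι → ℝ) (j : ι) :
    torusExp a j = 1 ↔ ∃ m : ℤ, a j = m := by
  rw [torusExp, Circle.exp_eq_one]
  constructor
  · rintro ⟨m, hm⟩
    refine ⟨m, ?_⟩
    have : (2 * Real.pi) * a j = (2 * Real.pi) * m := by rw [hm]; ring
    exact mul_left_cancel₀ (by positivity) this
  · rintro ⟨m, hm⟩
    exact ⟨m, by rw [hm]; ring⟩

theorem torus_apply_eq_one_of_smul {t : ι → Circle} {w w' : ι → ℂ} (h : t • w = w') {j : ι}
    (hw : w j = ‖w j‖) (hw' : w' j = ‖w' j‖) (h0 : w j ≠ 0) : t j = 1 := by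
  have h1 : (t j : ℂ) * w j = w' j := by rw [← torus_smul_apply, h]
  have h2 : ‖w' j‖ = ‖w j‖ := by rw [← h, norm_torus_smul]
  rw [hw', h2, ← hw] at h1
  exact Circle.coe_injective (mul_right_cancel₀ h0 (by rw [h1]; simp))

theorem arg_torusExp_smul {b : ι → ℝ} {w : ι → ℂ} {j : ι} (hb : |b j| < 1 / 2)
    (hw : w j = ‖w j‖) (h0 : w j ≠ 0) : Complex.arg ((torusExp b • w) j) = 2 * Real.pi * b j := by
  have h := abs_lt.mp hb
  have hpi := Real.pi_pos
  rw [torus_smul_apply, coe_torusExp, hw, mul_comm]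
  have : (2 * Real.pi * b j * Complex.I : ℂ) = ((2 * Real.pi * b j : ℝ) : ℂ) * Complex.I := by
    push_cast; ring
  rw [this, Complex.exp_mul_I, Complex.arg_mul_cos_add_sin_mul_I (norm_pos_iff.mpr h0)]
  constructor <;> nlinarith

end Torus

/-- A slice for the subgroup `exp (ker P)` of the torus, where `P : ℝ^ι → W`: a set `S` of
coordinates with a linear section of `P` with values in `ℝ^S`.  Such a section allows to turn
all coordinates outside of `S` to non-negative real numbers by an element of `exp (ker P)`
(see `Slice.normalize`). -/
structure Slice {ι : Type} {W : Type*} [AddCommGroup W] [Module ℝ W]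
    (P : (ι → ℝ) →ₗ[ℝ] W) where
  support : Set ι
  sec : W →ₗ[ℝ] (ι → ℝ)
  comp_sec : ∀ w, P (sec w) = w
  sec_apply : ∀ w, ∀ j ∉ support, sec w j = 0

namespace Slice

variable {ι : Type} {W : Type*} [AddCommGroup W] [Module ℝ W] {P : (ι → ℝ) →ₗ[ℝ] W}
  (σ : Slice P)

/-- The arguments, in units of a full turn, of the coordinates outside of `S`, and `0` in `S`. -/
noncomputable def angle (w : ι → ℂ) : ι → ℝ :=
  σ.supportᶜ.indicator fun j => Complex.arg (w j) / (2 * Real.pi)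

/-- The element of `ker P` whose exponential turns the coordinates outside of `S` to non-negative
real numbers. -/
noncomputable def rot (w : ι → ℂ) : ι → ℝ := σ.sec (P (σ.angle w)) - σ.angle w

/-- The point of the `exp (ker P)`-orbit of `w` whose coordinates outside of `S` are non-negative
real numbers. -/
noncomputable def normalize (w : ι → ℂ) : ι → ℂ := torusExp (σ.rot w) • w

/-- The set on which `normalize` is smooth. -/
def slitSet : Set (ι → ℂ) := {w | ∀ j ∉ σ.support, w j ∈ Complex.slitPlane}

theorem P_rot (w : ι → ℂ) : P (σ.rot w) = 0 := by
  rw [rot, map_sub, σ.comp_sec, sub_self]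

theorem rot_apply (w : ι → ℂ) {j : ι} (hj : j ∉ σ.support) :
    σ.rot w j = -(Complex.arg (w j) / (2 * Real.pi)) := by
  have : j ∈ σ.supportᶜ := hj
  simp [rot, σ.sec_apply _ j hj, angle, Set.indicator_of_mem this]

theorem normalize_apply (w : ι → ℂ) {j : ι} (hj : j ∉ σ.support) :
    σ.normalize w j = ‖w j‖ := by
  rw [normalize, torus_smul_apply, coe_torusExp, σ.rot_apply w hj]
  conv_lhs => rw [← Complex.norm_mul_exp_arg_mul_I (w j)]
  have hpi : (Real.pi : ℂ) ≠ 0 := by exact_mod_cast Real.pi_ne_zero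
  rw [mul_left_comm, ← Complex.exp_add]
  have : (2 * Real.pi * ((-(Complex.arg (w j) / (2 * Real.pi)) : ℝ) : ℂ) * Complex.I +
      Complex.arg (w j) * Complex.I : ℂ) = 0 := by
    push_cast
    field_simp
    ring
  rw [Complex.norm_mul_exp_arg_mul_I, this, Complex.exp_zero, mul_one]

theorem norm_normalize (w : ι → ℂ) (j : ι) : ‖σ.normalize w j‖ = ‖w j‖ := norm_torus_smul _ _ _

theorem rot_eq_zero {w : ι → ℂ} (hw : ∀ j ∉ σ.support, w j = ‖w j‖) : σ.rot w = 0 := by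
  have : σ.angle w = 0 := by
    ext j
    by_cases hj : j ∈ σ.supportᶜ
    · rw [angle, Set.indicator_of_mem hj, hw j hj, Complex.arg_ofReal_of_nonneg (norm_nonneg _)]
      simp
    · rw [angle, Set.indicator_of_notMem hj]; rfl
  rw [rot, this, map_zero, map_zero, sub_zero]

theorem normalize_eq_self {w : ι → ℂ} (hw : ∀ j ∉ σ.support, w j = ‖w j‖) :
    σ.normalize w = w := by
  rw [normalize, σ.rot_eq_zero hw, torusExp_zero, one_smul]

theorem mem_slitSet {w : ι → ℂ} (hw : ∀ j ∉ σ.support, w j = ‖w j‖)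
    (h0 : ∀ j ∉ σ.support, w j ≠ 0) : w ∈ σ.slitSet := fun j hj => by
  rw [hw j hj, Complex.ofReal_mem_slitPlane]
  exact norm_pos_iff.mpr (h0 j hj)

theorem abs_rot_lt {w : ι → ℂ} (hw : w ∈ σ.slitSet) {j : ι} (hj : j ∉ σ.support) :
    |σ.rot w j| < 1 / 2 := by
  have h1 := Complex.mem_slitPlane_iff_arg.mp (hw j hj)
  have h2 := Complex.arg_le_pi (w j)
  have h3 := Complex.neg_pi_lt_arg (w j)
  have h4 : Complex.arg (w j) < Real.pi := lt_of_le_of_ne h2 h1.1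
  have hpi := Real.pi_pos
  rw [σ.rot_apply w hj, abs_neg, abs_div, abs_of_pos (by positivity : 0 < 2 * Real.pi),
    div_lt_iff₀ (by positivity), abs_lt]
  constructor <;> linarith

/-- If `P` is injective on `ℝ^S`, then `normalize` undoes small rotations in `exp (ker P)`. -/
theorem rot_torusExp_smul (hinj : ∀ c : ι → ℝ, (∀ j ∉ σ.support, c j = 0) → P c = 0 → c = 0)
    {b : ι → ℝ} (hPb : P b = 0) {w : ι → ℂ} (hb : ∀ j ∉ σ.support, |b j| < 1 / 2)
    (hw : ∀ j ∉ σ.support, w j = ‖w j‖) (h0 : ∀ j ∉ σ.support, w j ≠ 0) :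
    σ.rot (torusExp b • w) = -b := by
  have hoff : ∀ j ∉ σ.support, σ.rot (torusExp b • w) j = -b j := fun j hj => by
    have := Real.pi_pos
    rw [σ.rot_apply _ hj, arg_torusExp_smul (hb j hj) (hw j hj) (h0 j hj)]
    field_simp
  rw [← add_eq_zero_iff_eq_neg]
  exact hinj _ (fun j hj => by simp [hoff j hj]) (by rw [map_add, P_rot, hPb, add_zero])

section Smooth

variable [Fintype ι]

theorem isOpen_slitSet : IsOpen σ.slitSet := by
  have : σ.slitSet = ⋂ j, {w : ι → ℂ | j ∉ σ.support → w j ∈ Complex.slitPlane} := by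
    ext w; simp [slitSet]
  rw [this]
  refine isOpen_iInter_of_finite fun j => ?_
  by_cases hj : j ∈ σ.support
  · simp [hj]
  · simp only [hj, not_false_eq_true, forall_const]
    exact Complex.isOpen_slitPlane.preimage (continuous_apply j)

theorem contDiffOn_angle : ContDiffOn ℝ ∞ σ.angle σ.slitSet := by
  rw [contDiffOn_pi]
  intro j
  by_cases hj : j ∈ σ.support
  · have : (fun w => σ.angle w j) = fun _ => 0 := by
      ext w
      have : j ∉ σ.supportᶜ := fun h => h hj
      rw [angle, Set.indicator_of_notMem this]
    rw [this]
    exact contDiffOn_const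
  · have : (fun w => σ.angle w j) = fun w => (Complex.log (w j)).im / (2 * Real.pi) := by
      ext w
      have : j ∈ σ.supportᶜ := hj
      rw [angle, Set.indicator_of_mem this, Complex.log_im]
    rw [this]
    intro w hw
    have h1 : ContDiffAt ℝ ∞ Complex.log (w j) :=
      (Complex.contDiffAt_log (hw j hj)).restrict_scalars ℝ
    have h2 : ContDiffAt ℝ ∞ (fun w : ι → ℂ => w j) w := by fun_prop
    have h12 := ContDiffAt.comp w h1 h2
    have h3 : ContDiffAt ℝ ∞ (fun w : ι → ℂ => (Complex.log (w j)).im) w :=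
      ContDiffAt.comp w Complex.imCLM.contDiff.contDiffAt h12
    exact (h3.div_const _).contDiffWithinAt

theorem contDiffOn_rot : ContDiffOn ℝ ∞ σ.rot σ.slitSet := by
  let A : (ι → ℝ) →L[ℝ] (ι → ℝ) := LinearMap.toContinuousLinearMap (σ.sec ∘ₗ P)
  have : σ.rot = fun w => A (σ.angle w) - σ.angle w := rfl
  rw [this]
  exact (A.contDiff.comp_contDiffOn σ.contDiffOn_angle).sub σ.contDiffOn_angle

theorem contDiff_torusExp_smul :
    ContDiff ℝ ∞ fun p : (ι → ℝ) × (ι → ℂ) => torusExp p.1 • p.2 := by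
  rw [contDiff_pi]
  intro j
  have : (fun p : (ι → ℝ) × (ι → ℂ) => (torusExp p.1 • p.2) j) =
      fun p => Complex.exp (2 * Real.pi * Complex.ofRealCLM (p.1 j) * Complex.I) * p.2 j := by
    ext p
    rw [torus_smul_apply, coe_torusExp]
    rfl
  rw [this]
  fun_prop

theorem contDiffOn_normalize : ContDiffOn ℝ ∞ σ.normalize σ.slitSet :=
  contDiff_torusExp_smul.comp_contDiffOn (σ.contDiffOn_rot.prodMk contDiffOn_id)

theorem contDiff_torus_smul (t : ι → Circle) : ContDiff ℝ ∞ fun w : ι → ℂ => t • w := by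
  rw [contDiff_pi]
  intro j
  simp only [torus_smul_apply]
  fun_prop

end Smooth

end Slice

/-! ### Slices and the standard symplectic form -/

section Symplectic

variable {ι : Type} [Fintype ι]

theorem stdSymplecticForm_apply (v : Fin 2 → ι → ℂ) : stdSymplecticForm ι v =
    -(1 / Real.pi) * ∑ j, ((v 0 j).re * (v 1 j).im - (v 0 j).im * (v 1 j).re) := rfl

/-- The standard form only sees a set of coordinates outside of which both vectors are real. -/
theorem stdSymplecticForm_comp {κ : Type} [Fintype κ] (e : κ ↪ ι) {u v : ι → ℂ}
    (hu : ∀ j ∉ Set.range e, (u j).im = 0) (hv : ∀ j ∉ Set.range e, (v j).im = 0) :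
    stdSymplecticForm κ ![fun h => u (e h), fun h => v (e h)] = stdSymplecticForm ι ![u, v] := by
  rw [stdSymplecticForm_apply, stdSymplecticForm_apply]
  congr 1
  exact Fintype.sum_of_injective e e.injective _ _
    (fun j hj => by simp [hu j hj, hv j hj]) fun _ => rfl

theorem stdSymplecticForm_nondegenerate {u : ι → ℂ}
    (h : ∀ v, stdSymplecticForm ι ![u, v] = 0) : u = 0 := by
  have h1 := h fun j => Complex.I * u j
  rw [stdSymplecticForm_apply] at h1
  have h2 : ∑ j, ((u j).re * (u j).re + (u j).im * (u j).im) = 0 := by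
    have hpi : -(1 / Real.pi) ≠ 0 := by have := Real.pi_pos; simp
    rw [← (mul_eq_zero.mp h1).resolve_left hpi]
    refine Finset.sum_congr rfl fun j _ => ?_
    simp
  ext j
  have h3 := (Finset.sum_eq_zero_iff_of_nonneg fun j _ =>
    add_nonneg (mul_self_nonneg (u j).re) (mul_self_nonneg (u j).im)).mp h2 j (Finset.mem_univ j)
  refine Complex.normSq_eq_zero.mp ?_
  rw [Complex.normSq_apply]
  exact h3

/-- The effect on the standard form of a rotation `z ↦ exp a • z` by variable angles `a`, whose
derivatives in the directions `u` and `v` are `a₁` and `a₂`: the new terms are the pairings of `a₁`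
and `a₂` with the differential of `(|z_j|²)_j`, the moment mapping of the rotations. -/
theorem stdSymplecticForm_rotate (t : ι → Circle) (a₁ a₂ : ι → ℝ) (z u v : ι → ℂ) :
    stdSymplecticForm ι ![t • (u + fun j => 2 * Real.pi * a₁ j * Complex.I * z j),
      t • (v + fun j => 2 * Real.pi * a₂ j * Complex.I * z j)] =
    stdSymplecticForm ι ![u, v] +
      2 * ∑ j, a₁ j * ((z j).re * (v j).re + (z j).im * (v j).im) -
      2 * ∑ j, a₂ j * ((z j).re * (u j).re + (z j).im * (u j).im) := by
  have hpi := Real.pi_ne_zero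
  simp only [stdSymplecticForm_apply, Finset.mul_sum, ← Finset.sum_add_distrib,
    ← Finset.sum_sub_distrib]
  refine Finset.sum_congr rfl fun j _ => ?_
  have ht : (t j : ℂ).re * (t j : ℂ).re + (t j : ℂ).im * (t j : ℂ).im = 1 := by
    rw [← Complex.normSq_apply, Circle.normSq_coe]
  have key : ∀ A B : ℂ, ((t j : ℂ) * A).re * ((t j : ℂ) * B).im -
      ((t j : ℂ) * A).im * ((t j : ℂ) * B).re = A.re * B.im - A.im * B.re := fun A B => by
    simp only [Complex.mul_re, Complex.mul_im]
    linear_combination (A.re * B.im - A.im * B.re) * ht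
  simp only [Matrix.cons_val_zero, Matrix.cons_val_one, torus_smul_apply]
  rw [key]
  simp only [Pi.add_apply, Complex.add_re, Complex.add_im, Complex.mul_re, Complex.mul_im,
    Complex.ofReal_re, Complex.ofReal_im, Complex.I_re, Complex.I_im, Complex.re_ofNat,
    Complex.im_ofNat]
  field_simp
  ring

variable {E : Type*} [NormedAddCommGroup E] [NormedSpace ℝ E]

theorem hasFDerivAt_sum_mul_norm_sq {F : E → ι → ℂ} {F' : E →L[ℝ] (ι → ℂ)} {x : E}
    (hF : HasFDerivAt F F' x) (a : ι → ℝ) (lam : ι → ℝ) :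
    ∃ D : E →L[ℝ] ℝ, HasFDerivAt (fun x => ∑ j, a j * (‖F x j‖ ^ 2 + lam j)) D x ∧
      ∀ u, D u = 2 * ∑ j, a j * ((F x j).re * (F' u j).re + (F x j).im * (F' u j).im) := by
  have hj : ∀ j, HasFDerivAt (fun x => F x j) ((ContinuousLinearMap.proj j).comp F') x := fun j =>
    (hasFDerivAt_pi'.mp hF) j
  have hre : ∀ j, HasFDerivAt (fun x => (F x j).re)
      (Complex.reCLM.comp ((ContinuousLinearMap.proj j).comp F')) x := fun j =>
    Complex.reCLM.hasFDerivAt.comp x (hj j)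
  have him : ∀ j, HasFDerivAt (fun x => (F x j).im)
      (Complex.imCLM.comp ((ContinuousLinearMap.proj j).comp F')) x := fun j =>
    Complex.imCLM.hasFDerivAt.comp x (hj j)
  have h := HasFDerivAt.fun_sum (u := Finset.univ) fun j _ =>
    (((((hre j).mul (hre j)).add ((him j).mul (him j))).add_const (lam j)).const_mul (a j))
  refine ⟨_, h.congr_of_eventuallyEq (Filter.Eventually.of_forall fun x => ?_), fun u => ?_⟩
  · refine Finset.sum_congr rfl fun j _ => ?_
    rw [Complex.sq_norm, Complex.normSq_apply]
    rfl
  · simp [Finset.mul_sum]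
    refine Finset.sum_congr rfl fun j _ => ?_
    ring

/-- The standard form is invariant under the torus. -/
theorem stdSymplecticForm_torus_smul {F : E → ι → ℂ} {F' : E →L[ℝ] (ι → ℂ)} {x : E}
    (hF : HasFDerivAt F F' x) (t : ι → Circle) :
    ∃ D : E →L[ℝ] (ι → ℂ), HasFDerivAt (fun y => t • F y) D x ∧
      ∀ u v, stdSymplecticForm ι ![D u, D v] = stdSymplecticForm ι ![F' u, F' v] := by
  let L : (ι → ℂ) →L[ℝ] (ι → ℂ) := LinearMap.toContinuousLinearMap
    { toFun := fun w => t • w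
      map_add' := fun z z' => smul_add t z z'
      map_smul' := fun c z => by
        ext j
        simp only [torus_smul_apply, Pi.smul_apply, Complex.real_smul, RingHom.id_apply]
        ring }
  refine ⟨_, (L.hasFDerivAt.comp x hF : HasFDerivAt (fun y => t • F y) _ x), fun u v => ?_⟩
  have h := stdSymplecticForm_rotate t 0 0 0 (F' u) (F' v)
  simp only [Pi.zero_apply, Complex.ofReal_zero, mul_zero, zero_mul, Finset.sum_const_zero,
    add_zero, sub_zero] at h
  have h0 : (fun _ : ι => (0 : ℂ)) = 0 := rfl
  rw [h0, add_zero, add_zero] at h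
  exact h

namespace Slice

variable {W : Type*} [AddCommGroup W] [Module ℝ W] {P : (ι → ℝ) →ₗ[ℝ] W} (σ : Slice P)

theorem hasFDerivAt_normalize {F : E → ι → ℂ} {F' : E →L[ℝ] (ι → ℂ)} {x : E}
    (hF : HasFDerivAt F F' x) (hx : F x ∈ σ.slitSet) :
    ∃ (D : E →L[ℝ] (ι → ℂ)) (R : E →L[ℝ] (ι → ℝ)),
      HasFDerivAt (fun x => σ.normalize (F x)) D x ∧ (∀ u, P (R u) = 0) ∧
      ∀ u, D u = torusExp (σ.rot (F x)) •
        (F' u + fun j => 2 * Real.pi * R u j * Complex.I * F x j) := by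
  have hrot : DifferentiableAt ℝ σ.rot (F x) :=
    (σ.contDiffOn_rot.contDiffAt (σ.isOpen_slitSet.mem_nhds hx)).differentiableAt (by simp)
  have hR : HasFDerivAt (fun x => σ.rot (F x)) ((fderiv ℝ σ.rot (F x)).comp F') x :=
    hrot.hasFDerivAt.comp x hF
  set R := (fderiv ℝ σ.rot (F x)).comp F'
  have hdiff : DifferentiableAt ℝ (fun x => σ.normalize (F x)) x :=
    ((σ.contDiffOn_normalize.contDiffAt (σ.isOpen_slitSet.mem_nhds hx)).differentiableAt
      (by simp)).comp x hF.differentiableAt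
  refine ⟨_, R, hdiff.hasFDerivAt, fun u => ?_, fun u => ?_⟩
  · -- `W` carries no norm, so the equation `P ∘ rot = 0` is composed with the injective map `sec`
    -- before it is differentiated
    let A : (ι → ℝ) →L[ℝ] (ι → ℝ) := LinearMap.toContinuousLinearMap (σ.sec ∘ₗ P)
    have h1 : HasFDerivAt (fun x => A (σ.rot (F x))) (A.comp R) x := A.hasFDerivAt.comp x hR
    have h2 : (fun x => A (σ.rot (F x))) = fun _ => 0 := by
      ext1 y
      change σ.sec (P (σ.rot (F y))) = 0
      rw [P_rot, map_zero]
    rw [h2] at h1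
    have h3 : A (R u) = 0 := by
      have := h1.unique (hasFDerivAt_const (0 : ι → ℝ) x)
      exact congrArg (fun L : E →L[ℝ] (ι → ℝ) => L u) this
    rw [← σ.comp_sec (P (R u))]
    change P (A (R u)) = 0
    rw [h3, map_zero]
  · ext j
    have h1 := hasFDerivAt_pi'.mp hdiff.hasFDerivAt j
    have hrj := Complex.ofRealCLM.hasFDerivAt.comp x ((hasFDerivAt_pi'.mp hR) j)
    have h2 := (((hrj.const_mul (2 * Real.pi * Complex.I : ℂ)).cexp).mul
      ((hasFDerivAt_pi'.mp hF) j))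
    have h3 := h1.unique (h2.congr_of_eventuallyEq (Filter.Eventually.of_forall fun y => by
      simp only [normalize, torus_smul_apply, coe_torusExp, Pi.mul_apply, Function.comp_apply,
        Complex.ofRealCLM_apply]
      congr 2
      ring))
    have h4 := congrArg (fun L : E →L[ℝ] ℂ => L u) h3
    simp only [ContinuousLinearMap.comp_apply, ContinuousLinearMap.proj_apply] at h4
    rw [h4, torus_smul_apply, coe_torusExp]
    simp
    ring_nf

/-- Turning a family of points of a level set by variable elements of `exp (ker P)` does not change
the pull-back of the standard form in the directions tangent to the level set. -/
theorem stdSymplecticForm_normalize {F : E → ι → ℂ} {F' : E →L[ℝ] (ι → ℂ)} {x : E}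
    (hF : HasFDerivAt F F' x) (hx : F x ∈ σ.slitSet) {s : Set E} {lam : ι → ℝ} (hxs : x ∈ s)
    (hs : ∀ y ∈ s, ∀ a, P a = 0 → ∑ j, a j * (‖F y j‖ ^ 2 + lam j) = 0) {u v : E}
    (hu : u ∈ tangentConeAt ℝ s x) (hv : v ∈ tangentConeAt ℝ s x) :
    stdSymplecticForm ι ![fderiv ℝ (fun x => σ.normalize (F x)) x u,
      fderiv ℝ (fun x => σ.normalize (F x)) x v] = stdSymplecticForm ι ![F' u, F' v] := by
  have key : ∀ u ∈ tangentConeAt ℝ s x, ∀ a, P a = 0 →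
      2 * ∑ j, a j * ((F x j).re * (F' u j).re + (F x j).im * (F' u j).im) = 0 := by
    intro u hu a ha
    obtain ⟨D, hD, hDu⟩ := hasFDerivAt_sum_mul_norm_sq hF a lam
    rw [← hDu]
    have h0 : HasFDerivWithinAt (fun x => ∑ j, a j * (‖F x j‖ ^ 2 + lam j)) (0 : E →L[ℝ] ℝ) s x :=
      (hasFDerivWithinAt_const (0 : ℝ) x s).congr (fun y hy => hs y hy a ha) (hs x hxs a ha)
    exact hD.hasFDerivWithinAt.unique_on h0 hu
  obtain ⟨D, R, hD, hPR, hDR⟩ := σ.hasFDerivAt_normalize hF hx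
  rw [hD.fderiv, hDR, hDR, stdSymplecticForm_rotate, key v hv _ (hPR u), key u hu _ (hPR v),
    add_zero, sub_zero]

end Slice

end Symplectic

/-! ### The vertex charts -/

namespace Slice

variable {ι : Type} {W : Type*} [AddCommGroup W] [Module ℝ W] {P : (ι → ℝ) →ₗ[ℝ] W}

/-- The slice given by coordinates whose images under `P` form a basis of `W`. -/
noncomputable def ofBasis [DecidableEq ι] {κ : Type} [Fintype κ] (P : (ι → ℝ) →ₗ[ℝ] W) (e : κ ↪ ι)
    (b : Module.Basis κ ℝ W) (hb : ∀ h, b h = P (Pi.single (e h) 1)) : Slice P where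
  support := Set.range e
  sec := b.constr ℝ fun h => Pi.single (e h) 1
  comp_sec w := by
    have : P ∘ₗ b.constr ℝ (fun h => Pi.single (e h) (1 : ℝ)) = LinearMap.id :=
      b.ext fun h => by
        rw [LinearMap.comp_apply, Module.Basis.constr_basis, ← hb, LinearMap.id_apply]
    exact LinearMap.congr_fun this w
  sec_apply w j hj := by
    rw [Module.Basis.constr_apply_fintype, Finset.sum_apply]
    refine Finset.sum_eq_zero fun h _ => ?_
    have : j ≠ e h := fun h' => hj ⟨h, h'.symm⟩
    simp [this]

theorem ofBasis_injective [Fintype ι] [DecidableEq ι] {κ : Type} [Fintype κ] (e : κ ↪ ι)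
    (b : Module.Basis κ ℝ W) (hb : ∀ h, b h = P (Pi.single (e h) 1)) (c : ι → ℝ)
    (hc : ∀ j ∉ (ofBasis P e b hb).support, c j = 0) (h0 : P c = 0) : c = 0 := by
  have h1 : c = ∑ h, c (e h) • Pi.single (e h) (1 : ℝ) := by
    have : c = ∑ j, c j • Pi.single j (1 : ℝ) := by
      ext j; simp [Finset.sum_apply, Pi.single_apply]
    rw [this]
    symm
    refine Fintype.sum_of_injective e e.injective _ _ (fun j hj => ?_) fun h => ?_
    · rw [hc j hj, zero_smul]
    · rw [← this]
  have h2 : ∑ h, c (e h) • b h = 0 := by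
    rw [← h0]
    conv_rhs => rw [h1]
    simp [map_sum, hb]
  have h3 := Fintype.linearIndependent_iff.mp b.linearIndependent (fun h => c (e h)) h2
  rw [h1]
  simp [h3]

theorem sec_apply_eq (σ : Slice P)
    (hinj : ∀ c : ι → ℝ, (∀ j ∉ σ.support, c j = 0) → P c = 0 → c = 0) {c : ι → ℝ}
    (hc : ∀ j ∉ σ.support, c j = 0) : σ.sec (P c) = c := by
  rw [← sub_eq_zero]
  refine hinj _ (fun j hj => ?_) ?_
  · rw [Pi.sub_apply, σ.sec_apply _ j hj, hc j hj, sub_zero]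
  · rw [map_sub, σ.comp_sec, sub_self]

end Slice

theorem im_fderiv_apply_eq_zero {ι : Type} [Fintype ι] {E : Type*} [NormedAddCommGroup E]
    [NormedSpace ℝ E] {F : E → ι → ℂ} {F' : E →L[ℝ] (ι → ℂ)} {x : E} (hF : HasFDerivAt F F' x)
    {j : ι} (h : ∀ᶠ y in 𝓝 x, (F y j).im = 0) (u : E) : (F' u j).im = 0 := by
  have h1 : HasFDerivAt (fun y => (F y j).im)
      (Complex.imCLM.comp ((ContinuousLinearMap.proj j).comp F')) x :=
    Complex.imCLM.hasFDerivAt.comp x ((hasFDerivAt_pi'.mp hF) j)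
  have h2 := h1.unique ((hasFDerivAt_const (0 : ℝ) x).congr_of_eventuallyEq h)
  exact congrArg (fun L : E →L[ℝ] ℝ => L u) h2

/-- Reading off the slice coordinates of the normalized points of a level set preserves the
standard forms, in the directions tangent to the level set: the other coordinates are real. -/
theorem Slice.stdSymplecticForm_normalize_comp {ι : Type} [Fintype ι] {W : Type*} [AddCommGroup W]
    [Module ℝ W] {P : (ι → ℝ) →ₗ[ℝ] W} (σ : Slice P) {κ : Type} [Fintype κ] (e : κ ↪ ι)
    (he : σ.support = Set.range e) {E : Type*} [NormedAddCommGroup E] [NormedSpace ℝ E]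
    {F : E → ι → ℂ} {F' : E →L[ℝ] (ι → ℂ)} {x : E} (hF : HasFDerivAt F F' x)
    (hx : F x ∈ σ.slitSet) {s : Set E} {lam : ι → ℝ} (hxs : x ∈ s)
    (hs : ∀ y ∈ s, ∀ a, P a = 0 → ∑ j, a j * (‖F y j‖ ^ 2 + lam j) = 0) {u v : E}
    (hu : u ∈ tangentConeAt ℝ s x) (hv : v ∈ tangentConeAt ℝ s x) :
    stdSymplecticForm κ ![fderiv ℝ (fun x h => σ.normalize (F x) (e h)) x u,
      fderiv ℝ (fun x h => σ.normalize (F x) (e h)) x v] = stdSymplecticForm ι ![F' u, F' v] := by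
  obtain ⟨D, R, hD, -, -⟩ := σ.hasFDerivAt_normalize hF hx
  have h1 := σ.stdSymplecticForm_normalize hF hx hxs hs hu hv
  have him : ∀ u, ∀ j ∉ Set.range e, (D u j).im = 0 := fun u j hj =>
    im_fderiv_apply_eq_zero hD (Filter.Eventually.of_forall fun y => by
      rw [σ.normalize_apply (F y) (he ▸ hj), Complex.ofReal_im]) u
  have hcoord : HasFDerivAt (fun x h => σ.normalize (F x) (e h))
      (ContinuousLinearMap.pi fun h => (ContinuousLinearMap.proj (e h)).comp D) x :=
    hasFDerivAt_pi.mpr fun h => (hasFDerivAt_pi'.mp hD) (e h)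
  rw [← h1, hD.fderiv, hcoord.fderiv, ← stdSymplecticForm_comp e (him u) (him v)]
  rfl

namespace ToricTriple

variable {V : Type*} [AddCommGroup V] [Module ℝ V] {ι : Type} [Fintype ι]
  (T : ToricTriple V ι) (e : T.VertexIndex)

theorem piMap_single [DecidableEq ι] (j : ι) : T.piMap (Pi.single j 1) = T.normal j := by
  simp [piMap_apply, Pi.single_apply]

open Classical in
/-- The slice of the normals at a vertex. -/
noncomputable def vertexSlice : Slice T.piMap :=
  Slice.ofBasis T.piMap e.1 (T.vertexBasis e) fun h => by
    rw [vertexBasis_apply, piMap_single]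

theorem vertexSlice_injective (c : ι → ℝ) (hc : ∀ j ∉ (T.vertexSlice e).support, c j = 0)
    (h0 : T.piMap c = 0) : c = 0 := by
  classical exact Slice.ofBasis_injective e.1 (T.vertexBasis e) _ c hc h0

theorem radicand_eq {z : Fin (Module.finrank ℝ V) → ℂ} {μ : Module.Dual ℝ V}
    (hμ : ∀ h, ‖z h‖ ^ 2 + T.lam (e.1 h) = μ (T.normal (e.1 h))) (j : ι) :
    T.radicand e z j = μ (T.normal j) - T.lam j := by
  rw [radicand]
  congr 1
  conv_rhs => rw [← (T.vertexBasis e).sum_repr (T.normal j), map_sum]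
  exact Finset.sum_congr rfl fun h _ => by rw [hμ, map_smul, smul_eq_mul, vertexBasis_apply]

theorem vertexLift_apply_of_notMem (z : Fin (Module.finrank ℝ V) → ℂ) {j : ι}
    (hj : j ∉ Set.range e.1) : T.vertexLift e z j = (Real.sqrt (T.radicand e z j) : ℂ) := by
  rw [vertexLift, dif_neg]
  exact hj

theorem vertexLift_eq_norm (z : Fin (Module.finrank ℝ V) → ℂ) {j : ι} (hj : j ∉ Set.range e.1) :
    T.vertexLift e z j = ‖T.vertexLift e z j‖ := by
  rw [T.vertexLift_apply_of_notMem e z hj, Complex.norm_real, Real.norm_eq_abs,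
    abs_of_nonneg (Real.sqrt_nonneg _)]

theorem vertexLift_ne_zero {z : Fin (Module.finrank ℝ V) → ℂ} (hz : z ∈ T.vertexDom e) {j : ι}
    (hj : j ∉ Set.range e.1) : T.vertexLift e z j ≠ 0 := by
  rw [T.vertexLift_apply_of_notMem e z hj]
  exact_mod_cast (Real.sqrt_pos.mpr (hz j hj)).ne'

/-- A point of `Ψ⁻¹(0)` whose coordinates outside of the vertex are positive is determined by its
coordinates at the vertex. -/
theorem vertexLift_comp {w : ι → ℂ} (hw : w ∈ T.levelSet)
    (hreal : ∀ j ∉ Set.range e.1, w j = ‖w j‖) (h0 : ∀ j ∉ Set.range e.1, w j ≠ 0) :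
    (fun h => w (e.1 h)) ∈ T.vertexDom e ∧ T.vertexLift e (fun h => w (e.1 h)) = w := by
  obtain ⟨μ, hμ⟩ := (T.mem_levelSet_iff w).mp hw
  have hrad : ∀ j, T.radicand e (fun h => w (e.1 h)) j = ‖w j‖ ^ 2 := fun j => by
    rw [T.radicand_eq e (fun h => hμ (e.1 h)), ← hμ j, add_sub_cancel_right]
  refine ⟨fun j hj => ?_, ?_⟩
  · rw [hrad]
    have := norm_pos_iff.mpr (h0 j hj)
    positivity
  · ext j
    by_cases hj : j ∈ Set.range e.1
    · obtain ⟨h, rfl⟩ := hj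
      rw [vertexLift_apply]
    · rw [T.vertexLift_apply_of_notMem e _ hj, hrad, Real.sqrt_sq (norm_nonneg _), ← hreal j hj]

theorem zero_mem_vertexDom : (0 : Fin (Module.finrank ℝ V) → ℂ) ∈ T.vertexDom e := by
  obtain ⟨ν, hν, he⟩ := e.2
  intro j hj
  rw [T.radicand_eq e (μ := ν) fun h => ?_]
  · refine sub_pos.mpr (lt_of_le_of_ne (hν.1 j (Set.mem_univ j)) fun h => hj ?_)
    rw [he]
    exact h.symm
  · have : e.1 h ∈ {j | ν (T.normal j) = T.lam j} := he ▸ ⟨h, rfl⟩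
    rw [show ν (T.normal (e.1 h)) = T.lam (e.1 h) from this]
    simp

theorem contDiff_radicand (j : ι) : ContDiff ℝ ∞ fun z => T.radicand e z j := by
  unfold radicand
  refine (ContDiff.sum fun h _ => contDiff_const.mul (ContDiff.add ?_ contDiff_const)).sub
    contDiff_const
  exact (contDiff_norm_sq ℝ).comp (contDiff_apply ℝ ℂ h)

theorem isOpen_vertexDom : IsOpen (T.vertexDom e) := by
  have : T.vertexDom e = ⋂ j, {z | j ∉ Set.range e.1 → 0 < T.radicand e z j} := by
    ext z; simp [vertexDom]
  rw [this]
  refine isOpen_iInter_of_finite fun j => ?_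
  by_cases hj : j ∈ Set.range e.1
  · simp [hj]
  · simp only [hj, not_false_eq_true, forall_const]
    exact isOpen_lt continuous_const (T.contDiff_radicand e j).continuous

theorem contDiffOn_vertexLift : ContDiffOn ℝ ∞ (T.vertexLift e) (T.vertexDom e) := by
  rw [contDiffOn_pi]
  intro j
  by_cases hj : j ∈ Set.range e.1
  · obtain ⟨h, rfl⟩ := hj
    simp only [vertexLift_apply]
    exact (contDiff_apply ℝ ℂ h).contDiffOn
  · simp only [T.vertexLift_apply_of_notMem e _ hj]
    intro z hz
    exact (Complex.ofRealCLM.contDiff.contDiffAt.comp z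
      ((T.contDiff_radicand e j).contDiffAt.sqrt (hz j hj).ne')).contDiffWithinAt

theorem hasFDerivAt_vertexLift {z : Fin (Module.finrank ℝ V) → ℂ} (hz : z ∈ T.vertexDom e) :
    HasFDerivAt (T.vertexLift e) (fderiv ℝ (T.vertexLift e) z) z :=
  (((T.contDiffOn_vertexLift e).contDiffAt ((T.isOpen_vertexDom e).mem_nhds hz)).differentiableAt
    (by simp)).hasFDerivAt

/-- In a vertex chart the symplectic form is the standard form of `ℂ^n`, as the remaining
coordinates are real. -/
theorem vertexChart_form {z : Fin (Module.finrank ℝ V) → ℂ} (hz : z ∈ T.vertexDom e) :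
    (T.vertexChart e).form z = stdSymplecticForm (Fin (Module.finrank ℝ V)) := by
  ext v
  have hd := T.hasFDerivAt_vertexLift e hz
  have him : ∀ u, ∀ j ∉ Set.range e.1, (fderiv ℝ (T.vertexLift e) z u j).im = 0 := fun u j hj =>
    im_fderiv_apply_eq_zero hd (Filter.Eventually.of_forall fun y => by
      rw [T.vertexLift_eq_norm e y hj, Complex.ofReal_im]) u
  have hcoord : ∀ u h, fderiv ℝ (T.vertexLift e) z u (e.1 h) = u h := fun u h => by
    have h1 := (hasFDerivAt_pi'.mp hd) (e.1 h)
    simp only [vertexLift_apply] at h1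
    exact congrArg (fun L : (Fin (Module.finrank ℝ V) → ℂ) →L[ℝ] ℂ => L u)
      (h1.unique (hasFDerivAt_apply h z))
  have h := stdSymplecticForm_comp e.1 (him (v 0)) (him (v 1))
  simp only [hcoord] at h
  have hv : v = ![fun h => v 0 h, fun h => v 1 h] := by
    ext i; fin_cases i <;> rfl
  change stdSymplecticForm ι (fun i => fderiv ℝ (T.vertexLift e) z (v i)) = _
  conv_rhs => rw [hv, h]
  congr 1
  ext i; fin_cases i <;> rfl

theorem rep_iff {x : Fin (Module.finrank ℝ V) → ℂ} {m : T.Space} :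
    (T.vertexChart e).Rep x m ↔
      ∃ hx : x ∈ T.vertexDom e, T.cls ⟨T.vertexLift e x, T.vertexLift_mem e hx⟩ = m := Iff.rfl

theorem normalize_mem_levelSet {W : Type*} [AddCommGroup W] [Module ℝ W]
    {P : (ι → ℝ) →ₗ[ℝ] W} (σ : Slice P) {w : ι → ℂ} (hw : w ∈ T.levelSet) :
    σ.normalize w ∈ T.levelSet :=
  T.levelSet.smul_mem _ hw

theorem normalize_vertexSlice {w : ι → ℂ} (hw : w ∈ T.levelSet)
    (h0 : ∀ j ∉ Set.range e.1, w j ≠ 0) :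
    (fun h => (T.vertexSlice e).normalize w (e.1 h)) ∈ T.vertexDom e ∧
      T.vertexLift e (fun h => (T.vertexSlice e).normalize w (e.1 h)) =
        (T.vertexSlice e).normalize w := by
  refine T.vertexLift_comp e (T.normalize_mem_levelSet _ hw) (fun j hj => ?_) fun j hj => ?_
  · rw [Slice.norm_normalize, (T.vertexSlice e).normalize_apply w hj]
  · rw [(T.vertexSlice e).normalize_apply w hj]
    exact_mod_cast norm_ne_zero_iff.mpr (h0 j hj)

theorem cls_torusExp_smul {b : ι → ℝ} (hb : T.piMap b ∈ T.Q) (w : T.levelSet) :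
    T.cls (torusExp b • w) = T.cls w :=
  (T.cls_eq_iff _ _).mpr ⟨b, hb, rfl⟩

theorem rep_normalize {w : ι → ℂ} (hw : w ∈ T.levelSet) (h0 : ∀ j ∉ Set.range e.1, w j ≠ 0) :
    (T.vertexChart e).Rep (fun h => (T.vertexSlice e).normalize w (e.1 h)) (T.cls ⟨w, hw⟩) := by
  obtain ⟨h1, h2⟩ := T.normalize_vertexSlice e hw h0
  refine (T.rep_iff e).mpr ⟨h1, ?_⟩
  refine (T.cls_eq_iff _ _).mpr ⟨(T.vertexSlice e).rot w, ?_, h2.symm⟩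
  rw [Slice.P_rot]
  exact zero_mem _

end ToricTriple

namespace ToricTriple

variable {V : Type*} [AddCommGroup V] [Module ℝ V] {ι : Type} [Fintype ι]
  (T : ToricTriple V ι) (e e' : T.VertexIndex)

/-! ### The vertex charts are quasifold charts -/

theorem starConvex_vertexDom : StarConvex ℝ 0 (T.vertexDom e) := by
  intro z hz a b ha hb hab j hj
  have h0 := T.zero_mem_vertexDom e j hj
  have h1 := hz j hj
  have : T.radicand e (a • 0 + b • z) j =
      (1 - b ^ 2) * T.radicand e 0 j + b ^ 2 * T.radicand e z j := by
    simp only [radicand, Pi.add_apply, Pi.smul_apply, Pi.zero_apply, smul_zero, zero_add, norm_smul,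
      norm_zero, mul_pow, Real.norm_eq_abs, sq_abs, mul_sub, Finset.mul_sum]
    rw [sub_add_sub_comm, ← Finset.sum_add_distrib]
    congr 1
    · exact Finset.sum_congr rfl fun h _ => by ring
    · ring
  rw [this]
  have hb1 : b ≤ 1 := by linarith
  rcases hb.eq_or_lt with rfl | hb0
  · simpa using h0
  · have : 0 ≤ 1 - b ^ 2 := by nlinarith
    have : 0 < b ^ 2 := by positivity
    positivity

/-- The part of the chart domain with all coordinates different from zero. -/
def vertexTorus : Set (Fin (Module.finrank ℝ V) → ℂ) := {z ∈ T.vertexDom e | ∀ h, z h ≠ 0}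

theorem vertexDom_subset_closure_inter {W : Set (Fin (Module.finrank ℝ V) → ℂ)} (hW : IsOpen W)
    (hsub : W ⊆ T.vertexDom e) : W ⊆ closure (W ∩ T.vertexTorus e) := by
  have hd : Dense (Set.pi Set.univ fun _ : Fin (Module.finrank ℝ V) => ({0}ᶜ : Set ℂ)) :=
    dense_pi _ fun _ _ => dense_compl_singleton 0
  refine (hd.open_subset_closure_inter hW).trans (closure_mono fun z hz => ?_)
  exact ⟨hz.1, hsub hz.1, fun h => hz.2 h (Set.mem_univ h)⟩

/-- In the coordinates `|z_h|²` and `arg z_h` the set is a product of a convex set and a torus. -/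
theorem isConnected_vertexTorus : IsConnected (T.vertexTorus e) := by
  refine ⟨?_, ?_⟩
  · have h := T.vertexDom_subset_closure_inter e (T.isOpen_vertexDom e) subset_rfl
      (T.zero_mem_vertexDom e)
    obtain ⟨z, hz⟩ := closure_nonempty_iff.mp ⟨_, h⟩
    exact ⟨z, hz.2⟩
  let n := Module.finrank ℝ V
  let C : Set ((Fin n → ℝ) × (Fin n → ℝ)) := {p | (∀ h, 0 < p.1 h) ∧
    ∀ j ∉ Set.range e.1, T.lam j <
      ∑ h, (T.vertexBasis e).repr (T.normal j) h * (p.1 h + T.lam (e.1 h))}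
  have hC : Convex ℝ C := by
    rintro p ⟨hp1, hp2⟩ q ⟨hq1, hq2⟩ a b ha hb hab
    have hpos : ∀ x y : ℝ, 0 < x → 0 < y → 0 < a * x + b * y := fun x y hx hy => by
      rcases ha.eq_or_lt with rfl | ha'
      · have : b = 1 := by linarith
        simpa [this] using hy
      · have := mul_nonneg hb hy.le
        have := mul_pos ha' hx
        linarith
    refine ⟨fun h => hpos _ _ (hp1 h) (hq1 h), fun j hj => ?_⟩
    have h1 := hpos _ _ (sub_pos.mpr (hp2 j hj)) (sub_pos.mpr (hq2 j hj))
    rw [← sub_pos]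
    refine h1.trans_eq ?_
    obtain rfl : b = 1 - a := by linarith
    simp only [Prod.fst_add, Prod.smul_fst, Pi.add_apply, Pi.smul_apply, smul_eq_mul, mul_sub,
      Finset.mul_sum]
    rw [sub_add_sub_comm, ← Finset.sum_add_distrib]
    congr 1
    · exact Finset.sum_congr rfl fun h _ => by ring
    · ring
  have himg : T.vertexTorus e = (fun (p : (Fin n → ℝ) × (Fin n → ℝ)) (h : Fin n) =>
      (Real.sqrt (p.1 h) : ℂ) * Complex.exp (p.2 h * Complex.I)) '' C := by
    ext z
    constructor
    · rintro ⟨hz, h0⟩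
      refine ⟨(fun h => ‖z h‖ ^ 2, fun h => Complex.arg (z h)), ⟨fun h => ?_, fun j hj => ?_⟩, ?_⟩
      · have := norm_pos_iff.mpr (h0 h)
        change 0 < ‖z h‖ ^ 2
        positivity
      · exact sub_pos.mp (hz j hj)
      · ext h
        simp only [Real.sqrt_sq (norm_nonneg _)]
        exact Complex.norm_mul_exp_arg_mul_I _
    · rintro ⟨p, ⟨hp1, hp2⟩, rfl⟩
      refine ⟨fun j hj => ?_, fun h => ?_⟩
      · simp only [radicand, norm_mul, Complex.norm_real, Complex.norm_exp_ofReal_mul_I, mul_one,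
          Real.norm_eq_abs, sq_abs, Real.sq_sqrt (hp1 _).le]
        exact sub_pos.mpr (hp2 j hj)
      · have := (Real.sqrt_pos.mpr (hp1 h)).ne'
        exact mul_ne_zero (by exact_mod_cast this) (Complex.exp_ne_zero _)
  rw [himg]
  refine hC.isPreconnected.image _ (Continuous.continuousOn ?_)
  fun_prop

theorem piMap_mem_Q {a : ι → ℝ} (ha : ∀ j, ∃ m : ℤ, a j = m) : T.piMap a ∈ T.Q := by
  rw [piMap_apply]
  refine sum_mem fun j _ => ?_
  obtain ⟨m, hm⟩ := ha j
  rw [hm, Int.cast_smul_eq_zsmul]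
  exact zsmul_mem (T.normal_mem j) m

theorem countable_vertexGroup : Countable (T.vertexGroup e) := by
  have := T.countable_Q
  have hsub : (T.vertexGroup e : Set (ι → Circle)) ⊆
      Set.range fun q : T.Q => torusExp ((T.vertexSlice e).sec q) := by
    classical
    rintro _ ⟨⟨a, ha, rfl⟩, ht⟩
    let c : ι → ℝ := (Set.range e.1).indicator a
    have hc : ∀ j ∉ (T.vertexSlice e).support, c j = 0 := fun j hj =>
      Set.indicator_of_notMem hj a
    have hint : ∀ j, ∃ m : ℤ, (a - c) j = m := fun j => by
      by_cases hj : j ∈ Set.range e.1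
      · exact ⟨0, by simp [c, Set.indicator_of_mem hj]⟩
      · obtain ⟨m, hm⟩ := (torusExp_apply_eq_one_iff a j).mp (ht j hj)
        exact ⟨m, by simp [c, Set.indicator_of_notMem hj, hm]⟩
    have hQ : T.piMap (a - c) ∈ T.Q := T.piMap_mem_Q hint
    have hcQ : T.piMap c ∈ T.Q := by
      have := sub_mem ha hQ
      rwa [map_sub, sub_sub_cancel] at this
    refine ⟨⟨_, hcQ⟩, ?_⟩
    change torusExp ((T.vertexSlice e).sec (T.piMap c)) = torusExp a
    rw [(T.vertexSlice e).sec_apply_eq (T.vertexSlice_injective e) hc]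
    have : torusExp (a - c) = 1 := by
      ext j
      rw [(torusExp_apply_eq_one_iff _ j).mpr (hint j)]
      rfl
    rw [← sub_add_cancel a c, torusExp_add, this, one_mul]
  exact ((Set.countable_range _).mono hsub).to_subtype

theorem vertexChart_act (γ : T.vertexGroup e) (z : Fin (Module.finrank ℝ V) → ℂ)
    (h : Fin (Module.finrank ℝ V)) :
    (T.vertexChart e).act γ z h = ((γ : ι → Circle) (e.1 h) : ℂ) * z h := rfl

theorem norm_vertexChart_act (γ : T.vertexGroup e) (z : Fin (Module.finrank ℝ V) → ℂ)
    (h : Fin (Module.finrank ℝ V)) : ‖(T.vertexChart e).act γ z h‖ = ‖z h‖ := by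
  rw [vertexChart_act, norm_mul, Circle.norm_coe, one_mul]

theorem contDiff_vertexChart_act (γ : T.vertexGroup e) :
    ContDiff ℝ ∞ ((T.vertexChart e).act γ) := by
  rw [contDiff_pi]
  intro h
  simp only [vertexChart_act]
  fun_prop

theorem vertexTorus_subset_freeSet {W : Set (Fin (Module.finrank ℝ V) → ℂ)} :
    W ∩ T.vertexTorus e ⊆ (T.vertexChart e).freeSet W := by
  rintro z ⟨hz, -, h0⟩
  refine ⟨hz, fun (γ : T.vertexGroup e) hγ => Subtype.ext (funext fun j => ?_)⟩
  by_cases hj : j ∈ Set.range e.1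
  · obtain ⟨h, rfl⟩ := hj
    have h1 := congrFun hγ h
    rw [vertexChart_act] at h1
    exact Circle.coe_injective (mul_right_cancel₀ (h0 h) (h1.trans (one_mul (z h)).symm))
  · exact γ.2.2 j hj

/-- An open subset of a chart domain is a model if it is defined by conditions on the `‖z_h‖` and
contains all points with non-zero coordinates: these points are free, connected and dense. -/
theorem isModel_of_subset {W : Set (Fin (Module.finrank ℝ V) → ℂ)} (hW : IsOpen W)
    (hsub : W ⊆ T.vertexDom e) (htor : T.vertexTorus e ⊆ W)
    (hinv : ∀ z z' : Fin (Module.finrank ℝ V) → ℂ, (∀ h, ‖z h‖ = ‖z' h‖) → z ∈ W → z' ∈ W) :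
    (T.vertexChart e).IsModel W := by
  have hcl := T.vertexDom_subset_closure_inter e hW hsub
  have heq : W ∩ T.vertexTorus e = T.vertexTorus e := Set.inter_eq_right.mpr htor
  have hconn := T.isConnected_vertexTorus e
  have hfree : W ∩ T.vertexTorus e ⊆ (T.vertexChart e).freeSet W :=
    T.vertexTorus_subset_freeSet e
  rw [heq] at hcl hfree
  have hfW : (T.vertexChart e).freeSet W ⊆ W := fun z hz => hz.1
  exact
    { isOpen := hW
      isConnected := hconn.subset_closure htor hcl
      countable := T.countable_vertexGroup e
      act_mem := fun γ z hz => hinv z _ (fun h => (T.norm_vertexChart_act e γ z h).symm) hz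
      one_act := fun z _ => by
        ext h
        change ((1 : T.vertexGroup e) : ι → Circle) (e.1 h) • z h = z h
        simp
      mul_act := fun (γ γ' : T.vertexGroup e) z _ => by
        ext h
        exact mul_smul ((γ : ι → Circle) (e.1 h)) ((γ' : ι → Circle) (e.1 h)) (z h)
      smooth_act := fun γ => (T.contDiff_vertexChart_act e γ).contDiffOn
      free_connected := hconn.subset_closure hfree (hfW.trans hcl)
      free_dense := hcl.trans (closure_mono hfree) }

theorem vertexDom_of_norm_eq {z z' : Fin (Module.finrank ℝ V) → ℂ} (h : ∀ h, ‖z h‖ = ‖z' h‖)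
    (hz : z ∈ T.vertexDom e) : z' ∈ T.vertexDom e := fun j hj => by
  have := hz j hj
  simpa only [radicand, h] using this

theorem isModel_vertexDom : (T.vertexChart e).IsModel (T.vertexChart e).dom :=
  T.isModel_of_subset e (T.isOpen_vertexDom e) subset_rfl (fun _ hz => hz.1)
    fun _ _ h hz => T.vertexDom_of_norm_eq e h hz

theorem continuous_cls : Continuous T.cls := continuous_quotient_mk'

theorem continuous_vertexChart_proj : Continuous (T.vertexChart e).proj := by
  refine T.continuous_cls.comp (Continuous.subtype_mk ?_ _)
  exact continuousOn_iff_continuous_domRestrict.mp (T.contDiffOn_vertexLift e).continuousOn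

/-- The points of `Ψ⁻¹(0)` near a point represented in a chart are represented near it, as
`normalize` gives local coordinates. -/
theorem isOpenMap_vertexChart_proj : IsOpenMap (T.vertexChart e).proj := by
  intro U hU
  have hq : IsOpen (T.cls ⁻¹' ((T.vertexChart e).proj '' U)) := by
    rw [isOpen_iff_mem_nhds]
    rintro z ⟨u, huU, hu⟩
    obtain ⟨a, ha, hz⟩ := (T.cls_eq_iff _ _).mp hu
    replace hz : torusExp a • (z : ι → ℂ) = T.vertexLift e u := hz
    have hslit : torusExp a • (z : ι → ℂ) ∈ (T.vertexSlice e).slitSet := by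
      rw [hz]
      exact (T.vertexSlice e).mem_slitSet (fun j hj => T.vertexLift_eq_norm e _ hj)
        fun j hj => T.vertexLift_ne_zero e u.2 hj
    let f : T.levelSet → Fin (Module.finrank ℝ V) → ℂ := fun z' h =>
      (T.vertexSlice e).normalize (torusExp a • (z' : ι → ℂ)) (e.1 h)
    have hcs : Continuous fun z' : T.levelSet => torusExp a • (z' : ι → ℂ) :=
      (Slice.contDiff_torus_smul _).continuous.comp continuous_subtype_val
    have hcont : ContinuousAt f z := by
      rw [continuousAt_pi]
      intro h
      have h1 : ContinuousAt (T.vertexSlice e).normalize (torusExp a • (z : ι → ℂ)) :=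
        (T.vertexSlice e).contDiffOn_normalize.continuousOn.continuousAt
          ((T.vertexSlice e).isOpen_slitSet.mem_nhds hslit)
      exact (continuous_apply (e.1 h)).continuousAt.comp
        (ContinuousAt.comp (f := fun z' : T.levelSet => torusExp a • (z' : ι → ℂ)) h1
          hcs.continuousAt)
    have hfz : f z = u := by
      ext h
      simp only [f]
      rw [hz, (T.vertexSlice e).normalize_eq_self fun j hj => T.vertexLift_eq_norm e _ hj]
      exact T.vertexLift_apply e _ h
    obtain ⟨U', hU', hUU'⟩ := isOpen_induced_iff.mp hU
    have hev1 : ∀ᶠ z' in 𝓝 z, f z' ∈ U' := by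
      refine hcont.eventually_mem (hU'.mem_nhds ?_)
      rw [hfz]
      have : u ∈ Subtype.val ⁻¹' U' := hUU' ▸ huU
      exact this
    have hev2 : ∀ᶠ z' : T.levelSet in 𝓝 z, torusExp a • (z' : ι → ℂ) ∈ (T.vertexSlice e).slitSet :=
      hcs.continuousAt.eventually_mem ((T.vertexSlice e).isOpen_slitSet.mem_nhds hslit)
    filter_upwards [hev1, hev2] with z' h1 h2
    obtain ⟨hx, hrep⟩ := T.rep_normalize e (w := torusExp a • (z' : ι → ℂ))
      (T.levelSet.smul_mem _ z'.2) fun j hj => Complex.slitPlane_ne_zero (h2 j hj)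
    refine ⟨⟨f z', hx⟩, ?_, hrep.trans (T.cls_torusExp_smul ha z')⟩
    rw [← hUU']
    exact h1
  exact isQuotientMap_quotient_mk'.isOpen_preimage.mp hq

theorem isChart_vertexChart : (T.vertexChart e).IsChart where
  isModel := T.isModel_vertexDom e
  simplyConnected := by
    have : ContractibleSpace (T.vertexChart e).dom :=
      (T.starConvex_vertexDom e).contractibleSpace ⟨0, T.zero_mem_vertexDom e⟩
    infer_instance
  continuous := T.continuous_vertexChart_proj e
  isOpenMap := T.isOpenMap_vertexChart_proj e
  fibre := by
    intro x y
    change T.cls _ = T.cls _ ↔ _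
    rw [T.cls_eq_iff]
    constructor
    · rintro ⟨a, ha, h⟩
      replace h : torusExp a • T.vertexLift e y = T.vertexLift e x := h
      have hone : ∀ j ∉ Set.range e.1, torusExp a j = 1 := fun j hj =>
        torus_apply_eq_one_of_smul h (T.vertexLift_eq_norm e _ hj) (T.vertexLift_eq_norm e _ hj)
          (T.vertexLift_ne_zero e y.2 hj)
      let γ : T.vertexGroup e := ⟨torusExp a, ⟨a, ha, rfl⟩, hone⟩
      refine ⟨γ⁻¹, funext fun h' => ?_⟩
      have h1 := congrFun h (e.1 h')
      rw [torus_smul_apply, vertexLift_apply, vertexLift_apply] at h1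
      refine (congrArg (fun c : ℂ => ((torusExp a)⁻¹ (e.1 h') : Circle) • c) h1.symm).trans ?_
      rw [← smul_eq_mul, ← Circle.smul_def, smul_smul, Pi.inv_apply, inv_mul_cancel, one_smul]
    · rintro ⟨(γ : T.vertexGroup e), hγ⟩
      obtain ⟨a, ha, hγa⟩ := (T.vertexGroup e).inv_mem γ.2 |>.1
      refine ⟨a, ha, funext fun j => ?_⟩
      change (torusExp a • T.vertexLift e y) j = T.vertexLift e x j
      rw [hγa, torus_smul_apply]
      by_cases hj : j ∈ Set.range e.1
      · obtain ⟨h, rfl⟩ := hj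
        rw [vertexLift_apply, vertexLift_apply, ← hγ, vertexChart_act, ← mul_assoc,
          ← Circle.coe_mul, Pi.inv_apply, inv_mul_cancel, Circle.coe_one, one_mul]
      · have h1 : (((γ : ι → Circle)⁻¹) j) = 1 := by rw [Pi.inv_apply, γ.2.2 j hj, inv_one]
        rw [h1, Circle.coe_one, one_mul, T.vertexLift_apply_of_notMem e _ hj,
          T.vertexLift_apply_of_notMem e _ hj, ← hγ]
        simp only [radicand, norm_vertexChart_act]
  form_smooth := contDiffOn_const.congr fun x hx => T.vertexChart_form e hx
  form_closed := by
    intro x hx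
    have h : (T.vertexChart e).form =ᶠ[𝓝 x] fun _ => stdSymplecticForm _ := by
      filter_upwards [(T.isOpen_vertexDom e).mem_nhds hx] with y hy
      exact T.vertexChart_form e hy
    rw [h.extDeriv_eq]
    ext v
    simp [extDeriv_apply]
  form_nondegenerate := by
    intro x hx u hu
    rw [T.vertexChart_form e hx] at hu
    exact stdSymplecticForm_nondegenerate hu
  form_invariant := by
    intro (γ : T.vertexGroup e) x hx
    rw [T.vertexChart_form e hx, T.vertexChart_form e ((T.isModel_vertexDom e).act_mem γ x hx)]
    let L : (Fin (Module.finrank ℝ V) → ℂ) →L[ℝ] (Fin (Module.finrank ℝ V) → ℂ) :=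
      LinearMap.toContinuousLinearMap
        { toFun := (T.vertexChart e).act γ
          map_add' := fun z z' => by ext h; simp [vertexChart_act, mul_add]
          map_smul' := fun c z => by ext h; simp [vertexChart_act]; ring }
    have hL : fderiv ℝ ((T.vertexChart e).act γ) x = L := L.hasFDerivAt.fderiv
    rw [hL]
    ext v
    have h := stdSymplecticForm_rotate (fun h => (γ : ι → Circle) (e.1 h)) 0 0 0 (v 0) (v 1)
    simp only [Pi.zero_apply, Complex.ofReal_zero, mul_zero, zero_mul, Finset.sum_const_zero,
      add_zero, sub_zero] at h
    have hv : v = ![v 0, v 1] := by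
      ext i; fin_cases i <;> rfl
    rw [hv]
    refine Eq.trans ?_ h
    change stdSymplecticForm _ (fun i => L (![v 0, v 1] i)) = _
    congr 1
    ext i j
    fin_cases i <;> simp [L, vertexChart_act, Circle.smul_def]

end ToricTriple

namespace ToricTriple

variable {V : Type*} [AddCommGroup V] [Module ℝ V] {ι : Type} [Fintype ι]
  (T : ToricTriple V ι) (e e' : T.VertexIndex)

/-! ### Changes of charts -/

/-- The coordinates, in the chart of a vertex, of a point of `Ψ⁻¹(0)`. -/
noncomputable def chartCoord (w : ι → ℂ) : Fin (Module.finrank ℝ V) → ℂ :=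
  fun h => (T.vertexSlice e).normalize w (e.1 h)

theorem contDiffOn_chartCoord : ContDiffOn ℝ ∞ (T.chartCoord e) (T.vertexSlice e).slitSet := by
  rw [contDiffOn_pi]
  exact fun h => (contDiff_apply ℝ ℂ (e.1 h)).comp_contDiffOn
    (T.vertexSlice e).contDiffOn_normalize

theorem vertexLift_mem_slitSet {x : Fin (Module.finrank ℝ V) → ℂ} (hx : x ∈ T.vertexDom e) :
    T.vertexLift e x ∈ (T.vertexSlice e).slitSet :=
  (T.vertexSlice e).mem_slitSet (fun _ hj => T.vertexLift_eq_norm e _ hj)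
    fun _ hj => T.vertexLift_ne_zero e hx hj

theorem chartCoord_vertexLift (x : Fin (Module.finrank ℝ V) → ℂ) :
    T.chartCoord e (T.vertexLift e x) = x := by
  ext h
  rw [chartCoord, (T.vertexSlice e).normalize_eq_self fun j hj => T.vertexLift_eq_norm e _ hj]
  exact T.vertexLift_apply e _ h

theorem vertexLift_chartCoord {w : ι → ℂ} (hw : w ∈ T.levelSet)
    (hs : w ∈ (T.vertexSlice e).slitSet) :
    T.chartCoord e w ∈ T.vertexDom e ∧
      T.vertexLift e (T.chartCoord e w) = (T.vertexSlice e).normalize w :=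
  T.normalize_vertexSlice e hw fun j hj => Complex.slitPlane_ne_zero (hs j hj)

theorem sum_mul_eq_zero_of_mem_levelSet {w : ι → ℂ} (hw : w ∈ T.levelSet) {a : ι → ℝ}
    (ha : T.piMap a = 0) : ∑ j, a j * (‖w j‖ ^ 2 + T.lam j) = 0 := by
  obtain ⟨μ, hμ⟩ := (T.mem_levelSet_iff w).mp hw
  have : μ (T.piMap a) = 0 := by rw [ha, map_zero]
  rw [← this, piMap_apply, map_sum]
  exact Finset.sum_congr rfl fun j _ => by rw [hμ, map_smul, smul_eq_mul]

/-- Passing from a family `F` of points of `Ψ⁻¹(0)` to the coordinates of a chart preserves the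
standard forms. -/
theorem stdSymplecticForm_chartCoord {E : Type*} [NormedAddCommGroup E] [NormedSpace ℝ E]
    {F : E → ι → ℂ} {F' : E →L[ℝ] (ι → ℂ)} {x : E} (hF : HasFDerivAt F F' x)
    (hx : F x ∈ (T.vertexSlice e).slitSet) (hl : ∀ᶠ y in 𝓝 x, F y ∈ T.levelSet) (u v : E) :
    stdSymplecticForm _ ![fderiv ℝ (fun y => T.chartCoord e (F y)) x u,
      fderiv ℝ (fun y => T.chartCoord e (F y)) x v] = stdSymplecticForm ι ![F' u, F' v] := by
  have htan : ∀ u : E, u ∈ tangentConeAt ℝ {y | F y ∈ T.levelSet} x := fun u => by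
    rw [tangentConeAt_of_mem_nhds hl]
    exact Set.mem_univ u
  exact (T.vertexSlice e).stdSymplecticForm_normalize_comp e.1 rfl hF hx
    (s := {y | F y ∈ T.levelSet}) (lam := T.lam) hl.self_of_nhds
    (fun y hy a ha => T.sum_mul_eq_zero_of_mem_levelSet hy ha) (htan u) (htan v)

/-- The domain of the change of charts that lifts the action of a torus element `t`.  The bound on
the angles ensures that the normalization in the chart `e` undoes that in the chart `e'`. -/
def transitionSource (t : ι → Circle) : Set (Fin (Module.finrank ℝ V) → ℂ) :=
  {x ∈ T.vertexDom e | t • T.vertexLift e x ∈ (T.vertexSlice e').slitSet ∧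
    ∀ j ∉ Set.range e.1, |(T.vertexSlice e').rot (t • T.vertexLift e x) j| < 1 / 2}

/-- The change of charts from `e` to `e'` that lifts the action of a torus element `t`. -/
noncomputable def transitionMap (t : ι → Circle) (x : Fin (Module.finrank ℝ V) → ℂ) :
    Fin (Module.finrank ℝ V) → ℂ :=
  T.chartCoord e' (t • T.vertexLift e x)

variable {e e'} in
theorem transitionMap_spec {t : ι → Circle} {x : Fin (Module.finrank ℝ V) → ℂ}
    (hx : x ∈ T.transitionSource e e' t) :
    T.transitionMap e e' t x ∈ T.vertexDom e' ∧ T.vertexLift e' (T.transitionMap e e' t x) =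
      (T.vertexSlice e').normalize (t • T.vertexLift e x) :=
  T.vertexLift_chartCoord e' (T.levelSet.smul_mem _ (T.vertexLift_mem e hx.1)) hx.2.1

variable {e e'} in
theorem transition_rot {t : ι → Circle} {x : Fin (Module.finrank ℝ V) → ℂ}
    (hx : x ∈ T.transitionSource e e' t) :
    t⁻¹ • T.vertexLift e' (T.transitionMap e e' t x) =
      torusExp ((T.vertexSlice e').rot (t • T.vertexLift e x)) • T.vertexLift e x ∧
    (T.vertexSlice e).rot (t⁻¹ • T.vertexLift e' (T.transitionMap e e' t x)) =
      -(T.vertexSlice e').rot (t • T.vertexLift e x) := by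
  have h1 : t⁻¹ • T.vertexLift e' (T.transitionMap e e' t x) =
      torusExp ((T.vertexSlice e').rot (t • T.vertexLift e x)) • T.vertexLift e x := by
    rw [(T.transitionMap_spec hx).2, Slice.normalize, smul_comm, inv_smul_smul]
  refine ⟨h1, ?_⟩
  rw [h1]
  exact (T.vertexSlice e).rot_torusExp_smul (T.vertexSlice_injective e)
    ((T.vertexSlice e').P_rot _) hx.2.2 (fun j hj => T.vertexLift_eq_norm e _ hj)
    fun j hj => T.vertexLift_ne_zero e hx.1 hj

variable {e e'} in
theorem transitionMap_inv {t : ι → Circle} {x : Fin (Module.finrank ℝ V) → ℂ}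
    (hx : x ∈ T.transitionSource e e' t) :
    T.transitionMap e' e t⁻¹ (T.transitionMap e e' t x) = x := by
  obtain ⟨h1, h2⟩ := T.transition_rot hx
  rw [transitionMap]
  ext h
  rw [chartCoord, Slice.normalize, h2, h1, smul_smul, ← torusExp_add, neg_add_cancel,
    torusExp_zero, one_smul]
  exact T.vertexLift_apply e x h

variable {e e'} in
theorem transitionMap_mem {t : ι → Circle} {x : Fin (Module.finrank ℝ V) → ℂ}
    (hx : x ∈ T.transitionSource e e' t) :
    T.transitionMap e e' t x ∈ T.transitionSource e' e t⁻¹ := by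
  obtain ⟨h1, h2⟩ := T.transition_rot hx
  refine ⟨(T.transitionMap_spec hx).1, fun j hj => ?_, fun j hj => ?_⟩
  · have hj0 := T.vertexLift_ne_zero e hx.1 hj
    rw [h1, Complex.mem_slitPlane_iff_arg, arg_torusExp_smul (hx.2.2 j hj)
      (T.vertexLift_eq_norm e _ hj) hj0]
    have h3 := abs_lt.mp (hx.2.2 j hj)
    have hpi := Real.pi_pos
    refine ⟨by nlinarith, ?_⟩
    rw [← norm_ne_zero_iff, norm_torus_smul, norm_ne_zero_iff]
    exact hj0
  · rw [h2, Pi.neg_apply, abs_neg]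
    exact (T.vertexSlice e').abs_rot_lt hx.2.1 hj

theorem contDiffOn_torus_smul_vertexLift (t : ι → Circle) :
    ContDiffOn ℝ ∞ (fun x => t • T.vertexLift e x) (T.vertexDom e) :=
  (Slice.contDiff_torus_smul t).comp_contDiffOn (T.contDiffOn_vertexLift e)

theorem isOpen_transitionSource (t : ι → Circle) : IsOpen (T.transitionSource e e' t) := by
  have hc := (T.contDiffOn_torus_smul_vertexLift e t).continuousOn
  have h1 : IsOpen (T.vertexDom e ∩
      (fun x => t • T.vertexLift e x) ⁻¹' (T.vertexSlice e').slitSet) :=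
    hc.isOpen_inter_preimage (T.isOpen_vertexDom e) (T.vertexSlice e').isOpen_slitSet
  have h2 : ContinuousOn (fun x => (T.vertexSlice e').rot (t • T.vertexLift e x))
      (T.vertexDom e ∩ (fun x => t • T.vertexLift e x) ⁻¹' (T.vertexSlice e').slitSet) :=
    (T.vertexSlice e').contDiffOn_rot.continuousOn.comp (hc.mono Set.inter_subset_left)
      fun x hx => hx.2
  have h3 : IsOpen {b : ι → ℝ | ∀ j ∉ Set.range e.1, |b j| < 1 / 2} := by
    have : {b : ι → ℝ | ∀ j ∉ Set.range e.1, |b j| < 1 / 2} =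
        ⋂ j, {b | j ∉ Set.range e.1 → |b j| < 1 / 2} := by ext; simp
    rw [this]
    refine isOpen_iInter_of_finite fun j => ?_
    by_cases hj : j ∈ Set.range e.1
    · simp [hj]
    · simp only [hj, not_false_eq_true, forall_const]
      exact isOpen_lt (by fun_prop) continuous_const
  convert h2.isOpen_inter_preimage h1 h3 using 1
  ext x
  exact ⟨fun h => ⟨⟨h.1, h.2.1⟩, h.2.2⟩, fun h => ⟨h.1.1, h.1.2, h.2⟩⟩

theorem contDiffOn_transitionMap (t : ι → Circle) :
    ContDiffOn ℝ ∞ (T.transitionMap e e' t) (T.transitionSource e e' t) :=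
  (T.contDiffOn_chartCoord e').comp
    ((T.contDiffOn_torus_smul_vertexLift e t).mono fun _ hx => hx.1) fun _ hx => hx.2.1

/-- The change of charts that lifts the action of a torus element, with inverse that of the
inverse element. -/
noncomputable def transition (t : ι → Circle) :
    OpenPartialHomeomorph (Fin (Module.finrank ℝ V) → ℂ) (Fin (Module.finrank ℝ V) → ℂ) where
  toFun := T.transitionMap e e' t
  invFun := T.transitionMap e' e t⁻¹
  source := T.transitionSource e e' t
  target := T.transitionSource e' e t⁻¹
  map_source' _ hx := T.transitionMap_mem hx
  map_target' x hx := by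
    have := T.transitionMap_mem hx
    rwa [inv_inv] at this
  left_inv' _ hx := T.transitionMap_inv hx
  right_inv' x hx := by
    have := T.transitionMap_inv hx
    rwa [inv_inv] at this
  open_source := T.isOpen_transitionSource e e' t
  open_target := T.isOpen_transitionSource e' e t⁻¹
  continuousOn_toFun := (T.contDiffOn_transitionMap e e' t).continuousOn
  continuousOn_invFun := (T.contDiffOn_transitionMap e' e t⁻¹).continuousOn

/-- The form of a chart is also the pull-back of the standard form of `ℂ^d` by a rotated lift. -/
theorem stdSymplecticForm_smul_vertexLift {x : Fin (Module.finrank ℝ V) → ℂ}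
    (hx : x ∈ T.vertexDom e) (t : ι → Circle) :
    ∃ D : (Fin (Module.finrank ℝ V) → ℂ) →L[ℝ] (ι → ℂ),
      HasFDerivAt (fun y => t • T.vertexLift e y) D x ∧
      ∀ u v, stdSymplecticForm ι ![D u, D v] = (T.vertexChart e).form x ![u, v] := by
  have hd := T.hasFDerivAt_vertexLift e hx
  obtain ⟨D, hD, h⟩ := stdSymplecticForm_torus_smul hd t
  refine ⟨D, hD, fun u v => (h u v).trans ?_⟩
  change _ = stdSymplecticForm ι (fun i => fderiv ℝ (T.vertexLift e) x (![u, v] i))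
  congr 1
  ext i; fin_cases i <;> rfl

/-- A map of `M` that is given on `Ψ⁻¹(0)` by a torus element lifts to symplectic
diffeomorphisms. -/
theorem hasSymplecticLift {f : T.Space → T.Space} (t : ι → Circle)
    (hf : ∀ z : T.levelSet, f (T.cls z) = T.cls (t • z)) {x y : Fin (Module.finrank ℝ V) → ℂ}
    (hx : x ∈ T.vertexDom e) (hy : y ∈ T.vertexDom e')
    (hxy : T.vertexLift e' y = t • T.vertexLift e x) :
    (T.vertexChart e).HasSymplecticLift (T.vertexChart e') f x y := by
  refine ⟨T.transition e e' t, ?_, ?_, fun x' hx' => hx'.1, T.contDiffOn_transitionMap e e' t,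
    T.contDiffOn_transitionMap e' e t⁻¹, ?_, ?_⟩
  · refine ⟨hx, hxy ▸ T.vertexLift_mem_slitSet e' hy, fun j hj => ?_⟩
    rw [← hxy, (T.vertexSlice e').rot_eq_zero fun j hj => T.vertexLift_eq_norm e' _ hj]
    simp
  · change T.chartCoord e' (t • T.vertexLift e x) = y
    rw [← hxy, chartCoord_vertexLift]
  · rintro x' hx' m ⟨hm, rfl⟩
    obtain ⟨h1, h2⟩ := T.transitionMap_spec hx'
    refine (T.rep_iff e').mpr ⟨h1, ?_⟩
    refine Eq.trans ?_ (hf _).symm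
    exact (T.cls_eq_iff _ _).mpr ⟨_, by rw [(T.vertexSlice e').P_rot]; exact zero_mem _, h2.symm⟩
  · intro x' hx'
    ext v
    obtain ⟨D, hD, hform⟩ := T.stdSymplecticForm_smul_vertexLift e hx'.1 t
    have h := T.stdSymplecticForm_chartCoord e' hD hx'.2.1 (by
      filter_upwards [(T.isOpen_vertexDom e).mem_nhds hx'.1] with y hy
      exact T.levelSet.smul_mem _ (T.vertexLift_mem e hy)) (v 0) (v 1)
    rw [hform] at h
    have hv : v = ![v 0, v 1] := by
      ext i; fin_cases i <;> rfl
    rw [hv]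
    refine Eq.trans ?_ h
    have := T.vertexChart_form e' (T.transitionMap_spec hx').1
    change (T.vertexChart e').form (T.transitionMap e e' t x')
      (fun i => fderiv ℝ (T.transitionMap e e' t) x' (![v 0, v 1] i)) = _
    rw [this]
    congr 1
    ext i; fin_cases i <;> rfl

theorem hasSymplecticLift_of_rep {f : T.Space → T.Space} (t : ι → Circle)
    (hf : ∀ z : T.levelSet, f (T.cls z) = T.cls (t • z)) {x y : Fin (Module.finrank ℝ V) → ℂ}
    {m : T.Space} (hx : (T.vertexChart e).Rep x m) (hy : (T.vertexChart e').Rep y (f m)) :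
    (T.vertexChart e).HasSymplecticLift (T.vertexChart e') f x y := by
  obtain ⟨hxd, rfl⟩ := (T.rep_iff e).mp hx
  obtain ⟨hyd, hm⟩ := (T.rep_iff e').mp hy
  rw [hf] at hm
  obtain ⟨a, ha, h⟩ := (T.cls_eq_iff _ _).mp hm
  refine T.hasSymplecticLift e e' (torusExp a * t) (fun z => ?_) hxd hyd ?_
  · rw [hf, mul_smul]
    exact (T.cls_torusExp_smul ha _).symm
  · rw [mul_smul]
    exact h.symm

theorem overlap_eq : (T.vertexChart e).overlap (T.vertexChart e') =
    {x ∈ T.vertexDom e | ∀ j ∉ Set.range e'.1, T.vertexLift e x j ≠ 0} := by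
  ext x
  constructor
  · rintro ⟨m, ⟨hx, rfl⟩, y, hy, hm⟩
    refine ⟨hx, fun j hj h0 => T.vertexLift_ne_zero e' hy hj ?_⟩
    obtain ⟨a, -, h⟩ := (T.cls_eq_iff _ _).mp hm
    have h1 : (torusExp a • T.vertexLift e x) j = T.vertexLift e' y j := congrFun h j
    rw [← h1, torus_smul_apply, h0, mul_zero]
  · rintro ⟨hx, h⟩
    exact ⟨_, ⟨hx, rfl⟩, _, T.rep_normalize e' (T.vertexLift_mem e hx) h⟩

theorem isModel_overlap :
    (T.vertexChart e).IsModel ((T.vertexChart e).overlap (T.vertexChart e')) := by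
  have key : (T.vertexChart e).overlap (T.vertexChart e') =
      {x ∈ T.vertexDom e | ∀ h, e.1 h ∉ Set.range e'.1 → x h ≠ 0} := by
    rw [overlap_eq]
    ext x
    refine and_congr_right fun hx => ⟨fun h i hi => ?_, fun h j hj => ?_⟩
    · rw [← T.vertexLift_apply e x i]
      exact h _ hi
    · by_cases hje : j ∈ Set.range e.1
      · obtain ⟨i, rfl⟩ := hje
        rw [vertexLift_apply]
        exact h i hj
      · exact T.vertexLift_ne_zero e hx hje
  rw [key]
  refine T.isModel_of_subset e ?_ (fun x hx => hx.1) (fun x hx => ⟨hx.1, fun h _ => hx.2 h⟩) ?_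
  · have : {x | x ∈ T.vertexDom e ∧ ∀ h, e.1 h ∉ Set.range e'.1 → x h ≠ 0} =
        T.vertexDom e ∩ ⋂ h, {x | e.1 h ∉ Set.range e'.1 → x h ≠ 0} := by ext; simp
    rw [this]
    refine (T.isOpen_vertexDom e).inter (isOpen_iInter_of_finite fun h => ?_)
    by_cases hh : e.1 h ∈ Set.range e'.1
    · simp only [hh, not_true_eq_false, IsEmpty.forall_iff, Set.ofPred_true, isOpen_univ]
    · simp only [hh, not_false_eq_true, forall_const]
      exact isOpen_ne_fun (continuous_apply h) continuous_const
  · rintro z z' h ⟨hz, h0⟩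
    refine ⟨T.vertexDom_of_norm_eq e h hz, fun i hi => ?_⟩
    rw [← norm_ne_zero_iff, ← h i, norm_ne_zero_iff]
    exact h0 i hi

theorem compatible_vertexChart : (T.vertexChart e).Compatible (T.vertexChart e') := by
  refine fun _ => ⟨T.isModel_overlap e e', T.isModel_overlap e' e, fun x y m hx hy => ?_⟩
  exact T.hasSymplecticLift_of_rep e e' 1 (fun z => by rw [one_smul]; rfl) hx hy

/-- The charts cover: a point lies in the chart of any vertex on all the facets that contain its
value under `Φ`. -/
theorem exists_rep (m : T.Space) : ∃ e x, (T.vertexChart e).Rep x m := by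
  obtain ⟨z, rfl⟩ : ∃ z, T.cls z = m := Quotient.exists_rep m
  obtain ⟨e, he⟩ := T.exists_vertexIndex (T.Φ_mem_polyhedron (T.cls z))
  refine ⟨e, _, T.rep_normalize e z.2 fun j hj h0 => hj (he ?_)⟩
  change T.Φ (T.cls z) (T.normal j) = T.lam j
  rw [Φ_cls_normal, h0]
  simp

theorem isSymplecticQuasifold_atlas : T.atlas.IsSymplecticQuasifold (2 * Module.finrank ℝ V) where
  finiteDimensional := inferInstance
  finrank_eq := by
    rw [Module.finrank_pi_fintype]
    simp [Complex.finrank_real_complex, mul_comm]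
  isChart := T.isChart_vertexChart
  cover := T.exists_rep
  compatible := T.compatible_vertexChart

end ToricTriple

namespace ToricTriple

variable {V : Type*} [AddCommGroup V] [Module ℝ V] {ι : Type} [Fintype ι]
  (T : ToricTriple V ι) (e e' : T.VertexIndex)

/-! ### The Hamiltonian action of the quasitorus -/

theorem mk_vadd_cls (v : V) {a : ι → ℝ} (ha : T.piMap a = v) (z : T.levelSet) :
    (QuotientAddGroup.mk v : V ⧸ T.Q) +ᵥ T.cls z = T.cls (torusExp a • z) := by
  rw [← ha, vadd_cls]

theorem contDiff_quasitorus_lift (t : ι → Circle) :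
    ContDiff ℝ ∞ fun p : (ι → ℝ) × (ι → ℂ) => t • torusExp p.1 • p.2 :=
  (Slice.contDiff_torus_smul t).comp Slice.contDiff_torusExp_smul

/-- The action lifts to smooth maps: in `ℂ^d` it is given by the exponentials of the values of a
linear section of `π`. -/
theorem exists_smooth_lift_vadd {n : ℕ} (ℓ : (Fin n → ℝ) →ₗ[ℝ] V) (v : Fin n → ℝ)
    (x y : Fin (Module.finrank ℝ V) → ℂ) (m : T.Space) (hx : (T.vertexChart e).Rep x m)
    (hy : (T.vertexChart e').Rep y ((QuotientAddGroup.mk (ℓ v) : V ⧸ T.Q) +ᵥ m)) :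
    ∃ (O : Set ((Fin n → ℝ) × (Fin (Module.finrank ℝ V) → ℂ)))
      (f : (Fin n → ℝ) × (Fin (Module.finrank ℝ V) → ℂ) → Fin (Module.finrank ℝ V) → ℂ),
      IsOpen O ∧ (v, x) ∈ O ∧ ContDiffOn ℝ ∞ f O ∧ f (v, x) = y ∧
      ∀ v' x' m', (v', x') ∈ O → (T.vertexChart e).Rep x' m' →
        (T.vertexChart e').Rep (f (v', x')) ((QuotientAddGroup.mk (ℓ v') : V ⧸ T.Q) +ᵥ m') := by
  obtain ⟨hxd, rfl⟩ := (T.rep_iff e).mp hx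
  obtain ⟨hyd, hm⟩ := (T.rep_iff e').mp hy
  let A : (Fin n → ℝ) →L[ℝ] (ι → ℝ) :=
    LinearMap.toContinuousLinearMap ((T.vertexSlice e').sec ∘ₗ ℓ)
  have hA : ∀ v, T.piMap (A v) = ℓ v := fun v => (T.vertexSlice e').comp_sec (ℓ v)
  rw [T.mk_vadd_cls _ (hA v)] at hm
  obtain ⟨a, ha, hxy⟩ := (T.cls_eq_iff _ _).mp hm
  let g : (Fin n → ℝ) × (Fin (Module.finrank ℝ V) → ℂ) → ι → ℂ := fun p =>
    torusExp a • torusExp (A p.1) • T.vertexLift e p.2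
  replace hxy : g (v, x) = T.vertexLift e' y := hxy
  have hg : ContDiffOn ℝ ∞ g (Set.univ ×ˢ T.vertexDom e) := by
    refine (contDiff_quasitorus_lift (torusExp a)).comp_contDiffOn
      (f := fun p : (Fin n → ℝ) × (Fin (Module.finrank ℝ V) → ℂ) =>
        (A p.1, T.vertexLift e p.2)) (ContDiffOn.prodMk ?_ ?_)
    · exact (A.contDiff.comp contDiff_fst).contDiffOn
    · exact (T.contDiffOn_vertexLift e).comp contDiff_snd.contDiffOn fun p hp => hp.2
  refine ⟨(Set.univ ×ˢ T.vertexDom e) ∩ g ⁻¹' (T.vertexSlice e').slitSet,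
    fun p => T.chartCoord e' (g p), ?_, ⟨⟨Set.mem_univ _, hxd⟩, ?_⟩, ?_, ?_, ?_⟩
  · exact hg.continuousOn.isOpen_inter_preimage (isOpen_univ.prod (T.isOpen_vertexDom e))
      (T.vertexSlice e').isOpen_slitSet
  · rw [Set.mem_preimage, hxy]
    exact T.vertexLift_mem_slitSet e' hyd
  · exact (T.contDiffOn_chartCoord e').comp (hg.mono Set.inter_subset_left) fun p hp => hp.2
  · change T.chartCoord e' (g (v, x)) = y
    rw [hxy, chartCoord_vertexLift]
  · rintro v' x' m' ⟨-, hO⟩ ⟨hx', rfl⟩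
    have hl : g (v', x') ∈ T.levelSet :=
      T.levelSet.smul_mem _ (T.levelSet.smul_mem _ (T.vertexLift_mem e hx'))
    have h := T.rep_normalize e' hl fun j hj => Complex.slitPlane_ne_zero (hO j hj)
    have h2 : (QuotientAddGroup.mk (ℓ v') : V ⧸ T.Q) +ᵥ (T.vertexChart e).proj ⟨x', hx'⟩ =
        T.cls ⟨g (v', x'), hl⟩ :=
      (T.mk_vadd_cls _ (hA v') _).trans (T.cls_torusExp_smul ha _).symm
    rw [h2]
    exact h

/-- The fundamental vector fields are the rotations of the coordinates, and the components of `Φ`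
are, up to constants, linear combinations of the `|z_h|²`. -/
theorem exists_hamiltonian (ξ : V) :
    ∃ (H : (Fin (Module.finrank ℝ V) → ℂ) → ℝ)
      (Y : (Fin (Module.finrank ℝ V) → ℂ) → Fin (Module.finrank ℝ V) → ℂ),
      ContDiffOn ℝ ∞ H (T.vertexChart e).dom ∧ ContDiffOn ℝ ∞ Y (T.vertexChart e).dom ∧
      ∀ x m, (T.vertexChart e).Rep x m →
        H x = T.Φ m ξ ∧
        (∃ c : ℝ → Fin (Module.finrank ℝ V) → ℂ, c 0 = x ∧ ∀ᶠ t in 𝓝 (0 : ℝ),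
          HasDerivAt c (Y (c t)) t ∧
            (T.vertexChart e).Rep (c t) ((QuotientAddGroup.mk (t • ξ) : V ⧸ T.Q) +ᵥ m)) ∧
        ∀ u, (T.vertexChart e).form x ![Y x, u] = fderiv ℝ H x u := by
  set a : Fin (Module.finrank ℝ V) → ℝ := fun h => (T.vertexBasis e).repr ξ h
  refine ⟨fun x => ∑ h, a h * (‖x h‖ ^ 2 + T.lam (e.1 h)),
    fun x h => 2 * Real.pi * a h * Complex.I * x h, ?_, ?_, ?_⟩
  · refine (ContDiff.sum fun h _ => contDiff_const.mul (ContDiff.add ?_ contDiff_const)).contDiffOn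
    exact (contDiff_norm_sq ℝ).comp (contDiff_apply ℝ ℂ h)
  · refine (contDiff_pi.mpr fun h => ?_).contDiffOn
    fun_prop
  rintro x m hm
  obtain ⟨hx, rfl⟩ := (T.rep_iff e).mp hm
  have hξ : ξ = ∑ h, a h • T.normal (e.1 h) := by
    conv_lhs => rw [← (T.vertexBasis e).sum_repr ξ]
    exact Finset.sum_congr rfl fun h _ => by rw [vertexBasis_apply]
  refine ⟨?_, ?_, fun u => ?_⟩
  · conv_rhs => rw [hξ, map_sum]
    refine Finset.sum_congr rfl fun h _ => ?_
    rw [map_smul, Φ_cls_normal, smul_eq_mul]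
    change _ = a h * (‖T.vertexLift e x (e.1 h)‖ ^ 2 + _)
    rw [vertexLift_apply]
  · let b : ℝ → ι → ℝ := fun t => (T.vertexSlice e).sec (t • ξ)
    have hb : ∀ t h, b t (e.1 h) = t * a h := by
      classical
      intro t h
      have h1 : T.piMap (∑ i, (t * a i) • Pi.single (e.1 i) (1 : ℝ)) = t • ξ := by
        rw [map_sum, hξ, Finset.smul_sum]
        exact Finset.sum_congr rfl fun i _ => by rw [map_smul, piMap_single, mul_smul]
      have h2 := (T.vertexSlice e).sec_apply_eq (T.vertexSlice_injective e)
        (c := ∑ i, (t * a i) • Pi.single (e.1 i) (1 : ℝ)) fun j hj => by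
          rw [Finset.sum_apply]
          refine Finset.sum_eq_zero fun i _ => ?_
          have : j ≠ e.1 i := fun h' => hj ⟨i, h'.symm⟩
          simp [this]
      simp only [b]
      rw [← h1, h2, Finset.sum_apply, Finset.sum_eq_single h]
      · simp
      · intro i _ hi
        have : e.1 h ≠ e.1 i := fun h' => hi (e.1.injective h').symm
        simp [this]
      · simp
    have hb0 : ∀ t, ∀ j ∉ Set.range e.1, b t j = 0 := fun t j hj =>
      (T.vertexSlice e).sec_apply _ j hj
    refine ⟨fun t h => Complex.exp (2 * Real.pi * (t * a h : ℝ) * Complex.I) * x h, ?_,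
      Filter.Eventually.of_forall fun t => ⟨?_, ?_⟩⟩
    · ext h; simp
    · rw [hasDerivAt_pi]
      intro h
      have h1 : HasDerivAt (fun t : ℝ => (2 * Real.pi * (t * a h : ℝ) * Complex.I : ℂ))
          (2 * Real.pi * a h * Complex.I) t := by
        have h2 : HasDerivAt (fun t : ℝ => (t : ℂ)) 1 t := Complex.ofRealCLM.hasDerivAt
        have h3 := h2.mul_const (2 * Real.pi * a h * Complex.I : ℂ)
        rw [one_mul] at h3
        refine h3.congr_of_eventuallyEq (Filter.Eventually.of_forall fun s => ?_)
        push_cast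
        ring
      refine (h1.cexp.mul_const (x h)).congr_deriv ?_
      ring
    · have hmem : torusExp (b t) • T.vertexLift e x ∈ T.levelSet :=
        T.levelSet.smul_mem _ (T.vertexLift_mem e hx)
      have hoff : ∀ j ∉ Set.range e.1,
          (torusExp (b t) • T.vertexLift e x) j = T.vertexLift e x j := fun j hj => by
        rw [torus_smul_apply, (torusExp_apply_eq_one_iff _ _).mpr ⟨0, by simp [hb0 t j hj]⟩,
          Circle.coe_one, one_mul]
      obtain ⟨h1, h2⟩ := T.vertexLift_comp e hmem
        (fun j hj => by rw [norm_torus_smul, hoff j hj]; exact T.vertexLift_eq_norm e x hj)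
        fun j hj => by rw [hoff j hj]; exact T.vertexLift_ne_zero e hx hj
      have hc : (fun h => (torusExp (b t) • T.vertexLift e x) (e.1 h)) =
          fun h => Complex.exp (2 * Real.pi * (t * a h : ℝ) * Complex.I) * x h := by
        ext h
        rw [torus_smul_apply, coe_torusExp, vertexLift_apply, hb]
      rw [hc] at h1 h2
      refine (T.rep_iff e).mpr ⟨h1, ?_⟩
      rw [T.mk_vadd_cls _ ((T.vertexSlice e).comp_sec (t • ξ))]
      exact congrArg T.cls (Subtype.ext h2)
  · rw [T.vertexChart_form e hx]
    obtain ⟨D, hD, hDu⟩ := hasFDerivAt_sum_mul_norm_sq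
      (hasFDerivAt_id (𝕜 := ℝ) x) a fun h => T.lam (e.1 h)
    have h1 := stdSymplecticForm_rotate 1 a 0 x 0 u
    have h2 : stdSymplecticForm (Fin (Module.finrank ℝ V)) ![0, u] = 0 := by
      simp [stdSymplecticForm_apply]
    simp only [Pi.zero_apply, Complex.ofReal_zero, mul_zero, zero_mul, Finset.sum_const_zero,
      sub_zero, one_smul, zero_add, h2] at h1
    have h0 : (fun _ : Fin (Module.finrank ℝ V) => (0 : ℂ)) = 0 := rfl
    rw [h0, add_zero] at h1
    refine h1.trans (Eq.trans ?_ (congrArg (fun L => L u) hD.fderiv).symm)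
    rw [hDu]
    rfl

theorem isHamiltonianAction_atlas :
    T.atlas.IsHamiltonianAction (QuotientAddGroup.mk' T.Q) T.Φ where
  exp_surjective := QuotientAddGroup.mk'_surjective T.Q
  smooth ℓ i i' v x y m hx hy := T.exists_smooth_lift_vadd i i' ℓ.toLinearMap v x y m hx hy
  symplectic := by
    intro g i i' x y m hx hy
    obtain ⟨a, rfl⟩ := T.exists_lift g
    exact T.hasSymplecticLift_of_rep i i' (torusExp a) (fun z => T.vadd_cls a z) hx hy
  invariant := T.Φ_vadd
  moment i ξ := T.exists_hamiltonian i ξ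

end ToricTriple

/-! ### Transport of structure along a homeomorphism -/

namespace SymplecticChart

variable {E : Type*} [NormedAddCommGroup E] [NormedSpace ℝ E]
  {F : Type*} [NormedAddCommGroup F] [NormedSpace ℝ F] {M N M' N' : Type*}

/-- The chart of `M` that corresponds to a chart of `N` under a bijection `M ≃ N`. -/
def transport (c : SymplecticChart E N) (g : M ≃ N) : SymplecticChart E M where
  dom := c.dom
  Γ := c.Γ
  act := c.act
  proj x := g.symm (c.proj x)
  form := c.form

theorem rep_transport {c : SymplecticChart E N} {g : M ≃ N} {x : E} {m : M} :
    (c.transport g).Rep x m ↔ c.Rep x (g m) :=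
  exists_congr fun _ => g.symm_apply_eq

theorem overlap_transport (c c' : SymplecticChart E N) (g : M ≃ N) :
    (c.transport g).overlap (c'.transport g) = c.overlap c' := by
  ext x
  constructor
  · rintro ⟨m, hm, y, hy⟩
    exact ⟨g m, rep_transport.mp hm, y, rep_transport.mp hy⟩
  · rintro ⟨n, hn, y, hy⟩
    exact ⟨g.symm n, rep_transport.mpr (by simpa using hn), y,
      rep_transport.mpr (by simpa using hy)⟩

theorem IsModel.transport {c : SymplecticChart E N} {W : Set E} (h : c.IsModel W) (g : M ≃ N) :
    (c.transport g).IsModel W :=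
  ⟨h.isOpen, h.isConnected, h.countable, h.act_mem, h.one_act, h.mul_act, h.smooth_act,
    h.free_connected, h.free_dense⟩

theorem HasSymplecticLift.transport {c : SymplecticChart E N} {c' : SymplecticChart F N'}
    {f' : N → N'} {x : E} {y : F} (h : c.HasSymplecticLift c' f' x y) (g : M ≃ N) (g' : M' ≃ N')
    {f : M → M'} (hf : ∀ m, g' (f m) = f' (g m)) :
    (c.transport g).HasSymplecticLift (c'.transport g') f x y := by
  obtain ⟨φ, hx, hy, hs, h1, h2, hrep, hform⟩ := h
  refine ⟨φ, hx, hy, hs, h1, h2, fun x' hx' m hm => ?_, hform⟩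
  rw [rep_transport, hf]
  exact hrep x' hx' _ (rep_transport.mp hm)

theorem Compatible.transport {c c' : SymplecticChart E N} (h : c.Compatible c') (g : M ≃ N) :
    (c.transport g).Compatible (c'.transport g) := by
  intro hne
  rw [overlap_transport] at hne ⊢
  obtain ⟨h1, h2, h3⟩ := h hne
  refine ⟨h1.transport g, overlap_transport c' c g ▸ h2.transport g, fun x y m hx hy => ?_⟩
  exact (h3 x y _ (rep_transport.mp hx) (rep_transport.mp hy)).transport g g fun _ => rfl

theorem IsChart.transport [TopologicalSpace M] [TopologicalSpace N] {c : SymplecticChart E N}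
    (h : c.IsChart) (g : M ≃ₜ N) : (c.transport g.toEquiv).IsChart where
  isModel := h.isModel.transport _
  simplyConnected := h.simplyConnected
  continuous := g.symm.continuous.comp h.continuous
  isOpenMap := g.symm.isOpenMap.comp h.isOpenMap
  fibre x y := g.symm.injective.eq_iff.trans (h.fibre x y)
  form_smooth := h.form_smooth
  form_closed := h.form_closed
  form_nondegenerate := h.form_nondegenerate
  form_invariant := h.form_invariant

end SymplecticChart

namespace SymplecticAtlas

open SymplecticChart

variable {E : Type*} [NormedAddCommGroup E] [NormedSpace ℝ E] {M N : Type*}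

/-- The atlas of `M` that corresponds to an atlas of `N` under a bijection `M ≃ N`. -/
def transport (A : SymplecticAtlas E N) (g : M ≃ N) : SymplecticAtlas E M where
  Index := A.Index
  chart i := (A.chart i).transport g

theorem IsHamiltonianAction.transport {W G G' : Type*} [AddCommGroup W] [Module ℝ W]
    [AddCommGroup G] [AddAction G N] [AddCommGroup G'] [AddAction G' M] {A : SymplecticAtlas E N}
    {exp : W →+ G} {Φ : N → Module.Dual ℝ W} (h : A.IsHamiltonianAction exp Φ) (g : M ≃ N)
    {exp' : W →+ G'} (hexp' : Function.Surjective exp')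
    (hg : ∀ w m, g (exp' w +ᵥ m) = exp w +ᵥ g m) {Φ' : M → Module.Dual ℝ W}
    (hΦ : ∀ m, Φ (g m) = Φ' m) : (A.transport g).IsHamiltonianAction exp' Φ' where
  exp_surjective := hexp'
  smooth ℓ i i' v x y m hx hy := by
    obtain ⟨O, f, h1, h2, h3, h4, h5⟩ := h.smooth ℓ i i' v x y (g m) (rep_transport.mp hx)
      (by rw [← hg]; exact rep_transport.mp hy)
    refine ⟨O, f, h1, h2, h3, h4, fun v' x' m' hO hr => rep_transport.mpr ?_⟩
    rw [hg]
    exact h5 v' x' _ hO (rep_transport.mp hr)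
  symplectic δ i i' x y m hx hy := by
    obtain ⟨w, rfl⟩ := hexp' δ
    refine (h.symplectic (exp w) i i' x y (g m) (rep_transport.mp hx) ?_).transport g g
      fun m => hg w m
    simp only
    rw [← hg]
    exact rep_transport.mp hy
  invariant δ m := by
    obtain ⟨w, rfl⟩ := hexp' δ
    rw [← hΦ, ← hΦ, hg, h.invariant]
  moment i ξ := by
    obtain ⟨H, Y, hH, hY, hm⟩ := h.moment i ξ
    refine ⟨H, Y, hH, hY, fun x m hx => ?_⟩
    obtain ⟨h1, ⟨c, hc0, hc⟩, h3⟩ := hm x (g m) (rep_transport.mp hx)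
    refine ⟨by rw [h1, hΦ], ⟨c, hc0, hc.mono fun t ht => ⟨ht.1, rep_transport.mpr ?_⟩⟩, h3⟩
    rw [hg]
    exact ht.2

variable [TopologicalSpace M] [TopologicalSpace N]

theorem IsSymplecticQuasifold.transport {A : SymplecticAtlas E N} {dim : ℕ}
    (h : A.IsSymplecticQuasifold dim) (g : M ≃ₜ N) :
    (A.transport g.toEquiv).IsSymplecticQuasifold dim where
  finiteDimensional := h.finiteDimensional
  finrank_eq := h.finrank_eq
  isChart i := (h.isChart i).transport g
  cover m := by
    obtain ⟨i, x, hx⟩ := h.cover (g m)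
    exact ⟨i, x, rep_transport.mpr hx⟩
  compatible i i' := (h.compatible i i').transport _

/-- The local lifts of the identity of `N` are local lifts of the transporting homeomorphism. -/
theorem IsSymplecticQuasifold.isSymplectomorphism_transport {A : SymplecticAtlas E N} {dim : ℕ}
    (h : A.IsSymplecticQuasifold dim) (g : M ≃ₜ N) :
    (A.transport g.toEquiv).IsSymplectomorphism A g := by
  have hid : A.IsLocalSymplectomorphism A id := fun i i' x y m hx hy =>
    (h.compatible i i' ⟨x, m, hx, y, hy⟩).2.2 x y m hx hy
  constructor
  · intro i i' x y m hx hy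
    exact (hid i i' x y (g m) (rep_transport.mp hx) hy).transport g.toEquiv (Equiv.refl N)
      fun _ => rfl
  · intro i i' x y n hx hy
    have hy' : (A.chart i').Rep y n := by
      have := rep_transport.mp hy
      rwa [show g.toEquiv (g.symm n) = n from g.apply_symm_apply n] at this
    exact (hid i i' x y n hx hy').transport (Equiv.refl N) g.toEquiv fun n =>
      g.apply_symm_apply n

end SymplecticAtlas

/-! ### The reduced space as a quotient of a level set in `ℂ^d` -/

namespace ToricTriple

variable {V : Type*} [AddCommGroup V] [Module ℝ V] {ι : Type} (T : ToricTriple V ι)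
  (𝔨 : Submodule ℝ V)

/-- The preimage of `Φ_𝔨⁻¹(0)` in `ℂ^d`: the points over the linear forms that vanish on `𝔨`. -/
def redLevel : Set (ι → ℂ) :=
  {z | ∃ ν : Module.Dual ℝ (V ⧸ 𝔨), ∀ j, ‖z j‖ ^ 2 + T.lam j = ν (𝔨.mkQ (T.normal j))}

variable {T 𝔨}

theorem smul_mem_redLevel (t : ι → Circle) {z : ι → ℂ} (hz : z ∈ T.redLevel 𝔨) :
    t • z ∈ T.redLevel 𝔨 := by
  obtain ⟨ν, hν⟩ := hz
  exact ⟨ν, fun j => by rw [norm_torus_smul, hν]⟩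

theorem mem_map_Q_iff (v : V) :
    𝔨.mkQ v ∈ T.Q.map (𝔨.mkQ : V →+ V ⧸ 𝔨) ↔ ∃ u ∈ 𝔨, v - u ∈ T.Q := by
  constructor
  · rintro ⟨q, hq, h⟩
    refine ⟨v - q, ?_, by simpa using hq⟩
    rw [← Submodule.Quotient.mk_eq_zero, Submodule.Quotient.mk_sub, sub_eq_zero]
    exact h.symm
  · rintro ⟨u, hu, h⟩
    refine ⟨v - u, h, ?_⟩
    change 𝔨.mkQ (v - u) = 𝔨.mkQ v
    rw [map_sub, sub_eq_self]
    exact (Submodule.Quotient.mk_eq_zero 𝔨).mpr hu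

theorem ker_residualExp : (T.residualExp 𝔨).ker = T.Q.map (𝔨.mkQ : V →+ V ⧸ 𝔨) := by
  ext w
  obtain ⟨v, rfl⟩ := 𝔨.mkQ_surjective w
  rw [mem_map_Q_iff, AddMonoidHom.mem_ker]
  change (QuotientAddGroup.mk (QuotientAddGroup.mk v : V ⧸ T.Q) : (V ⧸ T.Q) ⧸ T.K 𝔨) = 0 ↔ _
  rw [QuotientAddGroup.eq_zero_iff]
  refine exists_congr fun u => and_congr_right fun _ => ?_
  change (QuotientAddGroup.mk u : V ⧸ T.Q) = QuotientAddGroup.mk v ↔ _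
  rw [eq_comm, ← sub_eq_zero, ← QuotientAddGroup.mk_sub, QuotientAddGroup.eq_zero_iff]

theorem residualExp_surjective : Function.Surjective (T.residualExp 𝔨) := by
  intro δ
  obtain ⟨δ, rfl⟩ := QuotientAddGroup.mk_surjective δ
  obtain ⟨v, rfl⟩ := QuotientAddGroup.mk_surjective δ
  exact ⟨𝔨.mkQ v, rfl⟩

variable [Fintype ι] (T 𝔨)

/-- The composition `ℝ^d → V → V / 𝔨`. -/
noncomputable def redMap : (ι → ℝ) →ₗ[ℝ] V ⧸ 𝔨 := 𝔨.mkQ ∘ₗ T.piMap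

variable {T 𝔨}

theorem mem_levelSet_of_mem_redLevel {z : ι → ℂ} (hz : z ∈ T.redLevel 𝔨) : z ∈ T.levelSet := by
  obtain ⟨ν, hν⟩ := hz
  exact (T.mem_levelSet_iff z).mpr ⟨𝔨.mkQ.dualMap ν, hν⟩

theorem cls_mem_zeroLevel {z : ι → ℂ} (hz : z ∈ T.redLevel 𝔨) :
    T.cls ⟨z, mem_levelSet_of_mem_redLevel hz⟩ ∈ T.zeroLevel 𝔨 := by
  obtain ⟨ν, hν⟩ := id hz
  change T.Φk 𝔨 _ = 0
  rw [Φk, T.Φ_cls_eq ⟨z, mem_levelSet_of_mem_redLevel hz⟩ (μ := 𝔨.mkQ.dualMap ν) hν]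
  refine LinearMap.ext fun v => ?_
  simp [(Submodule.Quotient.mk_eq_zero 𝔨).mpr v.2]

theorem mem_redLevel_of_cls_mem {z : T.levelSet} (hz : T.cls z ∈ T.zeroLevel 𝔨) :
    (z : ι → ℂ) ∈ T.redLevel 𝔨 :=
  ⟨𝔨.liftQ (T.Φ (T.cls z)) fun v hv => LinearMap.congr_fun hz ⟨v, hv⟩, fun j =>
    (T.Φ_cls_normal z j).symm⟩

theorem sum_mul_eq_zero_of_mem_redLevel {w : ι → ℂ} (hw : w ∈ T.redLevel 𝔨) {a : ι → ℝ}
    (ha : T.redMap 𝔨 a = 0) : ∑ j, a j * (‖w j‖ ^ 2 + T.lam j) = 0 := by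
  obtain ⟨ν, hν⟩ := hw
  have : ν (T.redMap 𝔨 a) = 0 := by rw [ha, map_zero]
  rw [← this, redMap, LinearMap.comp_apply, piMap_apply, map_sum, map_sum]
  exact Finset.sum_congr rfl fun j _ => by rw [hν, map_smul, map_smul, smul_eq_mul]

theorem redMap_single [DecidableEq ι] (j : ι) :
    T.redMap 𝔨 (Pi.single j 1) = 𝔨.mkQ (T.normal j) := by
  rw [redMap, LinearMap.comp_apply, piMap_single]

variable (T 𝔨)

/-- The class of a point of `ℂ^d` in the reduced space. -/
noncomputable def redCls (z : T.redLevel 𝔨) : T.ReducedSpace 𝔨 :=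
  T.reducedMk 𝔨 ⟨T.cls ⟨z, mem_levelSet_of_mem_redLevel z.2⟩, cls_mem_zeroLevel z.2⟩

variable {T 𝔨}

theorem redCls_surjective : Function.Surjective (T.redCls 𝔨) := by
  rintro ⟨⟨m, hm⟩⟩
  obtain ⟨z, rfl⟩ : ∃ z, T.cls z = m := Quotient.exists_rep m
  exact ⟨⟨z, mem_redLevel_of_cls_mem hm⟩, rfl⟩

theorem vadd_redCls (a : ι → ℝ) (z : T.redLevel 𝔨) :
    T.residualExp 𝔨 (T.redMap 𝔨 a) +ᵥ T.redCls 𝔨 z =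
      T.redCls 𝔨 ⟨torusExp a • (z : ι → ℂ), smul_mem_redLevel _ z.2⟩ := by
  refine congrArg (T.reducedMk 𝔨) (Subtype.ext ?_)
  exact T.vadd_cls a ⟨z, mem_levelSet_of_mem_redLevel z.2⟩

/-- `M_𝔨` is the quotient of the preimage of `Φ_𝔨⁻¹(0)` by `{exp a | p (π a) ∈ p(Q)}`. -/
theorem redCls_eq_iff (z z' : T.redLevel 𝔨) : T.redCls 𝔨 z = T.redCls 𝔨 z' ↔
    ∃ a : ι → ℝ, T.redMap 𝔨 a ∈ T.Q.map (𝔨.mkQ : V →+ V ⧸ 𝔨) ∧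
      torusExp a • (z' : ι → ℂ) = z := by
  constructor
  · intro h
    obtain ⟨⟨_, v, hv, rfl⟩, hκ⟩ := Quotient.exact h
    obtain ⟨a, rfl⟩ := T.piMap_surjective v
    have h1 : T.cls (torusExp a • ⟨z', mem_levelSet_of_mem_redLevel z'.2⟩) =
        T.cls ⟨z, mem_levelSet_of_mem_redLevel z.2⟩ :=
      (T.vadd_cls a _).symm.trans (congrArg Subtype.val hκ)
    obtain ⟨b, hb, h2⟩ := (T.cls_eq_iff _ _).mp h1.symm
    refine ⟨b + a, ?_, ?_⟩
    · rw [redMap, LinearMap.comp_apply, mem_map_Q_iff]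
      exact ⟨T.piMap a, hv, by rwa [map_add, add_sub_cancel_right]⟩
    · rw [torusExp_add, mul_smul]
      exact h2
  · rintro ⟨a, ha, h⟩
    rw [← ker_residualExp, AddMonoidHom.mem_ker] at ha
    have h1 := vadd_redCls a z'
    rw [ha, zero_vadd] at h1
    rw [h1]
    exact congrArg _ (Subtype.ext h.symm)

theorem redCls_smul {a : ι → ℝ} (ha : T.redMap 𝔨 a ∈ T.Q.map (𝔨.mkQ : V →+ V ⧸ 𝔨))
    (z : T.redLevel 𝔨) :
    T.redCls 𝔨 ⟨torusExp a • (z : ι → ℂ), smul_mem_redLevel _ z.2⟩ = T.redCls 𝔨 z :=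
  (redCls_eq_iff _ _).mpr ⟨a, ha, rfl⟩

theorem redCls_normalize {σ : Slice (T.redMap 𝔨)} {w : ι → ℂ} (hw : w ∈ T.redLevel 𝔨) :
    T.redCls 𝔨 ⟨σ.normalize w, smul_mem_redLevel _ hw⟩ = T.redCls 𝔨 ⟨w, hw⟩ :=
  redCls_smul (a := σ.rot w) (by rw [σ.P_rot]; exact zero_mem _) ⟨w, hw⟩

theorem continuous_redCls : Continuous (T.redCls 𝔨) := by
  have h : Continuous fun z : T.redLevel 𝔨 =>
      (⟨z, mem_levelSet_of_mem_redLevel z.2⟩ : T.levelSet) :=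
    Continuous.subtype_mk continuous_subtype_val _
  exact continuous_quotient_mk'.comp (Continuous.subtype_mk (T.continuous_cls.comp h) _)

theorem isOpenMap_cls : IsOpenMap T.cls := by
  have : ContinuousConstSMul T.N T.levelSet := ⟨fun t => Continuous.subtype_mk
    ((Slice.contDiff_torus_smul (t : ι → Circle)).continuous.comp continuous_subtype_val) _⟩
  exact isOpenMap_quotient_mk'_mul

theorem continuous_of_comp_redCls {X : Type*} [TopologicalSpace X] {f : T.ReducedSpace 𝔨 → X}
    (hf : Continuous (f ∘ T.redCls 𝔨)) : Continuous f := by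
  have hcls : Function.Surjective T.cls := Quotient.exists_rep
  have hq : Topology.IsQuotientMap
      ((T.zeroLevel 𝔨 : Set T.Space).restrictPreimage T.cls) :=
    (isOpenMap_cls.restrictPreimage _).isQuotientMap (T.continuous_cls.restrictPreimage)
      (Set.restrictPreimage_surjective _ hcls)
  refine (isQuotientMap_quotient_mk'.continuous_iff).mpr (hq.continuous_iff.mpr ?_)
  have h : Continuous fun z : T.cls ⁻¹' (T.zeroLevel 𝔨 : Set T.Space) =>
      (⟨z.1, mem_redLevel_of_cls_mem z.2⟩ : T.redLevel 𝔨) :=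
    Continuous.subtype_mk (continuous_subtype_val.comp continuous_subtype_val) _
  exact hf.comp h

theorem reducedMoment_redCls (z : T.redLevel 𝔨) {ν : Module.Dual ℝ (V ⧸ 𝔨)}
    (hν : ∀ j, ‖(z : ι → ℂ) j‖ ^ 2 + T.lam j = ν (𝔨.mkQ (T.normal j))) :
    T.reducedMoment 𝔨 (T.redCls 𝔨 z) = ν := by
  refine LinearMap.ext fun w => ?_
  obtain ⟨v, rfl⟩ := 𝔨.mkQ_surjective w
  change T.Φ (T.cls ⟨z, mem_levelSet_of_mem_redLevel z.2⟩) v = _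
  rw [T.Φ_cls_eq ⟨z, mem_levelSet_of_mem_redLevel z.2⟩ (μ := 𝔨.mkQ.dualMap ν) hν]
  rfl

end ToricTriple

namespace ToricTriple

/-! ### The toric space of the reduced polyhedron as a slice -/

section ExtZero

variable {ι : Type} {J : Finset ι}

/-- Extension by zero `ℝ^J → ℝ^ι`. -/
noncomputable def extZero (J : Finset ι) : (J → ℝ) →ₗ[ℝ] (ι → ℝ) :=
  Function.ExtendByZero.linearMap ℝ (Subtype.val : J → ι)

theorem extZero_apply (a : J → ℝ) (j : J) : extZero J a j = a j :=
  Subtype.val_injective.extend_apply a (0 : ι → ℝ) j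

theorem extZero_of_notMem (a : J → ℝ) {j : ι} (hj : j ∉ J) : extZero J a j = 0 :=
  Function.extend_apply' a (0 : ι → ℝ) j fun ⟨i, hi⟩ => hj (hi ▸ i.2)

end ExtZero

variable {V : Type*} [AddCommGroup V] [Module ℝ V] {ι : Type}
  (T : ToricTriple V ι) {𝔨 : Submodule ℝ V} {J : Finset ι} (T' : ToricTriple (V ⧸ 𝔨) J)

/-- A linear section of `π' : ℝ^J → V / 𝔨`. -/
noncomputable def cutSec : (V ⧸ 𝔨) →ₗ[ℝ] (J → ℝ) :=
  (T'.piMap.exists_rightInverse_of_surjective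
    (LinearMap.range_eq_top.mpr T'.piMap_surjective)).choose

theorem piMap_cutSec (w : V ⧸ 𝔨) : T'.piMap (cutSec T' w) = w :=
  LinearMap.congr_fun (T'.piMap.exists_rightInverse_of_surjective
    (LinearMap.range_eq_top.mpr T'.piMap_surjective)).choose_spec w

/-- The number `⟨ν, p(X_j)⟩ - λ_j`, where `ν ∈ Δ_𝔨` is the value of the moment mapping at the point
`z` of the level set of `T'`. -/
noncomputable def cutSq (z : J → ℂ) (j : ι) : ℝ :=
  ∑ i, (‖z i‖ ^ 2 + T'.lam i) * cutSec T' (𝔨.mkQ (T.normal j)) i - T.lam j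

open Classical in
/-- The extension of a point of the level set of `T'` to a point of `ℂ^d`, by square roots. -/
noncomputable def cutExt (z : J → ℂ) (j : ι) : ℂ :=
  if h : j ∈ J then z ⟨j, h⟩ else (Real.sqrt (cutSq T T' z j) : ℂ)

theorem cutExt_apply (z : J → ℂ) (j : J) : cutExt T T' z j = z j := by
  rw [cutExt, dif_pos j.2]

theorem cutExt_of_notMem (z : J → ℂ) {j : ι} (hj : j ∉ J) :
    cutExt T T' z j = (Real.sqrt (cutSq T T' z j) : ℂ) := by
  rw [cutExt, dif_neg hj]

theorem cutExt_eq_norm (z : J → ℂ) {j : ι} (hj : j ∉ J) :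
    cutExt T T' z j = ‖cutExt T T' z j‖ := by
  rw [cutExt_of_notMem T T' z hj, Complex.norm_real, Real.norm_eq_abs,
    abs_of_nonneg (Real.sqrt_nonneg _)]

theorem cutSq_eq {z : J → ℂ} {ν : Module.Dual ℝ (V ⧸ 𝔨)}
    (hν : ∀ j, ‖z j‖ ^ 2 + T'.lam j = ν (T'.normal j)) (j : ι) :
    cutSq T T' z j = ν (𝔨.mkQ (T.normal j)) - T.lam j := by
  conv_rhs => rw [← piMap_cutSec T' (𝔨.mkQ (T.normal j)), piMap_apply, map_sum]
  rw [cutSq]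
  congr 1
  exact Finset.sum_congr rfl fun i _ => by rw [hν, map_smul, smul_eq_mul, mul_comm]

theorem contDiff_cutSq (j : ι) : ContDiff ℝ ∞ fun z => cutSq T T' z j := by
  unfold cutSq
  refine (ContDiff.sum fun i _ => (ContDiff.add ?_ contDiff_const).mul contDiff_const).sub
    contDiff_const
  exact (contDiff_norm_sq ℝ).comp (contDiff_apply ℝ ℂ i)

theorem contDiffOn_cutExt [Fintype ι] :
    ContDiffOn ℝ ∞ (cutExt T T') {z | ∀ j ∉ J, 0 < cutSq T T' z j} := by
  rw [contDiffOn_pi]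
  intro j
  by_cases hj : j ∈ J
  · have : (fun z => cutExt T T' z j) = fun z => z ⟨j, hj⟩ := by
      ext z; exact cutExt_apply T T' z ⟨j, hj⟩
    rw [this]
    exact (contDiff_apply ℝ ℂ _).contDiffOn
  · simp only [cutExt_of_notMem T T' _ hj]
    intro z hz
    exact (Complex.ofRealCLM.contDiff.contDiffAt.comp z
      ((contDiff_cutSq T T' j).contDiffAt.sqrt (hz j hj).ne')).contDiffWithinAt

theorem continuous_cutExt : Continuous (cutExt T T') := by
  refine continuous_pi fun j => ?_
  by_cases hj : j ∈ J
  · have : (fun z => cutExt T T' z j) = fun z => z ⟨j, hj⟩ := by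
      ext z; exact cutExt_apply T T' z ⟨j, hj⟩
    rw [this]
    exact continuous_apply _
  · simp only [cutExt_of_notMem T T' _ hj]
    exact Complex.continuous_ofReal.comp (contDiff_cutSq T T' j).continuous.sqrt

theorem cutExt_torusExp_smul (a : J → ℝ) (z : J → ℂ) :
    cutExt T T' (torusExp a • z) = torusExp (extZero J a) • cutExt T T' z := by
  ext j
  rw [torus_smul_apply]
  by_cases hj : j ∈ J
  · rw [show j = ((⟨j, hj⟩ : J) : ι) from rfl, cutExt_apply, cutExt_apply, torus_smul_apply,
      torusExp, torusExp, extZero_apply]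
  · rw [cutExt_of_notMem T T' _ hj, cutExt_of_notMem T T' _ hj,
      (torusExp_apply_eq_one_iff _ j).mpr ⟨0, by simp [extZero_of_notMem a hj]⟩]
    simp only [cutSq, norm_torus_smul, Circle.coe_one, one_mul]

variable {T T'}

namespace IsCut

theorem cutSq_pos (hc : T.IsCut 𝔨 J T') {z : J → ℂ} (hz : z ∈ T'.levelSet) {j : ι} (hj : j ∉ J) :
    0 < cutSq T T' z j := by
  obtain ⟨ν, hν⟩ := (T'.mem_levelSet_iff z).mp hz
  rw [cutSq_eq T T' hν]
  refine sub_pos.mpr (hc.lam_lt ν (fun i _ => ?_) j hj)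
  rw [← hν]
  linarith [sq_nonneg ‖z i‖]

theorem norm_cutExt (hc : T.IsCut 𝔨 J T') {z : J → ℂ} {ν : Module.Dual ℝ (V ⧸ 𝔨)}
    (hν : ∀ j, ‖z j‖ ^ 2 + T'.lam j = ν (T'.normal j)) (j : ι) :
    ‖cutExt T T' z j‖ ^ 2 + T.lam j = ν (𝔨.mkQ (T.normal j)) := by
  by_cases hj : j ∈ J
  · rw [show j = ((⟨j, hj⟩ : J) : ι) from rfl, cutExt_apply, ← hc.lam_eq, hν, hc.normal_eq]
  · have h := hc.cutSq_pos ((T'.mem_levelSet_iff z).mpr ⟨ν, hν⟩) hj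
    rw [cutExt_of_notMem T T' _ hj, Complex.norm_real, Real.norm_eq_abs, sq_abs,
      Real.sq_sqrt h.le, cutSq_eq T T' hν, sub_add_cancel]

theorem cutExt_mem (hc : T.IsCut 𝔨 J T') {z : J → ℂ} (hz : z ∈ T'.levelSet) :
    cutExt T T' z ∈ T.redLevel 𝔨 := by
  obtain ⟨ν, hν⟩ := (T'.mem_levelSet_iff z).mp hz
  exact ⟨ν, hc.norm_cutExt hν⟩

theorem restrict_mem (hc : T.IsCut 𝔨 J T') {w : ι → ℂ} (hw : w ∈ T.redLevel 𝔨) :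
    (fun j : J => w j) ∈ T'.levelSet := by
  obtain ⟨ν, hν⟩ := hw
  exact (T'.mem_levelSet_iff _).mpr ⟨ν, fun j => by rw [hc.lam_eq, hν, hc.normal_eq]⟩

/-- The points of the level set lie over `Δ_𝔨`, where the constraints outside of `J` are strict. -/
theorem ne_zero_of_notMem (hc : T.IsCut 𝔨 J T') {w : ι → ℂ} (hw : w ∈ T.redLevel 𝔨)
    {j : ι} (hj : j ∉ J) : w j ≠ 0 := by
  obtain ⟨ν, hν⟩ := hw
  intro h0
  have h1 := hν j
  rw [h0] at h1
  have h2 : ν ∈ T'.polyhedron := fun i _ => by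
    rw [hc.lam_eq, hc.normal_eq, ← hν]
    linarith [sq_nonneg ‖w i‖]
  have h3 := hc.lam_lt ν h2 j hj
  rw [← h1] at h3
  simp at h3

/-- A point of the level set with non-negative coordinates outside of `J` is determined by those
in `J`. -/
theorem cutExt_restrict (hc : T.IsCut 𝔨 J T') {w : ι → ℂ} (hw : w ∈ T.redLevel 𝔨)
    (hreal : ∀ j ∉ J, w j = ‖w j‖) : cutExt T T' (fun j => w j) = w := by
  obtain ⟨ν, hν⟩ := id hw
  ext j
  by_cases hj : j ∈ J
  · exact cutExt_apply T T' _ ⟨j, hj⟩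
  · rw [cutExt_of_notMem T T' _ hj, cutSq_eq T T' (ν := ν) fun j => by
      rw [hc.lam_eq, hν, hc.normal_eq], ← hν j, add_sub_cancel_right,
      Real.sqrt_sq (norm_nonneg _), ← hreal j hj]

/-- The identification of `D / K` with `(V / 𝔨) / p(Q)`. -/
noncomputable def residualEquiv (hc : T.IsCut 𝔨 J T') :
    ((V ⧸ T.Q) ⧸ T.K 𝔨) ≃+ (V ⧸ 𝔨) ⧸ T'.Q :=
  (QuotientAddGroup.quotientKerEquivOfSurjective (T.residualExp 𝔨)
    residualExp_surjective).symm.trans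
    (QuotientAddGroup.quotientAddEquivOfEq (ker_residualExp.trans hc.Q_eq.symm))

theorem residualEquiv_residualExp (hc : T.IsCut 𝔨 J T') (w : V ⧸ 𝔨) :
    hc.residualEquiv (T.residualExp 𝔨 w) = QuotientAddGroup.mk' T'.Q w := by
  have h : (QuotientAddGroup.quotientKerEquivOfSurjective (T.residualExp 𝔨)
      residualExp_surjective).symm (T.residualExp 𝔨 w) = QuotientAddGroup.mk w :=
    (AddEquiv.symm_apply_eq _).mpr rfl
  rw [residualEquiv, AddEquiv.trans_apply, h]
  rfl

variable [Fintype ι]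

theorem redMap_extZero (hc : T.IsCut 𝔨 J T') (a : J → ℝ) :
    T.redMap 𝔨 (extZero J a) = T'.piMap a := by
  rw [redMap, LinearMap.comp_apply, piMap_apply, piMap_apply, map_sum]
  symm
  refine Fintype.sum_of_injective _ Subtype.val_injective _ _ (fun j hj => ?_) fun j => ?_
  · rw [extZero_of_notMem a fun h => hj ⟨⟨j, h⟩, rfl⟩, zero_smul, map_zero]
  · rw [extZero_apply, hc.normal_eq, map_smul]

/-- Elements of `{exp a | p (π a) ∈ p(Q)}` that are trivial outside of `J` restrict to the group
`N` of the reduced triple. -/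
theorem piMap_restrict_mem (hc : T.IsCut 𝔨 J T') {a : ι → ℝ} (ha : T.redMap 𝔨 a ∈ T'.Q)
    (hint : ∀ j ∉ J, ∃ m : ℤ, a j = m) : T'.piMap (fun j => a j) ∈ T'.Q := by
  have h1 : T.redMap 𝔨 (a - extZero J fun j => a j) ∈ T'.Q := by
    rw [hc.Q_eq]
    refine ⟨_, T.piMap_mem_Q (a := a - extZero J fun j => a j) fun j => ?_, rfl⟩
    by_cases hj : j ∈ J
    · exact ⟨0, by simpa [sub_eq_zero] using (extZero_apply (fun j : J => a j) ⟨j, hj⟩).symm⟩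
    · obtain ⟨m, hm⟩ := hint j hj
      exact ⟨m, by simp [extZero_of_notMem _ hj, hm]⟩
  have h2 := sub_mem ha h1
  rwa [map_sub, sub_sub_cancel, hc.redMap_extZero] at h2

/-- The slice `{z_j > 0 for j ∉ J}` of the level set. -/
noncomputable def slice (hc : T.IsCut 𝔨 J T') : Slice (T.redMap 𝔨) where
  support := J
  sec := extZero J ∘ₗ cutSec T'
  comp_sec w := by
    rw [LinearMap.comp_apply, hc.redMap_extZero, piMap_cutSec]
  sec_apply w _ hj := extZero_of_notMem _ hj

/-- The class in the reduced space of a point of the level set of `T'`. -/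
noncomputable def extCls (hc : T.IsCut 𝔨 J T') (z : T'.levelSet) : T.ReducedSpace 𝔨 :=
  T.redCls 𝔨 ⟨cutExt T T' z, hc.cutExt_mem z.2⟩

/-- The map `X_𝔨 → M_𝔨` induced by the extension of points to `ℂ^d`. -/
noncomputable def fromSpace (hc : T.IsCut 𝔨 J T') : T'.Space → T.ReducedSpace 𝔨 :=
  Quotient.lift hc.extCls fun z z' h => by
    obtain ⟨a, ha, hz⟩ := (T'.cls_eq_iff z z').mp (Quotient.sound h)
    refine (redCls_eq_iff _ _).mpr ⟨extZero J a, ?_, ?_⟩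
    · rw [hc.redMap_extZero, ← hc.Q_eq]
      exact ha
    · rw [← cutExt_torusExp_smul, hz]

theorem fromSpace_restrict (hc : T.IsCut 𝔨 J T') {w : ι → ℂ} (hw : w ∈ T.redLevel 𝔨)
    (hreal : ∀ j ∉ J, w j = ‖w j‖) :
    hc.fromSpace (T'.cls ⟨_, hc.restrict_mem hw⟩) = T.redCls 𝔨 ⟨w, hw⟩ :=
  congrArg (T.redCls 𝔨) (Subtype.ext (hc.cutExt_restrict hw hreal))

/-- Every class of the reduced space has representatives in the slice. -/
theorem fromSpace_normalize (hc : T.IsCut 𝔨 J T') {w : ι → ℂ} (hw : w ∈ T.redLevel 𝔨) :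
    hc.fromSpace (T'.cls ⟨_, hc.restrict_mem (smul_mem_redLevel (torusExp (hc.slice.rot w)) hw)⟩) =
      T.redCls 𝔨 ⟨w, hw⟩ :=
  (hc.fromSpace_restrict (smul_mem_redLevel (torusExp (hc.slice.rot w)) hw) fun j hj => by
    rw [norm_torus_smul]
    exact hc.slice.normalize_apply w hj).trans (redCls_normalize hw)

theorem fromSpace_bijective (hc : T.IsCut 𝔨 J T') : Function.Bijective hc.fromSpace := by
  constructor
  · rintro m m' h
    obtain ⟨z, rfl⟩ : ∃ z, T'.cls z = m := Quotient.exists_rep m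
    obtain ⟨z', rfl⟩ : ∃ z, T'.cls z = m' := Quotient.exists_rep m'
    obtain ⟨a, ha, hz⟩ := (redCls_eq_iff _ _).mp h
    refine (T'.cls_eq_iff _ _).mpr ⟨fun j => a j, hc.piMap_restrict_mem (hc.Q_eq ▸ ha) ?_, ?_⟩
    · intro j hj
      rw [← torusExp_apply_eq_one_iff]
      exact torus_apply_eq_one_of_smul hz (cutExt_eq_norm T T' _ hj) (cutExt_eq_norm T T' _ hj)
        (hc.ne_zero_of_notMem (hc.cutExt_mem z'.2) hj)
    · ext j
      have h1 : (torusExp a • cutExt T T' z') j = cutExt T T' z j := congrFun hz j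
      rw [torus_smul_apply, cutExt_apply, cutExt_apply] at h1
      rw [torus_smul_apply]
      exact h1
  · intro m
    obtain ⟨⟨w, hw⟩, rfl⟩ := redCls_surjective m
    exact ⟨_, hc.fromSpace_normalize hw⟩

theorem continuous_fromSpace (hc : T.IsCut 𝔨 J T') : Continuous hc.fromSpace := by
  refine isQuotientMap_quotient_mk'.continuous_iff.mpr (continuous_redCls.comp ?_)
  exact Continuous.subtype_mk ((continuous_cutExt T T').comp continuous_subtype_val) _

/-- The inverse map is continuous: near a point it is given by a rotation that makes the
coordinates outside of `J` of that point positive, followed by the normalization. -/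
theorem continuous_fromSpace_symm (hc : T.IsCut 𝔨 J T') :
    Continuous (Equiv.ofBijective _ hc.fromSpace_bijective).symm := by
  refine continuous_of_comp_redCls (continuous_iff_continuousAt.mpr fun z => ?_)
  set a := hc.slice.rot (z : ι → ℂ)
  have ha : T.redMap 𝔨 a = 0 := hc.slice.P_rot _
  have hmem : ∀ w : T.redLevel 𝔨, torusExp a • (w : ι → ℂ) ∈ T.redLevel 𝔨 := fun w =>
    smul_mem_redLevel _ w.2
  let f : T.redLevel 𝔨 → T'.levelSet := fun w =>
    ⟨fun j => hc.slice.normalize (torusExp a • (w : ι → ℂ)) j,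
      hc.restrict_mem (smul_mem_redLevel _ (hmem w))⟩
  have heq : (Equiv.ofBijective _ hc.fromSpace_bijective).symm ∘ T.redCls 𝔨 =
      fun w => T'.cls (f w) := by
    ext1 w
    refine (Equiv.symm_apply_eq _).mpr ?_
    refine Eq.trans ?_ (hc.fromSpace_normalize (hmem w)).symm
    exact (redCls_smul (by rw [ha]; exact zero_mem _) w).symm
  rw [heq]
  refine T'.continuous_cls.continuousAt.comp
    (Topology.IsInducing.subtypeVal.continuousAt_iff.mpr (continuousAt_pi.mpr fun j => ?_))
  have hslit : torusExp a • (z : ι → ℂ) ∈ hc.slice.slitSet := by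
    refine hc.slice.mem_slitSet (fun j hj => ?_) fun j hj =>
      hc.ne_zero_of_notMem (hmem z) hj
    rw [norm_torus_smul]
    exact hc.slice.normalize_apply (z : ι → ℂ) hj
  have h1 : ContinuousAt hc.slice.normalize (torusExp a • (z : ι → ℂ)) :=
    hc.slice.contDiffOn_normalize.continuousOn.continuousAt
      (hc.slice.isOpen_slitSet.mem_nhds hslit)
  have h2 : Continuous fun w : T.redLevel 𝔨 => torusExp a • (w : ι → ℂ) :=
    (Slice.contDiff_torus_smul _).continuous.comp continuous_subtype_val
  exact (continuous_apply (j : ι)).continuousAt.comp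
    (ContinuousAt.comp (f := fun w : T.redLevel 𝔨 => torusExp a • (w : ι → ℂ)) h1
      h2.continuousAt)

/-- The homeomorphism `M_𝔨 → X_𝔨`. -/
noncomputable def homeomorph (hc : T.IsCut 𝔨 J T') : T.ReducedSpace 𝔨 ≃ₜ T'.Space where
  toEquiv := (Equiv.ofBijective _ hc.fromSpace_bijective).symm
  continuous_toFun := hc.continuous_fromSpace_symm
  continuous_invFun := hc.continuous_fromSpace

theorem homeomorph_symm_cls (hc : T.IsCut 𝔨 J T') (z : T'.levelSet) :
    hc.homeomorph.symm (T'.cls z) = T.redCls 𝔨 ⟨cutExt T T' z, hc.cutExt_mem z.2⟩ := rfl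

theorem Φ_homeomorph (hc : T.IsCut 𝔨 J T') (m : T.ReducedSpace 𝔨) :
    T'.Φ (hc.homeomorph m) = T.reducedMoment 𝔨 m := by
  obtain ⟨n, rfl⟩ := hc.homeomorph.symm.surjective m
  obtain ⟨z, rfl⟩ : ∃ z, T'.cls z = n := Quotient.exists_rep n
  rw [hc.homeomorph.apply_symm_apply, homeomorph_symm_cls]
  refine (reducedMoment_redCls _ ?_).symm
  exact hc.norm_cutExt fun j => (T'.Φ_cls_normal z j).symm

theorem homeomorph_vadd (hc : T.IsCut 𝔨 J T') (w : V ⧸ 𝔨) (m : T.ReducedSpace 𝔨) :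
    hc.homeomorph (T.residualExp 𝔨 w +ᵥ m) =
      (QuotientAddGroup.mk' T'.Q w : (V ⧸ 𝔨) ⧸ T'.Q) +ᵥ hc.homeomorph m := by
  obtain ⟨n, rfl⟩ := hc.homeomorph.symm.surjective m
  obtain ⟨z, rfl⟩ : ∃ z, T'.cls z = n := Quotient.exists_rep n
  obtain ⟨a, rfl⟩ := T'.piMap_surjective w
  rw [hc.homeomorph.apply_symm_apply, ← hc.homeomorph.apply_symm_apply (_ +ᵥ T'.cls z)]
  congr 1
  have h1 : (QuotientAddGroup.mk' T'.Q (T'.piMap a) : (V ⧸ 𝔨) ⧸ T'.Q) +ᵥ T'.cls z =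
      T'.cls (torusExp a • z) := T'.vadd_cls a z
  rw [h1, homeomorph_symm_cls, homeomorph_symm_cls, ← hc.redMap_extZero, vadd_redCls]
  exact congrArg (T.redCls 𝔨) (Subtype.ext (cutExt_torusExp_smul T T' a z).symm)

end IsCut

end ToricTriple

namespace ToricTriple

namespace IsCut

variable {V : Type*} [AddCommGroup V] [Module ℝ V] {ι : Type}
  {T : ToricTriple V ι} {𝔨 : Submodule ℝ V} {J : Finset ι} {T' : ToricTriple (V ⧸ 𝔨) J}

/-! ### The reduced symplectic structure -/

/-- The lift `Ũ_ν → ℂ^d` of a chart of `X_𝔨`. -/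
noncomputable def chartExt (_hc : T.IsCut 𝔨 J T') (e' : T'.VertexIndex)
    (y : Fin (Module.finrank ℝ (V ⧸ 𝔨)) → ℂ) : ι → ℂ :=
  cutExt T T' (T'.vertexLift e' y)

theorem chartExt_mem (hc : T.IsCut 𝔨 J T') (e' : T'.VertexIndex)
    {y : Fin (Module.finrank ℝ (V ⧸ 𝔨)) → ℂ} (hy : y ∈ T'.vertexDom e') :
    hc.chartExt e' y ∈ T.redLevel 𝔨 :=
  hc.cutExt_mem (T'.vertexLift_mem e' hy)

/-- The indices in `ι` of the normals at a vertex of `Δ_𝔨`. -/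
def vertexEmb (_hc : T.IsCut 𝔨 J T') (e' : T'.VertexIndex) :
    Fin (Module.finrank ℝ (V ⧸ 𝔨)) ↪ ι :=
  e'.1.trans (Function.Embedding.subtype _)

theorem chartExt_vertexEmb (hc : T.IsCut 𝔨 J T') (e' : T'.VertexIndex)
    (y : Fin (Module.finrank ℝ (V ⧸ 𝔨)) → ℂ) (h : Fin (Module.finrank ℝ (V ⧸ 𝔨))) :
    hc.chartExt e' y (hc.vertexEmb e' h) = y h :=
  (cutExt_apply T T' _ (e'.1 h)).trans (T'.vertexLift_apply e' y h)

variable [Fintype ι]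

theorem contDiffOn_chartExt (hc : T.IsCut 𝔨 J T') (e' : T'.VertexIndex) :
    ContDiffOn ℝ ∞ (hc.chartExt e') (T'.vertexDom e') :=
  (contDiffOn_cutExt T T').comp (T'.contDiffOn_vertexLift e') fun _ hy _ hj =>
    hc.cutSq_pos (T'.vertexLift_mem e' hy) hj

/-- As the coordinates outside of `J` are real, the form of a chart of `X_𝔨` is the pull-back of the
standard form of `ℂ^d`. -/
theorem stdSymplecticForm_chartExt (hc : T.IsCut 𝔨 J T') (e' : T'.VertexIndex)
    {y : Fin (Module.finrank ℝ (V ⧸ 𝔨)) → ℂ} (hy : y ∈ T'.vertexDom e') :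
    ∃ D : (Fin (Module.finrank ℝ (V ⧸ 𝔨)) → ℂ) →L[ℝ] (ι → ℂ),
      HasFDerivAt (hc.chartExt e') D y ∧
      ∀ u v, stdSymplecticForm ι ![D u, D v] = (T'.vertexChart e').form y ![u, v] := by
  have hd : HasFDerivAt (hc.chartExt e') (fderiv ℝ (hc.chartExt e') y) y :=
    (((hc.contDiffOn_chartExt e').contDiffAt
      ((T'.isOpen_vertexDom e').mem_nhds hy)).differentiableAt (by simp)).hasFDerivAt
  refine ⟨_, hd, fun u v => ?_⟩
  have him : ∀ u, ∀ j ∉ Set.range (Function.Embedding.subtype (· ∈ J)),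
      (fderiv ℝ (hc.chartExt e') y u j).im = 0 := fun u j hj =>
    im_fderiv_apply_eq_zero hd (Filter.Eventually.of_forall fun z => by
      rw [chartExt, cutExt_eq_norm T T' _ fun h => hj ⟨⟨j, h⟩, rfl⟩, Complex.ofReal_im]) u
  have hcoord : ∀ u, (fun j : J => fderiv ℝ (hc.chartExt e') y u j) =
      fderiv ℝ (T'.vertexLift e') y u := fun u => by
    ext j
    have h1 := (hasFDerivAt_pi'.mp hd) (j : ι)
    simp only [chartExt, cutExt_apply] at h1
    exact congrArg (fun L : (Fin (Module.finrank ℝ (V ⧸ 𝔨)) → ℂ) →L[ℝ] ℂ => L u)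
      (h1.unique ((hasFDerivAt_pi'.mp (T'.hasFDerivAt_vertexLift e' hy)) j))
  have h := stdSymplecticForm_comp (Function.Embedding.subtype (· ∈ J)) (him u) (him v)
  rw [← h]
  change stdSymplecticForm J ![fun j : J => fderiv ℝ (hc.chartExt e') y u j,
    fun j : J => fderiv ℝ (hc.chartExt e') y v j] = _
  rw [hcoord, hcoord]
  change _ = stdSymplecticForm J (fun i => fderiv ℝ (T'.vertexLift e') y (![u, v] i))
  congr 1
  ext i; fin_cases i <;> rfl

open Classical in
/-- The slice of the normals at a vertex of `Δ_𝔨`, for the map `ℝ^d → V / 𝔨`. -/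
noncomputable def vertexSlice (hc : T.IsCut 𝔨 J T') (e' : T'.VertexIndex) : Slice (T.redMap 𝔨) :=
  Slice.ofBasis (T.redMap 𝔨) (hc.vertexEmb e') (T'.vertexBasis e') fun h => by
    rw [vertexBasis_apply, redMap_single, hc.normal_eq]
    rfl

theorem chartExt_eq_norm (hc : T.IsCut 𝔨 J T') (e' : T'.VertexIndex)
    (y : Fin (Module.finrank ℝ (V ⧸ 𝔨)) → ℂ) {j : ι} (hj : j ∉ (hc.vertexSlice e').support) :
    hc.chartExt e' y j = ‖hc.chartExt e' y j‖ := by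
  by_cases hJ : j ∈ J
  · have h1 : (⟨j, hJ⟩ : J) ∉ Set.range e'.1 := fun ⟨h, hh⟩ => hj ⟨h, congrArg Subtype.val hh⟩
    have h2 : hc.chartExt e' y j = T'.vertexLift e' y ⟨j, hJ⟩ := cutExt_apply T T' _ ⟨j, hJ⟩
    rw [h2]
    exact T'.vertexLift_eq_norm e' y h1
  · exact cutExt_eq_norm T T' _ hJ

theorem chartExt_ne_zero (hc : T.IsCut 𝔨 J T') (e' : T'.VertexIndex)
    {y : Fin (Module.finrank ℝ (V ⧸ 𝔨)) → ℂ} (hy : y ∈ T'.vertexDom e') {j : ι}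
    (hj : j ∉ (hc.vertexSlice e').support) : hc.chartExt e' y j ≠ 0 := by
  by_cases hJ : j ∈ J
  · have h1 : (⟨j, hJ⟩ : J) ∉ Set.range e'.1 := fun ⟨h, hh⟩ => hj ⟨h, congrArg Subtype.val hh⟩
    have h2 : hc.chartExt e' y j = T'.vertexLift e' y ⟨j, hJ⟩ := cutExt_apply T T' _ ⟨j, hJ⟩
    rw [h2]
    exact T'.vertexLift_ne_zero e' hy h1
  · exact hc.ne_zero_of_notMem (hc.chartExt_mem e' hy) hJ

/-- A point of the level set with positive coordinates outside of a vertex of `Δ_𝔨` is the lift of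
its coordinates at the vertex. -/
theorem chartExt_comp (hc : T.IsCut 𝔨 J T') (e' : T'.VertexIndex) {w : ι → ℂ}
    (hw : w ∈ T.redLevel 𝔨) (hreal : ∀ j ∉ (hc.vertexSlice e').support, w j = ‖w j‖)
    (h0 : ∀ j ∉ (hc.vertexSlice e').support, w j ≠ 0) :
    (fun h => w (hc.vertexEmb e' h)) ∈ T'.vertexDom e' ∧
      hc.chartExt e' (fun h => w (hc.vertexEmb e' h)) = w := by
  have hoff : ∀ j : J, j ∉ Set.range e'.1 → (j : ι) ∉ (hc.vertexSlice e').support :=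
    fun j hj ⟨h, hh⟩ => hj ⟨h, Subtype.ext hh⟩
  obtain ⟨h1, h2⟩ := T'.vertexLift_comp e' (hc.restrict_mem hw)
    (fun j hj => hreal j (hoff j hj)) fun j hj => h0 j (hoff j hj)
  refine ⟨h1, ?_⟩
  have h3 : T'.vertexLift e' (fun h => w (hc.vertexEmb e' h)) = fun j : J => w j := h2
  rw [chartExt, h3]
  exact hc.cutExt_restrict hw fun j hj => hreal j fun ⟨h, hh⟩ => hj (hh ▸ (e'.1 h).2)

theorem rep_transport_iff (hc : T.IsCut 𝔨 J T') (e' : T'.VertexIndex)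
    {y : Fin (Module.finrank ℝ (V ⧸ 𝔨)) → ℂ} {m : T.ReducedSpace 𝔨} :
    ((T'.vertexChart e').transport hc.homeomorph.toEquiv).Rep y m ↔
      ∃ hy : y ∈ T'.vertexDom e', T.redCls 𝔨 ⟨_, hc.chartExt_mem e' hy⟩ = m := Iff.rfl

theorem rep_zeroLevel_iff (e : T.VertexIndex) {x : Fin (Module.finrank ℝ V) → ℂ}
    {m : T.zeroLevel 𝔨} : (T.vertexChart e).Rep x m ↔
      ∃ (_ : x ∈ T.vertexDom e) (hl : T.vertexLift e x ∈ T.redLevel 𝔨),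
        T.cls ⟨_, mem_levelSet_of_mem_redLevel hl⟩ = m := by
  constructor
  · rintro ⟨hx, h⟩
    refine ⟨hx, mem_redLevel_of_cls_mem (z := ⟨_, T.vertexLift_mem e hx⟩) ?_, h⟩
    have h' : T.cls ⟨_, T.vertexLift_mem e hx⟩ = m := h
    rw [h']
    exact m.2
  · rintro ⟨hx, hl, h⟩
    exact ⟨hx, h⟩

/-- The quotient map has local sections: a chart of `X_𝔨` is lifted to `ℂ^d`, turned by a constant
torus element and normalized in a chart of `M`. -/
theorem exists_section (hc : T.IsCut 𝔨 J T') (e : T.VertexIndex) (e' : T'.VertexIndex)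
    {x : Fin (Module.finrank ℝ V) → ℂ} {y : Fin (Module.finrank ℝ (V ⧸ 𝔨)) → ℂ} {a : ι → ℝ}
    (ha : T.redMap 𝔨 a ∈ T.Q.map (𝔨.mkQ : V →+ V ⧸ 𝔨)) (hx : x ∈ T.vertexDom e)
    (hy : y ∈ T'.vertexDom e') (hxy : torusExp a • hc.chartExt e' y = T.vertexLift e x) :
    ∃ (O : Set (Fin (Module.finrank ℝ (V ⧸ 𝔨)) → ℂ))
      (s : (Fin (Module.finrank ℝ (V ⧸ 𝔨)) → ℂ) → Fin (Module.finrank ℝ V) → ℂ),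
      IsOpen O ∧ y ∈ O ∧ O ⊆ T'.vertexDom e' ∧ ContDiffOn ℝ ∞ s O ∧ s y = x ∧
      (∀ y' ∈ O, ∃ m' : T.zeroLevel 𝔨, (T.vertexChart e).Rep (s y') m' ∧
        ((T'.vertexChart e').transport hc.homeomorph.toEquiv).Rep y' (T.reducedMk 𝔨 m')) ∧
      ∀ y' ∈ O, ((T.vertexChart e).form (s y')).compContinuousLinearMap (fderiv ℝ s y') =
        (T'.vertexChart e').form y' := by
  set F : (Fin (Module.finrank ℝ (V ⧸ 𝔨)) → ℂ) → ι → ℂ := fun y => torusExp a • hc.chartExt e' y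
    with hF
  have hFs : ContDiffOn ℝ ∞ F (T'.vertexDom e') :=
    (Slice.contDiff_torus_smul _).comp_contDiffOn (hc.contDiffOn_chartExt e')
  have hFm : ∀ y ∈ T'.vertexDom e', F y ∈ T.redLevel 𝔨 := fun y hy =>
    smul_mem_redLevel _ (hc.chartExt_mem e' hy)
  have hO : IsOpen (T'.vertexDom e' ∩ F ⁻¹' (T.vertexSlice e).slitSet) :=
    hFs.continuousOn.isOpen_inter_preimage (T'.isOpen_vertexDom e') (T.vertexSlice e).isOpen_slitSet
  refine ⟨T'.vertexDom e' ∩ F ⁻¹' (T.vertexSlice e).slitSet, fun y => T.chartCoord e (F y), hO,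
    ⟨hy, ?_⟩, Set.inter_subset_left, ?_, ?_, ?_, ?_⟩
  · rw [Set.mem_preimage, show F y = _ from hxy]
    exact T.vertexLift_mem_slitSet e hx
  · exact (T.contDiffOn_chartCoord e).comp (hFs.mono Set.inter_subset_left) fun _ h => h.2
  · simp only [show F y = _ from hxy, chartCoord_vertexLift]
  · rintro y' ⟨hy', hs⟩
    refine ⟨⟨_, cls_mem_zeroLevel (hFm y' hy')⟩, ?_, ?_⟩
    · exact T.rep_normalize e (mem_levelSet_of_mem_redLevel (hFm y' hy')) fun j hj =>
        Complex.slitPlane_ne_zero (hs j hj)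
    · exact (hc.rep_transport_iff e').mpr
        ⟨hy', (redCls_smul ha ⟨_, hc.chartExt_mem e' hy'⟩).symm⟩
  · rintro y' ⟨hy', hs⟩
    obtain ⟨D₀, hD₀, hform₀⟩ := hc.stdSymplecticForm_chartExt e' hy'
    obtain ⟨D, hD, hform⟩ := stdSymplecticForm_torus_smul hD₀ (torusExp a)
    ext v
    have h := T.stdSymplecticForm_chartCoord e hD hs (by
      filter_upwards [(T'.isOpen_vertexDom e').mem_nhds hy'] with z hz
      exact mem_levelSet_of_mem_redLevel (hFm z hz)) (v 0) (v 1)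
    rw [hform, hform₀] at h
    have hv : v = ![v 0, v 1] := by
      ext i; fin_cases i <;> rfl
    rw [hv]
    refine Eq.trans ?_ h
    have hdom := (T.vertexLift_chartCoord e (mem_levelSet_of_mem_redLevel (hFm y' hy')) hs).1
    rw [T.vertexChart_form e hdom]
    change stdSymplecticForm _ (fun i => fderiv ℝ _ y' (![v 0, v 1] i)) = _
    congr 1
    ext i; fin_cases i <;> rfl

/-- The quotient map lifts to smooth maps: a chart of `M` is lifted to `ℂ^d`, turned by a constant
torus element and normalized by `exp (ker (p ∘ π))`. -/
theorem exists_smooth_lift (hc : T.IsCut 𝔨 J T') (e : T.VertexIndex) (e' : T'.VertexIndex)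
    {x : Fin (Module.finrank ℝ V) → ℂ} {y : Fin (Module.finrank ℝ (V ⧸ 𝔨)) → ℂ} {a : ι → ℝ}
    (ha : T.redMap 𝔨 a ∈ T.Q.map (𝔨.mkQ : V →+ V ⧸ 𝔨)) (hx : x ∈ T.vertexDom e)
    (hy : y ∈ T'.vertexDom e') (hxy : torusExp a • T.vertexLift e x = hc.chartExt e' y) :
    ∃ (O : Set (Fin (Module.finrank ℝ V) → ℂ))
      (r : (Fin (Module.finrank ℝ V) → ℂ) → Fin (Module.finrank ℝ (V ⧸ 𝔨)) → ℂ),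
      IsOpen O ∧ x ∈ O ∧ O ⊆ T.vertexDom e ∧ ContDiffOn ℝ ∞ r O ∧ r x = y ∧
      (∀ x' ∈ O, ∀ m' : T.zeroLevel 𝔨, (T.vertexChart e).Rep x' m' →
        ((T'.vertexChart e').transport hc.homeomorph.toEquiv).Rep (r x') (T.reducedMk 𝔨 m')) ∧
      ∀ x' ∈ O, ∀ m' : T.zeroLevel 𝔨, (T.vertexChart e).Rep x' m' →
        ∀ u ∈ tangentConeAt ℝ {z | ∃ m'' : T.zeroLevel 𝔨, (T.vertexChart e).Rep z m''} x',
        ∀ v ∈ tangentConeAt ℝ {z | ∃ m'' : T.zeroLevel 𝔨, (T.vertexChart e).Rep z m''} x',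
          (T'.vertexChart e').form (r x') ![fderiv ℝ r x' u, fderiv ℝ r x' v] =
            (T.vertexChart e).form x' ![u, v] := by
  set σ := hc.vertexSlice e'
  set F : (Fin (Module.finrank ℝ V) → ℂ) → ι → ℂ := fun x => torusExp a • T.vertexLift e x with hF
  have hFs : ContDiffOn ℝ ∞ F (T.vertexDom e) := T.contDiffOn_torus_smul_vertexLift e _
  have hO : IsOpen (T.vertexDom e ∩ F ⁻¹' σ.slitSet) :=
    hFs.continuousOn.isOpen_inter_preimage (T.isOpen_vertexDom e) σ.isOpen_slitSet
  set r : (Fin (Module.finrank ℝ V) → ℂ) → Fin (Module.finrank ℝ (V ⧸ 𝔨)) → ℂ :=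
    fun x h => σ.normalize (F x) (hc.vertexEmb e' h) with hr
  -- on the level set, the lift of `r x'` to `ℂ^d` is the normalization of `F x'`
  have hspec : ∀ x' ∈ T.vertexDom e ∩ F ⁻¹' σ.slitSet, T.vertexLift e x' ∈ T.redLevel 𝔨 →
      r x' ∈ T'.vertexDom e' ∧ hc.chartExt e' (r x') = σ.normalize (F x') := by
    rintro x' ⟨hx', hs⟩ hl
    refine hc.chartExt_comp e' (smul_mem_redLevel _ (smul_mem_redLevel _ hl)) (fun j hj => ?_)
      fun j hj => ?_
    · refine (σ.normalize_apply (F x') hj).trans ?_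
      rw [σ.norm_normalize]
    · rw [σ.normalize_apply (F x') hj]
      exact_mod_cast norm_ne_zero_iff.mpr (Complex.slitPlane_ne_zero (hs j hj))
  refine ⟨T.vertexDom e ∩ F ⁻¹' σ.slitSet, r, hO, ⟨hx, ?_⟩, Set.inter_subset_left, ?_, ?_, ?_, ?_⟩
  · rw [Set.mem_preimage, show F x = _ from hxy]
    exact σ.mem_slitSet (fun j hj => hc.chartExt_eq_norm e' y hj) fun j hj =>
      hc.chartExt_ne_zero e' hy hj
  · rw [contDiffOn_pi]
    exact fun h => (contDiff_apply ℝ ℂ _).comp_contDiffOn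
      (σ.contDiffOn_normalize.comp (hFs.mono Set.inter_subset_left) fun _ h => h.2)
  · ext h
    simp only [hr, show F x = _ from hxy]
    rw [σ.normalize_eq_self fun j hj => hc.chartExt_eq_norm e' y hj]
    exact hc.chartExt_vertexEmb e' y h
  · rintro x' hx' m' hm'
    obtain ⟨hxd, hl, hm⟩ := (rep_zeroLevel_iff e).mp hm'
    obtain ⟨h1, h2⟩ := hspec x' hx' hl
    refine (hc.rep_transport_iff e').mpr ⟨h1, ?_⟩
    have h3 : T.reducedMk 𝔨 m' = T.redCls 𝔨 ⟨_, hl⟩ :=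
      congrArg (T.reducedMk 𝔨) (Subtype.ext hm.symm)
    rw [h3, ← redCls_smul ha ⟨_, hl⟩, ← redCls_normalize (σ := σ) (smul_mem_redLevel _ hl)]
    exact congrArg (T.redCls 𝔨) (Subtype.ext h2)
  · rintro x' hx' m' hm' u hu v hv
    obtain ⟨hxd, hl, -⟩ := (rep_zeroLevel_iff e).mp hm'
    rw [T'.vertexChart_form e' (hspec x' hx' hl).1]
    obtain ⟨D, hD, hform⟩ := T.stdSymplecticForm_smul_vertexLift e hxd (torusExp a)
    rw [← hform]
    refine σ.stdSymplecticForm_normalize_comp (hc.vertexEmb e') rfl hD hx'.2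
      (s := {z | ∃ m'' : T.zeroLevel 𝔨, (T.vertexChart e).Rep z m''}) (lam := T.lam) ⟨m', hm'⟩
      (fun z hz b hb => ?_) hu hv
    obtain ⟨m'', hm''⟩ := hz
    obtain ⟨-, hl', -⟩ := (rep_zeroLevel_iff e).mp hm''
    exact sum_mul_eq_zero_of_mem_redLevel (smul_mem_redLevel _ hl') hb

/-- The reduced structure is the structure of `X_𝔨`, transported to `M_𝔨`: the standard form of
`ℂ^d` restricts to both `ω` and `ω_𝔨`, and torus rotations preserve it along the level set. -/
theorem isReduction (hc : T.IsCut 𝔨 J T') :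
    T.atlas.IsReduction (T.zeroLevel 𝔨 : Set T.Space) (T.reducedMk 𝔨)
      (T'.atlas.transport hc.homeomorph.toEquiv) := by
  intro e e' x y m hx hy
  obtain ⟨hxd, hl, hm⟩ := (rep_zeroLevel_iff (m := m) e).mp hx
  obtain ⟨hyd, hym⟩ := (hc.rep_transport_iff e').mp hy
  have h3 : T.redCls 𝔨 ⟨_, hl⟩ = T.reducedMk 𝔨 m := congrArg (T.reducedMk 𝔨) (Subtype.ext hm)
  obtain ⟨a, ha, h⟩ := (redCls_eq_iff _ _).mp (hym.trans h3.symm)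
  refine ⟨hc.exists_section e e' (a := -a) ?_ hxd hyd ?_, hc.exists_smooth_lift e e' ha hxd hyd h⟩
  · rw [map_neg]
    exact neg_mem ha
  · have h' : torusExp a • T.vertexLift e x = hc.chartExt e' y := h
    rw [← h', torusExp_neg, inv_smul_smul]

end IsCut

end ToricTriple

theorem theorem2p3 {V : Type*} [AddCommGroup V] [Module ℝ V] [FiniteDimensional ℝ V]
    {ι : Type} [Fintype ι] (n k : ℕ) (hn : Module.finrank ℝ V = n)
    -- the triple `(Δ, {X_1, …, X_d}, Q)` and the subspace `𝔨`
    (T : ToricTriple V ι) (𝔨 : Submodule ℝ V) (hk : Module.finrank ℝ 𝔨 = k)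
    -- `0` is a value of `Φ_𝔨`
    (h0 : ∃ m, T.Φk 𝔨 m = 0)
    -- `K` acts on `Φ_𝔨⁻¹(0)` with `0`-dimensional isotropy groups
    (hiso : ∀ m : T.zeroLevel 𝔨, Countable (AddAction.stabilizer (T.K 𝔨) m))
    -- `J` is the set of indices of an irredundant choice of half-spaces defining `Δ_𝔨`
    (J : Finset ι)
    (hJ : Minimal (fun J' : Finset ι =>
      halfSpaceInter (fun j => 𝔨.mkQ (T.normal j)) T.lam (J' : Set ι) =
        {ν | 𝔨.mkQ.dualMap ν ∈ T.polyhedron}) J) :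
    -- the triple `(Δ_𝔨, {p(X_j)}, p(Q))`
    ∃ T' : ToricTriple (V ⧸ 𝔨) J,
      (T'.polyhedron = {ν | 𝔨.mkQ.dualMap ν ∈ T.polyhedron}) ∧
      (∀ j : J, T'.normal j = 𝔨.mkQ (T.normal j)) ∧ (∀ j : J, T'.lam j = T.lam j) ∧
      T'.Q = T.Q.map (𝔨.mkQ : V →+ V ⧸ 𝔨) ∧
      -- its symplectic toric quasifold `X_𝔨`
      T'.atlas.IsSymplecticQuasifold (2 * (n - k)) ∧
      -- the reduced symplectic quasifold structure of `M_𝔨`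
      ∃ B : SymplecticAtlas (Fin (Module.finrank ℝ (V ⧸ 𝔨)) → ℂ) (T.ReducedSpace 𝔨),
        B.IsSymplecticQuasifold (2 * (n - k)) ∧
        T.atlas.IsReduction (T.zeroLevel 𝔨 : Set T.Space) (T.reducedMk 𝔨) B ∧
        -- the Hamiltonian action of `D / K`
        B.IsHamiltonianAction (T.residualExp 𝔨) (T.reducedMoment 𝔨) ∧
        -- the identification of `D / K` with `(V / 𝔨) / p(Q)`
        ∃ θ : ((V ⧸ T.Q) ⧸ T.K 𝔨) ≃+ (V ⧸ 𝔨) ⧸ T'.Q,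
          (∀ v : V, θ (QuotientAddGroup.mk (QuotientAddGroup.mk v : V ⧸ T.Q)) =
            QuotientAddGroup.mk (𝔨.mkQ v)) ∧
          -- the equivariant symplectomorphism, which intertwines the moment mappings
          ∃ g : T.ReducedSpace 𝔨 ≃ₜ T'.Space,
            B.IsSymplectomorphism T'.atlas g ∧
            (∀ (δ : (V ⧸ T.Q) ⧸ T.K 𝔨) (m : T.ReducedSpace 𝔨), g (δ +ᵥ m) = θ δ +ᵥ g m) ∧
            (∀ m, T'.Φ (g m) = T.reducedMoment 𝔨 m) := by
  obtain ⟨T', hc⟩ := T.exists_isCut 𝔨 h0 hiso J hJ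
  have hdim : Module.finrank ℝ (V ⧸ 𝔨) = n - k := by
    have := Submodule.finrank_quotient_add_finrank 𝔨
    omega
  have hquasi : T'.atlas.IsSymplecticQuasifold (2 * (n - k)) := by
    rw [← hdim]
    exact T'.isSymplecticQuasifold_atlas
  have hθ : ∀ w, hc.residualEquiv (T.residualExp 𝔨 w) = QuotientAddGroup.mk' T'.Q w :=
    hc.residualEquiv_residualExp
  refine ⟨T', hc.polyhedron_eq, hc.normal_eq, hc.lam_eq, hc.Q_eq, hquasi,
    T'.atlas.transport hc.homeomorph.toEquiv, hquasi.transport hc.homeomorph, hc.isReduction,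
    T'.isHamiltonianAction_atlas.transport hc.homeomorph.toEquiv
      ToricTriple.residualExp_surjective hc.homeomorph_vadd hc.Φ_homeomorph,
    hc.residualEquiv, fun v => hθ (𝔨.mkQ v), hc.homeomorph,
    hquasi.isSymplectomorphism_transport hc.homeomorph, fun δ m => ?_, hc.Φ_homeomorph⟩
  obtain ⟨w, rfl⟩ := ToricTriple.residualExp_surjective δ
  rw [hc.homeomorph_vadd, hθ]
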